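/- **Model.** Two i.i.d. endowment states $1,2$ have probabilities $\pi(1)=\pi\in(0,1)$ and $\pi(2)=1-\pi$. The endowment shares of the young are $s(1)=\kappa-\epsilon(1-\pi)/\pi$ and $s(2)=\kappa+\epsilon$, with $0<s(1)<s(2)<1$, $\kappa\ge\tfrac12$ and $\epsilon>0$. Let $\beta\in(0,1]$ and $\delta\in(0,1)$. A rule $c$ assigns to each history $(s_0,\dots,s_t)$ a consumption share $c>0$ of the young. It is sustainable if after every history, with current share $s$, $c\le s$ and $\log c+\beta\sum_r\pi(r)\log(1-c_r)\ge\hat\upsilon(s):=\log s+\beta\sum_r\pi(r)\log(1-r)$, where $c_r$ is consumption next period in state $r$. (States are identified with shares.) Let $V(s,\omega)$ be the supremum of $\mathbb E\sum_t\delta^t\big[\tfrac\beta\delta\log(1-c_t)+\log c_t\big]$ over sustainable rules with $s_0=s$ and $\log(1-c_0)\ge\omega$. **Debt and policies.** Debt $d$ in state $s$ corresponds to the promise $\omega=\log(1-s+sd)$ to the old. The debt limit $d_{\max}$ is the largest solution in $[0,1)$ of $\log(1-d)+\beta\sum_r\pi(r)[\log(1-r+rd)-\log(1-r)]=0$. Put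 $\Omega(s)=[\log(1-s),\log(1-s+sd_{\max})]$. Let $\omega^0(s)$ be the largest maximizer of $V(s,\cdot)$ on $\Omega(s)$ and $d^0(s)$ the corresponding debt. Given $x=(s,d)$ with promise $\omega$, the planner chooses $c>0$ and $\omega_r\in\Omega(r)$ to maximize $\frac\beta\delta\log(1-c)+\log c+\delta\sum_r\pi(r)V(r,\omega_r)$ subject to $\log(1-c)\ge\omega$, $c\le s$ and $\log c+\beta\sum_r\pi(r)\omega_r\ge\hat\upsilon(s)$; optimal promises are normalized by $\omega_r\ge\omega^0(r)$. Let $b_r(x)$ be the debt corresponding to the optimal $\omega_r$. The Markov chain moves from $x$ to $(r,b_r(x))$ with probability $\pi(r)$; its transition probabilities are denoted $P(x,x')$. Let $d^c=1-\exp\!\big(-\beta\sum_r\pi(r)[\log(1-r+rd^0(r))-\log(1-r)]\big)$. Let $c^*(s)=\min\{\delta/(\beta+\delta),s\}$ be the first best and $d^*(s)=1-c^*(s)/s$. Set $d^{(0)}(s)=d^0(s)$ and $d^{(n+1)}(s)=b_s(2,d^{(n)}(2))$, the debt in state $s$ after $n+1$ consecutive state 2s. **Assumptions.** $s(1)\le\delta/(\beta+\delta)$;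 the first best violates the participation constraint of the young in state 2, i.e. $\log c^*(2)+\beta\sum_r\pi(r)\log(1-c^*(r))<\hat\upsilon(s(2))$; $d^*(2)<d_{\max}$; and $b_1(2,d^*(2))<d^c$. **Proposition.** (i) For either starting point $(i,d^0(i))$, the set $E$ of states reached with positive probability at some date $k\ge1$ is $E=\{(s,d^{(n)}(s)):n\ge0,\ s=1,2\}$. It is an ergodic set (it is absorbing and no proper subset is). There is a unique invariant distribution $\phi$ on $E$, and it is the image of a geometric distribution: $$\phi(s,d)=\sum_{n:\,d^{(n)}(s)=d}\pi(s)\,\pi\,(1-\pi)^n .$$ Moreover $\phi(2,d^{(n)}(2))=\pi(1-\pi)(1-\pi)^n$ for all $n\ge 0$. If the lower bound on debt does not bind, i.e. $s(1)=\delta/(\beta+\delta)$, then for each $s$ the levels $d^{(n)}(s)$, $n\ge0$, are distinct, and $\phi(s,d^{(n)}(s))=\phi(s,d^0(s))(1-\pi)^n$ for $n\ge1$ and $s=1,2$, with $\phi(1,d^0(1))=\pi^2$ and $\phi(2,d^0(2))=\pi(1-\pi)$. (ii) Suppose $s(1)=\delta/(\beta+\delta)$. Let $Q$ be the matrix on $E$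 of growth-adjusted state prices $q(x,x')=P(x,x')\,\beta c(x)/(1-c(x'))$, where $c(s,d)=s(1-d)$. Then $Q$ has a Perron eigenvector: $Q\psi=\varrho\psi$ with $\psi$ bounded above and bounded away from $0$. For every such $\psi$, $\Upsilon:=\log(\sup_E\psi/\inf_E\psi)$ satisfies $\Upsilon=\log(\delta/\beta)-\log(\chi^{-1}-1)$, where $$\chi=\left(\tfrac{\delta}{\beta}\right)^{\frac{1-\pi}{\pi}}\left(\tfrac{\beta+\delta}{\delta}\right)^{\frac{1+\beta(1-\pi)}{\beta\pi}}(\kappa+\epsilon)^{\frac1{\beta\pi}}(1-\kappa-\epsilon)^{\frac{1-\pi}{\pi}}\left(1-\kappa+\epsilon\tfrac{1-\pi}{\pi}\right).$$ -/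

import Mathlib

noncomputable section

namespace IntergenInsurance

/-- Primitives of the economy with i.i.d. endowment shares: `share r` is the endowment share of the
young in state `r`, `prob r` its probability, `β` the agents' and `δ` the planner's discount factor.
All quantities are expressed as shares of the aggregate endowment. -/
structure Economy (ι : Type) where
  share : ι → ℝ
  prob : ι → ℝ
  β : ℝ
  δ : ℝ

/-- An insurance rule: the consumption share of the young after each history `(s_0, …, s_t)`. -/
abbrev Rule (ι : Type) := (t : ℕ) → (Fin (t + 1) → ι) → ℝ

/-- A state of the Markov chain: the endowment state and the debt outstanding. -/
abbrev State (ι : Type) := ι × ℝ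

namespace Economy

variable {ι : Type} [Fintype ι] (e : Economy ι)

/-! ### Sustainable rules and the planner's value -/

/-- Lifetime utility in autarky of a young agent born in state `s`. -/
def autarky (s : ι) : ℝ :=
  Real.log (e.share s) + e.β * ∑ r, e.prob r * Real.log (1 - e.share r)

/-- A rule is sustainable if consumption is positive, the old never transfer to the young, and the
young always get at least their autarkic lifetime utility. -/
def Sustainable (c : Rule ι) : Prop :=
  ∀ (t : ℕ) (h : Fin (t + 1) → ι),
    0 < c t h ∧ c t h ≤ e.share (h (Fin.last t)) ∧
    e.autarky (h (Fin.last t)) ≤ Real.log (c t h) +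
      e.β * ∑ r, e.prob r * Real.log (1 - c (t + 1) (Fin.snoc (α := fun _ => ι) h r))

/-- The planner's per-period payoff from consumption share `c` of the young. -/
def flow (c : ℝ) : ℝ := e.β / e.δ * Real.log (1 - c) + Real.log c

/-- The planner's expected discounted payoff from a rule, given the initial state. -/
def payoff (s₀ : ι) (c : Rule ι) : ℝ :=
  ∑' t : ℕ, e.δ ^ t * ∑ h : Fin t → ι,
    (∏ k, e.prob (h k)) * e.flow (c t (Fin.cons (α := fun _ => ι) s₀ h))

/-- The planner's value when the initial old must get utility at least `ω`. -/
def value (s : ι) (ω : ℝ) : ℝ :=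
  sSup (e.payoff s '' {c | e.Sustainable c ∧ ω ≤ Real.log (1 - c 0 (fun _ => s))})

/-! ### Debt and promised utility -/

/-- The promised utility corresponding to debt `d` (relative to the share of the young). -/
def promise (s : ι) (d : ℝ) : ℝ := Real.log (1 - e.share s + e.share s * d)

/-- The debt corresponding to the promised utility `ω`; the inverse of `promise`. -/
def debt (s : ι) (ω : ℝ) : ℝ := (Real.exp ω - (1 - e.share s)) / e.share s

/-- The debt limit: the largest solution in `[0, 1)` of the stated equation (of which `0` is the
trivial solution). -/
def debtLimit : ℝ :=
  sSup {d | 0 ≤ d ∧ d < 1 ∧ Real.log (1 - d) + e.β * ∑ r, e.prob r *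
    (Real.log (1 - e.share r + e.share r * d) - Real.log (1 - e.share r)) = 0}

/-- The set of feasible promises in state `s`: the lower end is the autarkic utility of the old, the
upper end corresponds to the debt limit. -/
def promises (s : ι) : Set ℝ := Set.Icc (Real.log (1 - e.share s)) (e.promise s e.debtLimit)

/-- The largest promise that maximizes the planner's value in state `s`. -/
def resetPromise (s : ι) : ℝ :=
  sSup {ω | ω ∈ e.promises s ∧ ∀ ω' ∈ e.promises s, e.value s ω' ≤ e.value s ω}

/-- The debt level to which debt is reset in state `s`. -/
def resetDebt (s : ι) : ℝ := e.debt s (e.resetPromise s)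

/-! ### The recursive problem and its policy functions -/

/-- The constraint set of the recursive problem; a choice is the consumption share of the young
together with the state-contingent promises for the next period. -/
def Feasible (s : ι) (ω : ℝ) (a : ℝ × (ι → ℝ)) : Prop :=
  0 < a.1 ∧ ω ≤ Real.log (1 - a.1) ∧ a.1 ≤ e.share s ∧ (∀ r, a.2 r ∈ e.promises r) ∧
  e.autarky s ≤ Real.log a.1 + e.β * ∑ r, e.prob r * a.2 r

/-- The objective of the recursive problem. -/
def objective (a : ℝ × (ι → ℝ)) : ℝ :=
  e.flow a.1 + e.δ * ∑ r, e.prob r * e.value r (a.2 r)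

/-- An optimal choice in the recursive problem. As the value is flat in the promise below
`resetPromise r`, the promises are normalized to be at least `resetPromise r`. -/
def IsOptimalChoice (s : ι) (ω : ℝ) (a : ℝ × (ι → ℝ)) : Prop :=
  e.Feasible s ω a ∧ (∀ a', e.Feasible s ω a' → e.objective a' ≤ e.objective a) ∧
  ∀ r, e.resetPromise r ≤ a.2 r

/-- The optimal policy in state `(s, ω)`. -/
def policy (s : ι) (ω : ℝ) : ℝ × (ι → ℝ) := Classical.epsilon (e.IsOptimalChoice s ω)

/-- The debt policy function: optimal debt next period in state `r` if the current state is `x`. -/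
def nextDebt (x : State ι) (r : ι) : ℝ := e.debt r ((e.policy x.1 (e.promise x.1 x.2)).2 r)

/-- The debt level up to which resetting next period is compatible with the participation
constraint of the young. -/
def criticalDebt : ℝ :=
  1 - Real.exp (-e.β * ∑ r, e.prob r *
    (Real.log (1 - e.share r + e.share r * e.resetDebt r) - Real.log (1 - e.share r)))

/-! ### First best -/

/-- The first-best consumption share of the young. -/
def firstBest (s : ι) : ℝ := min (e.δ / (e.β + e.δ)) (e.share s)

/-- The first-best debt. -/
def firstBestDebt (s : ι) : ℝ := 1 - e.firstBest s / e.share s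

/-- The first best violates the participation constraint of the young in state `s`. -/
def FirstBestViolates (s : ι) : Prop :=
  Real.log (e.firstBest s) + e.β * ∑ r, e.prob r * Real.log (1 - e.firstBest r) < e.autarky s

/-! ### The Markov chain of endowment state and debt -/

open scoped Classical in
/-- Transition probability: from `x` the chain moves to `(r, nextDebt x r)` with probability
`prob r`. -/
def transition (x x' : State ι) : ℝ := ∑ r, if (r, e.nextDebt x r) = x' then e.prob r else 0

/-- The states that the chain started at the resetting level in state `i` reaches with positive
probability at some date `k ≥ 1`. -/
def ergodicSet (i : ι) : Set (State ι) :=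
  {x | Relation.TransGen (fun y y' => 0 < e.transition y y') (i, e.resetDebt i) x}

/-- `E` is nonempty and the chain never leaves it. -/
def Absorbing (E : Set (State ι)) : Prop :=
  E.Nonempty ∧ ∀ x ∈ E, ∀ x', 0 < e.transition x x' → x' ∈ E

/-- `E` is ergodic: absorbing, and no proper subset is absorbing. -/
def Ergodic (E : Set (State ι)) : Prop :=
  e.Absorbing E ∧ ∀ E' ⊆ E, e.Absorbing E' → E' = E

/-- `φ` is the probability mass function of an invariant distribution on `E`. -/
def IsInvariant (E : Set (State ι)) (φ : State ι → ℝ) : Prop :=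
  (∀ x, 0 ≤ φ x) ∧ (∀ x, x ∉ E → φ x = 0) ∧ HasSum (fun x : E => φ x) 1 ∧
  ∀ x' ∈ E, HasSum (fun x : E => φ x * e.transition x x') (φ x')

/-! ### State prices and the Martin-Ross measure -/

/-- Consumption share of the young in state `x`. -/
def consumption (x : State ι) : ℝ := e.share x.1 * (1 - x.2)

/-- State price (growth-adjusted): transition probability times the intertemporal marginal rate of
substitution with logarithmic utility. -/
def statePrice (x x' : State ι) : ℝ :=
  e.transition x x' * (e.β * e.consumption x / (1 - e.consumption x'))

/-- `ϱ` and `ψ` are a Perron root and eigenvector of the matrix of state prices on `E`. On a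
countable `E` the eigenvector is required to be bounded and bounded away from zero, so that `ϱ` is
the spectral radius of the matrix on bounded functions; on a finite `E` this is just positivity. -/
def IsPerronPair (E : Set (State ι)) (ϱ : ℝ) (ψ : State ι → ℝ) : Prop :=
  (∃ m M : ℝ, 0 < m ∧ ∀ x ∈ E, m ≤ ψ x ∧ ψ x ≤ M) ∧
  ∀ x ∈ E, HasSum (fun x' : E => e.statePrice x x' * ψ x') (ϱ * ψ x)

end Economy

/-- The Martin-Ross measure of an eigenvector `ψ`: the logarithm of the ratio of its largest and
smallest values on `E`. -/
def martinRoss {ι : Type} (E : Set (State ι)) (ψ : State ι → ℝ) : ℝ :=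
  Real.log (sSup (ψ '' E) / sInf (ψ '' E))

/-! ### The two-state example; states 1 and 2 are `0 1 : Fin 2` -/

/-- The two-state economy, with `p` the probability of state 1. -/
def twoState (β δ p κ ε : ℝ) : Economy (Fin 2) where
  share := ![κ - ε * (1 - p) / p, κ + ε]
  prob := ![p, 1 - p]
  β := β
  δ := δ

/-- Debt in state `s` after `n` consecutive occurrences of state 2, starting from resetting. -/
def debtAfter (e : Economy (Fin 2)) : ℕ → Fin 2 → ℝ
  | 0, s => e.resetDebt s
  | n + 1, s => e.nextDebt (1, debtAfter e n 1) s

/-- The constant in the closed form of the Martin-Ross measure. -/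
def chi (β δ p κ ε : ℝ) : ℝ :=
  (δ / β) ^ ((1 - p) / p) * ((β + δ) / δ) ^ ((1 + β * (1 - p)) / (β * p)) *
    (κ + ε) ^ (1 / (β * p)) * (1 - κ - ε) ^ ((1 - p) / p) * (1 - κ + ε * (1 - p) / p)

end IntergenInsurance

end

/-! The plan is to turn the planner's problem into a concave dynamic program, to read first-order
conditions off it without assuming differentiability, and to solve the resulting recursion along
runs of state 2.

Foundations. The surplus is strictly concave and vanishes at 0, so `debtLimit` is its only positive
zero, and no sustainable rule carries more debt (`Sustainable.lower_bound`). Sustainable rules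
therefore form a compact convex set on which the payoff is continuous and concave. Optimal rules
exist, the value V(s,·) is concave and antitone, strictly decreasing beyond the reset promise, and
the Bellman equation holds. Given the young's consumption, the continuation problem has one
multiplier: a supergradient of `continuation` yields a common supergradient of every V(r,·) at the
chosen promises (`isSupergradient_value`).

Dynamics. Let w* be the first-best promise, and write T(w), B(w) for the next promises to the rich
and poor states after promise w in the rich state. In the poor state, up to the critical debt, the
planner resets, so V(0,·) is explicit (`value_poor`). A perturbation argument gives T(w*) = w* and w
< T(w) for w < w* (`next_best_le`, `best_le_next`). Varying only the poor promise yields a smooth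
minorant of V(1,·), hence its derivative where there is room to vary. It follows that T(w) < w* and
B(w) ≤ B(w*) below w* (`next_lt_best`, `next_poor_le`). So the rich debts increase strictly along a
run of state 2, and every poor debt reached leads back to resetting. The chain is thus a function of
the current state and the number of preceding state 2s, which is geometric. This gives the ergodic
set and the invariant distribution.

Closed form. If the lower bound on debt does not bind, equating derivatives gives odds(b n) = (δ/β)
· odds(b (n+1)) · odds(w n) for the poor and rich promises b, w along the path (`odds_path`), where
odds is the ratio of old to young consumption. Then b is strictly increasing, w tends to w*, and
binding participation determines the limit of b, whose exponential is χ. The same identity factors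
the state prices as q(x,x') = δ P(x,x') ψ(x)/ψ(x') with `perron` as ψ. Hence δ is a Perron root,
every Perron eigenvector is ψ times a bounded positive function with constant conditional
expectation, hence a multiple of ψ, and the extreme values of ψ give the Martin-Ross measure. -/

namespace IntergenInsurance

set_option linter.unusedSectionVars false

open Set Filter Topology

namespace Economy

variable {ι : Type} [Fintype ι] {e : Economy ι}

/-! ### The surplus function and the debt limit. -/

/-- The standing assumptions on the primitives, together with a positive debt limit. -/
structure Regular (e : Economy ι) : Prop where
  share_pos : ∀ r, 0 < e.share r
  share_lt_one : ∀ r, e.share r < 1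
  prob_pos : ∀ r, 0 < e.prob r
  prob_sum : ∑ r, e.prob r = 1
  β_pos : 0 < e.β
  δ_pos : 0 < e.δ
  δ_lt_one : e.δ < 1
  debtLimit_pos : 0 < e.debtLimit

/-- The surplus of the young over autarky when debt is `d` today and tomorrow. -/
noncomputable def surplus (e : Economy ι) (d : ℝ) : ℝ :=
  Real.log (1 - d) + e.β * ∑ r, e.prob r *
    (Real.log (1 - e.share r + e.share r * d) - Real.log (1 - e.share r))

theorem log_mix_le {x y a b : ℝ} (hx : 0 < x) (hy : 0 < y) (ha : 0 ≤ a) (hb : 0 ≤ b)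
    (hab : a + b = 1) : a * Real.log x + b * Real.log y ≤ Real.log (a * x + b * y) := by
  have := strictConcaveOn_log_Ioi.concaveOn.2 (mem_Ioi.2 hx) (mem_Ioi.2 hy) ha hb hab
  simpa using this

theorem Regular.surplus_strictConcaveOn (he : e.Regular) :
    StrictConcaveOn ℝ (Ico 0 1) e.surplus := by
  refine ⟨convex_Ico 0 1, ?_⟩
  intro x hx y hy hxy a b ha hb hab
  have h1 : a * Real.log (1 - x) + b * Real.log (1 - y) < Real.log (1 - (a * x + b * y)) := by
    have := strictConcaveOn_log_Ioi.2 (mem_Ioi.2 (sub_pos.2 hx.2)) (mem_Ioi.2 (sub_pos.2 hy.2))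
      (fun h => hxy (by linarith)) ha hb hab
    have h2 : a * (1 - x) + b * (1 - y) = 1 - (a * x + b * y) := by linear_combination hab
    simpa [h2] using this
  have h2 : ∀ r, a * Real.log (1 - e.share r + e.share r * x) +
      b * Real.log (1 - e.share r + e.share r * y) ≤
      Real.log (1 - e.share r + e.share r * (a * x + b * y)) := by
    intro r
    have hs := he.share_pos r
    have hs1 := he.share_lt_one r
    have := log_mix_le (x := 1 - e.share r + e.share r * x) (y := 1 - e.share r + e.share r * y)
      (by nlinarith [hx.1]) (by nlinarith [hy.1]) ha.le hb.le hab
    refine this.trans (le_of_eq ?_)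
    congr 1
    linear_combination (1 - e.share r) * hab
  have h3 : a * (∑ r, e.prob r *
      (Real.log (1 - e.share r + e.share r * x) - Real.log (1 - e.share r))) +
      b * (∑ r, e.prob r *
      (Real.log (1 - e.share r + e.share r * y) - Real.log (1 - e.share r))) ≤
      ∑ r, e.prob r * (Real.log (1 - e.share r + e.share r * (a * x + b * y)) -
        Real.log (1 - e.share r)) := by
    rw [Finset.mul_sum, Finset.mul_sum, ← Finset.sum_add_distrib]
    refine Finset.sum_le_sum fun r _ => ?_
    have h4 := mul_le_mul_of_nonneg_left (h2 r) (he.prob_pos r).le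
    have h5 : a * (e.prob r * Real.log (1 - e.share r)) + b * (e.prob r * Real.log (1 - e.share r))
      = e.prob r * Real.log (1 - e.share r) := by rw [← add_mul, hab, one_mul]
    nlinarith [h4, h5]
  have h4 := mul_le_mul_of_nonneg_left h3 he.β_pos.le
  simp only [surplus, smul_eq_mul]
  linarith

theorem surplus_zero : e.surplus 0 = 0 := by
  simp [surplus]

/-- A strictly concave function vanishing at 0 lies strictly above its chords from the origin. So
there is at most one positive zero, and the surplus is negative beyond it. -/
theorem Regular.mul_surplus_lt (he : e.Regular) {z y : ℝ} (hz : 0 < z) (hzy : z < y) (hy : y < 1) :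
    z / y * e.surplus y < e.surplus z := by
  have hy0 := hz.trans hzy
  have h := he.surplus_strictConcaveOn.2 (⟨le_rfl, one_pos⟩ : (0 : ℝ) ∈ Ico (0 : ℝ) 1)
    (⟨hy0.le, hy⟩ : y ∈ Ico (0 : ℝ) 1) hy0.ne (sub_pos.2 ((div_lt_one hy0).2 hzy))
    (div_pos hz hy0) (by ring)
  simpa only [smul_eq_mul, mul_zero, zero_add, div_mul_cancel₀ _ hy0.ne', surplus_zero] using h

theorem Regular.debtLimit_mem (he : e.Regular) :
    0 < e.debtLimit ∧ e.debtLimit < 1 ∧ e.surplus e.debtLimit = 0 := by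
  obtain ⟨z, hz, hz0⟩ := exists_lt_of_lt_csSup (s := {d | 0 ≤ d ∧ d < 1 ∧ e.surplus d = 0})
    ⟨0, le_rfl, one_pos, surplus_zero⟩ he.debtLimit_pos
  have hg : IsGreatest {d | 0 ≤ d ∧ d < 1 ∧ e.surplus d = 0} z := by
    refine ⟨hz, fun y hy => ?_⟩
    by_contra! h
    have h1 := he.mul_surplus_lt hz0 h hy.2.1
    rw [hy.2.2, hz.2.2, mul_zero] at h1
    exact lt_irrefl _ h1
  have h := hg.csSup_eq
  have h' : e.debtLimit = z := h
  rw [h']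
  exact ⟨hz0, hz.2.1, hz.2.2⟩

theorem Regular.le_debtLimit (he : e.Regular) {d : ℝ} (h1 : d < 1)
    (h : 0 ≤ e.surplus d) : d ≤ e.debtLimit := by
  obtain ⟨hl0, hl1, hl⟩ := he.debtLimit_mem
  by_contra! hd
  have h3 : 0 < d := hl0.trans hd
  have h4 := he.mul_surplus_lt hl0 hd h1
  rw [hl] at h4
  have : 0 ≤ e.debtLimit / d * e.surplus d := by positivity
  linarith

/-! ### Debt and promises -/

theorem Regular.promise_debt (he : e.Regular) (s : ι) (ω : ℝ) : e.promise s (e.debt s ω) = ω := by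
  have := (he.share_pos s).ne'
  have h : 1 - e.share s + e.share s * ((Real.exp ω - (1 - e.share s)) / e.share s) = Real.exp ω := by
    field_simp; ring
  rw [promise, debt, h, Real.log_exp]

theorem Regular.promise_arg_pos (he : e.Regular) (s : ι) {d : ℝ} (hd : 0 ≤ d) :
    0 < 1 - e.share s + e.share s * d := by
  nlinarith [he.share_pos s, he.share_lt_one s]

theorem Regular.debt_promise (he : e.Regular) (s : ι) {d : ℝ} (hd : 0 ≤ d) :
    e.debt s (e.promise s d) = d := by
  have := (he.share_pos s).ne'
  rw [promise, debt, Real.exp_log (he.promise_arg_pos s hd)]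
  field_simp; ring

theorem Regular.promise_lt_promise (he : e.Regular) (s : ι) {d d' : ℝ} (hd : 0 ≤ d) (h : d < d') :
    e.promise s d < e.promise s d' := by
  refine Real.log_lt_log (he.promise_arg_pos s hd) ?_
  nlinarith [he.share_pos s]

theorem Regular.promise_le_promise (he : e.Regular) (s : ι) {d d' : ℝ} (hd : 0 ≤ d) (h : d ≤ d') :
    e.promise s d ≤ e.promise s d' := by
  refine Real.log_le_log (he.promise_arg_pos s hd) ?_
  nlinarith [he.share_pos s]

theorem Regular.debt_lt_debt (he : e.Regular) (s : ι) {ω ω' : ℝ} (h : ω < ω') :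
    e.debt s ω < e.debt s ω' := by
  have := he.share_pos s
  have := Real.exp_lt_exp.2 h
  unfold debt
  gcongr

theorem Regular.debt_le_debt (he : e.Regular) (s : ι) {ω ω' : ℝ} (h : ω ≤ ω') :
    e.debt s ω ≤ e.debt s ω' := by
  rcases h.eq_or_lt with rfl | h
  · exact le_rfl
  · exact (he.debt_lt_debt s h).le

theorem promise_zero (s : ι) : e.promise s 0 = Real.log (1 - e.share s) := by simp [promise]

theorem Regular.debt_log (he : e.Regular) (s : ι) : e.debt s (Real.log (1 - e.share s)) = 0 := by
  rw [← promise_zero, he.debt_promise s le_rfl]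

theorem Regular.promise_debtLimit_neg (he : e.Regular) (s : ι) : e.promise s e.debtLimit < 0 := by
  refine Real.log_neg (he.promise_arg_pos s he.debtLimit_mem.1.le) ?_
  nlinarith [he.share_pos s, he.debtLimit_mem.2.1]

theorem Regular.log_lt_promise_debtLimit (he : e.Regular) (s : ι) :
    Real.log (1 - e.share s) < e.promise s e.debtLimit := by
  rw [← promise_zero]
  exact he.promise_lt_promise s le_rfl he.debtLimit_mem.1

theorem exp_promise (he : e.Regular) (s : ι) {d : ℝ} (hd : 0 ≤ d) :
    1 - Real.exp (e.promise s d) = e.share s * (1 - d) := by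
  rw [promise, Real.exp_log (he.promise_arg_pos s hd)]; ring

/-- The largest promises leave the young exactly at autarky when they consume least. -/
theorem Regular.autarky_eq (he : e.Regular) (s : ι) :
    e.autarky s = Real.log (e.share s * (1 - e.debtLimit)) +
      e.β * ∑ r, e.prob r * e.promise r e.debtLimit := by
  obtain ⟨h0, h1, h2⟩ := he.debtLimit_mem
  rw [Real.log_mul (he.share_pos s).ne' (by linarith), autarky]
  simp only [surplus, mul_sub, Finset.sum_sub_distrib] at h2
  simp only [promise]
  linarith

/-! ### Sustainable rules are bounded by the debt limit -/

/-- Take the supremum of debt over all dates and histories of the rule. Participation bounds today's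
debt by tomorrow's, so the supremum itself has nonnegative surplus and lies below the debt limit. -/
theorem Sustainable.lower_bound (he : e.Regular) {c : Rule ι} (hc : e.Sustainable c) (t : ℕ)
    (h : Fin (t + 1) → ι) : e.share (h (Fin.last t)) * (1 - e.debtLimit) ≤ c t h := by
  set D : Set ℝ := range fun x : (Σ t : ℕ, Fin (t + 1) → ι) =>
    1 - c x.1 x.2 / e.share (x.2 (Fin.last x.1)) with hD
  have hmem : ∀ t (h : Fin (t + 1) → ι), 1 - c t h / e.share (h (Fin.last t)) ∈ D :=
    fun t h => ⟨⟨t, h⟩, rfl⟩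
  have hc1 : ∀ t (h : Fin (t + 1) → ι), c t h < 1 := fun t h =>
    (hc t h).2.1.trans_lt (he.share_lt_one _)
  -- the participation constraint in terms of debt
  have hpc : ∀ t (h : Fin (t + 1) → ι), -(e.β * ∑ r, e.prob r *
      (Real.log (1 - c (t + 1) (Fin.snoc (α := fun _ => ι) h r)) - Real.log (1 - e.share r))) ≤
      Real.log (1 - (1 - c t h / e.share (h (Fin.last t)))) := by
    intro t h
    have h1 := (hc t h).2.2
    rw [sub_sub_cancel, Real.log_div (hc t h).1.ne' (he.share_pos _).ne']
    simp only [autarky] at h1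
    simp only [mul_sub, Finset.sum_sub_distrib]
    linarith
  have hbound : ∀ (B : ℝ), (∀ t (h : Fin (t + 1) → ι), -(e.β * ∑ r, e.prob r *
      (Real.log (1 - c (t + 1) (Fin.snoc (α := fun _ => ι) h r)) - Real.log (1 - e.share r))) ≥ B) →
      ∀ x ∈ D, x ≤ 1 - Real.exp B := by
    rintro B hB _ ⟨⟨t, h⟩, rfl⟩
    have h1 : 0 < c t h / e.share (h (Fin.last t)) := div_pos (hc t h).1 (he.share_pos _)
    have h2 := (hB t h).trans (hpc t h)
    rw [sub_sub_cancel, Real.le_log_iff_exp_le h1] at h2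
    linarith
  -- A crude bound, from log utility of the old being at most 0. It keeps the supremum strictly
  -- below 1, where the surplus is meaningful.
  have hb1 := hbound (-(e.β * ∑ r, e.prob r * (0 - Real.log (1 - e.share r)))) (by
    intro t h
    refine neg_le_neg (mul_le_mul_of_nonneg_left (Finset.sum_le_sum fun r _ => ?_) he.β_pos.le)
    refine mul_le_mul_of_nonneg_left (sub_le_sub_right ?_ _) (he.prob_pos r).le
    have h1 := (hc (t + 1) (Fin.snoc (α := fun _ => ι) h r)).1
    exact Real.log_nonpos (by linarith [hc1 (t + 1) (Fin.snoc (α := fun _ => ι) h r)])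
      (by linarith))
  have hbdd : BddAbove D := ⟨_, hb1⟩
  have hne : D.Nonempty := ⟨_, hmem t h⟩
  have hlt : sSup D < 1 := by
    refine (csSup_le hne hb1).trans_lt ?_
    linarith [Real.exp_pos (-(e.β * ∑ r, e.prob r * (0 - Real.log (1 - e.share r))))]
  -- The same bound with every debt tomorrow replaced by the supremum.
  have hb2 := hbound (-(e.β * ∑ r, e.prob r *
      (Real.log (1 - e.share r + e.share r * sSup D) - Real.log (1 - e.share r)))) (by
    intro t h
    refine neg_le_neg (mul_le_mul_of_nonneg_left (Finset.sum_le_sum fun r _ => ?_) he.β_pos.le)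
    refine mul_le_mul_of_nonneg_left (sub_le_sub_right ?_ _) (he.prob_pos r).le
    have h1 := le_csSup hbdd (hmem (t + 1) (Fin.snoc (α := fun _ => ι) h r))
    simp only [Fin.snoc_last] at h1
    refine Real.log_le_log (by linarith [hc1 (t + 1) (Fin.snoc (α := fun _ => ι) h r)]) ?_
    have hs := he.share_pos r
    have h2 : e.share r * (1 - c (t + 1) (Fin.snoc (α := fun _ => ι) h r) / e.share r) =
      e.share r - c (t + 1) (Fin.snoc (α := fun _ => ι) h r) := by field_simp
    nlinarith [mul_le_mul_of_nonneg_left h1 hs.le])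
  have hle := csSup_le hne hb2
  have hsur : 0 ≤ e.surplus (sSup D) := by
    have h1 : Real.exp (-(e.β * ∑ r, e.prob r *
      (Real.log (1 - e.share r + e.share r * sSup D) - Real.log (1 - e.share r)))) ≤ 1 - sSup D := by
      linarith
    rw [← Real.le_log_iff_exp_le (by linarith)] at h1
    unfold surplus
    linarith
  have hfin := (le_csSup hbdd (hmem t h)).trans (he.le_debtLimit hlt hsur)
  have hs := he.share_pos (h (Fin.last t))
  have h2 : e.share (h (Fin.last t)) * (1 - c t h / e.share (h (Fin.last t))) =
      e.share (h (Fin.last t)) - c t h := by field_simp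
  nlinarith [mul_le_mul_of_nonneg_left hfin hs.le]

end Economy

namespace Economy

variable {ι : Type} [Fintype ι] {e : Economy ι}

/-! ### Compactness of the set of sustainable rules and continuity of the payoff -/

/-- The rules whose consumption respects the debt limit and the endowment of the young. -/
def box (e : Economy ι) : Set (Rule ι) :=
  Set.pi univ fun _ => Set.pi univ fun h =>
    Icc (e.share (h (Fin.last _)) * (1 - e.debtLimit)) (e.share (h (Fin.last _)))

theorem isCompact_box : IsCompact e.box :=
  isCompact_univ_pi fun _ => isCompact_univ_pi fun _ => isCompact_Icc

theorem Sustainable.mem_box (he : e.Regular) {c : Rule ι} (hc : e.Sustainable c) : c ∈ e.box :=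
  fun t _ h _ => ⟨hc.lower_bound he t h, (hc t h).2.1⟩

theorem Regular.floor_pos (he : e.Regular) (r : ι) : 0 < e.share r * (1 - e.debtLimit) :=
  mul_pos (he.share_pos r) (by linarith [he.debtLimit_mem.2.1])

theorem mem_box_pos (he : e.Regular) {c : Rule ι} (hc : c ∈ e.box) (t : ℕ) (h : Fin (t + 1) → ι) :
    0 < c t h :=
  (he.floor_pos _).trans_le (hc t (mem_univ _) h (mem_univ _)).1

theorem mem_box_lt (he : e.Regular) {c : Rule ι} (hc : c ∈ e.box) (t : ℕ) (h : Fin (t + 1) → ι) :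
    c t h < 1 :=
  (hc t (mem_univ _) h (mem_univ _)).2.trans_lt (he.share_lt_one _)

theorem continuous_rule_apply (t : ℕ) (h : Fin (t + 1) → ι) :
    Continuous fun c : Rule ι => c t h :=
  (continuous_apply h).comp (continuous_apply t)

theorem continuousOn_log_rule (he : e.Regular) (t : ℕ) (h : Fin (t + 1) → ι) :
    ContinuousOn (fun c : Rule ι => Real.log (c t h)) e.box :=
  (continuous_rule_apply t h).continuousOn.log fun _ hc => (mem_box_pos he hc t h).ne'

theorem continuousOn_log_one_sub_rule (he : e.Regular) (t : ℕ) (h : Fin (t + 1) → ι) :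
    ContinuousOn (fun c : Rule ι => Real.log (1 - c t h)) e.box :=
  (continuousOn_const.sub (continuous_rule_apply t h).continuousOn).log fun _ hc =>
    (sub_pos.2 (mem_box_lt he hc t h)).ne'

/-- The box is compact by Tychonoff. The debt limit keeps consumption in it away from 0, so the
logarithms are continuous and the participation constraints, each involving finitely many
coordinates, are closed. -/
theorem isCompact_sustainable (he : e.Regular) : IsCompact {c | e.Sustainable c} := by
  have heq : {c | e.Sustainable c} = ⋂ x : (Σ t : ℕ, Fin (t + 1) → ι), (e.box ∩
      (fun c : Rule ι => Real.log (c x.1 x.2) + e.β * ∑ r, e.prob r * Real.log (1 - c (x.1 + 1)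
        (Fin.snoc (α := fun _ => ι) x.2 r))) ⁻¹' Ici (e.autarky (x.2 (Fin.last x.1)))) := by
    ext c
    simp only [mem_ofPred_eq, mem_iInter]
    constructor
    · intro hc x
      exact ⟨hc.mem_box he, (hc x.1 x.2).2.2⟩
    · intro hc t h
      have h1 := hc ⟨t, h⟩
      exact ⟨mem_box_pos he h1.1 t h, (h1.1 t (mem_univ _) h (mem_univ _)).2, h1.2⟩
  refine isCompact_box.of_isClosed_subset ?_ fun c hc => Sustainable.mem_box he hc
  rw [heq]
  refine isClosed_iInter fun x => ?_
  refine ContinuousOn.preimage_isClosed_of_isClosed ?_ isCompact_box.isClosed isClosed_Ici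
  refine (continuousOn_log_rule he _ _).add (continuousOn_const.mul ?_)
  exact continuousOn_finsetSum _ fun r _ =>
    continuousOn_const.mul (continuousOn_log_one_sub_rule he _ _)

theorem exists_flow_bound (he : e.Regular) : ∃ M : ℝ, 0 ≤ M ∧ ∀ c ∈ e.box, ∀ t h,
    |e.flow (c t h)| ≤ M := by
  have h1 : ∀ r, ∃ M : ℝ, ∀ x ∈ Icc (e.share r * (1 - e.debtLimit)) (e.share r),
      ‖e.flow x‖ ≤ M := by
    intro r
    refine isCompact_Icc.exists_bound_of_continuousOn ?_
    have hp : ∀ x ∈ Icc (e.share r * (1 - e.debtLimit)) (e.share r), 0 < x ∧ x < 1 := fun x hx =>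
      ⟨(he.floor_pos r).trans_le hx.1, hx.2.trans_lt (he.share_lt_one r)⟩
    exact (continuousOn_const.mul ((continuousOn_const.sub continuousOn_id).log fun x hx =>
      (sub_pos.2 (hp x hx).2).ne')).add (continuousOn_id.log fun x hx => (hp x hx).1.ne')
  choose M hM using h1
  refine ⟨∑ r, |M r|, Finset.sum_nonneg fun r _ => abs_nonneg _, fun c hc t h => ?_⟩
  refine (hM (h (Fin.last t)) _ (hc t (mem_univ _) h (mem_univ _))).trans ((le_abs_self _).trans ?_)
  exact Finset.single_le_sum (f := fun r => |M r|) (fun r _ => abs_nonneg _) (Finset.mem_univ _)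

theorem sum_prod_prob (he : e.Regular) (t : ℕ) : ∑ h : Fin t → ι, ∏ k, e.prob (h k) = 1 := by
  rw [← Fintype.sum_pow, he.prob_sum, one_pow]

/-- The expected payoff at date `t`, discounted. -/
noncomputable def payoffTerm (e : Economy ι) (s₀ : ι) (c : Rule ι) (t : ℕ) : ℝ :=
  e.δ ^ t * ∑ h : Fin t → ι,
    (∏ k, e.prob (h k)) * e.flow (c t (Fin.cons (α := fun _ => ι) s₀ h))

theorem exists_payoffTerm_bound (he : e.Regular) : ∃ M : ℝ, ∀ c ∈ e.box, ∀ s t,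
    ‖e.payoffTerm s c t‖ ≤ M * e.δ ^ t := by
  obtain ⟨M, hM0, hM⟩ := exists_flow_bound he
  refine ⟨M, fun c hc s t => ?_⟩
  rw [payoffTerm, norm_mul, norm_pow, Real.norm_of_nonneg he.δ_pos.le, mul_comm]
  refine mul_le_mul_of_nonneg_right ?_ (pow_nonneg he.δ_pos.le t)
  calc _ ≤ ∑ h : Fin t → ι, (∏ k, e.prob (h k)) * M := by
        refine norm_sum_le_of_le _ fun h _ => ?_
        have hp : 0 ≤ ∏ k, e.prob (h k) := Finset.prod_nonneg fun k _ => (he.prob_pos _).le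
        rw [norm_mul, Real.norm_of_nonneg hp]
        exact mul_le_mul_of_nonneg_left (hM c hc _ _) hp
    _ = M := by rw [← Finset.sum_mul, sum_prod_prob he, one_mul]

theorem summable_bound (he : e.Regular) (M : ℝ) : Summable fun t : ℕ => M * e.δ ^ t :=
  (summable_geometric_of_lt_one he.δ_pos.le he.δ_lt_one).mul_left M

theorem summable_payoffTerm (he : e.Regular) {c : Rule ι} (hc : c ∈ e.box) (s : ι) :
    Summable (e.payoffTerm s c) := by
  obtain ⟨M, hM⟩ := exists_payoffTerm_bound he
  exact (summable_bound he M).of_norm_bounded fun t => hM c hc s t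

theorem continuousOn_payoff (he : e.Regular) (s : ι) : ContinuousOn (e.payoff s) e.box := by
  obtain ⟨M, hM⟩ := exists_payoffTerm_bound he
  refine continuousOn_tsum (f := fun t c => e.payoffTerm s c t) (fun t => ?_) (summable_bound he M)
    fun t c hc => hM c hc s t
  refine continuousOn_const.mul (continuousOn_finsetSum _ fun h _ => continuousOn_const.mul ?_)
  exact (continuousOn_const.mul (continuousOn_log_one_sub_rule he _ _)).add
    (continuousOn_log_rule he _ _)

/-! ### Recursive structure of rules -/

/-- The continuation of a rule after the initial state `s`. -/
def Rule.shift (s : ι) (c : Rule ι) : Rule ι :=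
  fun t h => c (t + 1) (Fin.cons (α := fun _ => ι) s h)

theorem cons_elim0 (s : ι) (h : Fin 0 → ι) :
    (Fin.cons (α := fun _ => ι) s h : Fin 1 → ι) = fun _ => s := by
  ext k
  rw [Subsingleton.elim (α := Fin 1) k 0, Fin.cons_zero]

theorem cons_last (s : ι) {t : ℕ} (h : Fin (t + 1) → ι) :
    (Fin.cons (α := fun _ => ι) s h : Fin (t + 2) → ι) (Fin.last (t + 1)) = h (Fin.last t) := by
  rw [← Fin.succ_last, Fin.cons_succ]

theorem Sustainable.shift {c : Rule ι} (hc : e.Sustainable c) (s : ι) :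
    e.Sustainable (Rule.shift s c) := by
  intro t h
  have h1 := hc (t + 1) (Fin.cons (α := fun _ => ι) s h)
  rw [cons_last] at h1
  refine ⟨h1.1, h1.2.1, h1.2.2.trans (le_of_eq ?_)⟩
  simp only [Rule.shift, Fin.cons_snoc_eq_snoc_cons]

/-- The date-0 term is the flow; the later sums are split by the first realized state through
`Fin.consEquiv`. -/
theorem payoff_eq (he : e.Regular) {c : Rule ι} (hc : e.Sustainable c) (s : ι) :
    e.payoff s c = e.flow (c 0 fun _ => s) +
      e.δ * ∑ r, e.prob r * e.payoff r (Rule.shift s c) := by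
  have hbox := hc.mem_box he
  have hbox' := (hc.shift s).mem_box he
  have hterm : ∀ t, e.payoffTerm s c (t + 1) =
      ∑ r, e.δ * (e.prob r * e.payoffTerm r (Rule.shift s c) t) := by
    intro t
    have hsum : ∑ h : Fin (t + 1) → ι,
        (∏ k, e.prob (h k)) * e.flow (c (t + 1) (Fin.cons (α := fun _ => ι) s h)) =
        ∑ r, ∑ h : Fin t → ι, (e.prob r * ∏ k, e.prob (h k)) *
          e.flow (c (t + 1) (Fin.cons (α := fun _ => ι) s (Fin.cons (α := fun _ => ι) r h))) := by
      rw [← Fintype.sum_prod_type']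
      refine (Fintype.sum_equiv (Fin.consEquiv fun _ : Fin (t + 1) => ι) _ _ ?_).symm
      rintro ⟨r, h⟩
      simp [Fin.consEquiv, Fin.prod_univ_succ]
    rw [payoffTerm, hsum, Finset.mul_sum]
    refine Finset.sum_congr rfl fun r _ => ?_
    rw [payoffTerm, Finset.mul_sum, Finset.mul_sum, Finset.mul_sum, Finset.mul_sum]
    refine Finset.sum_congr rfl fun h _ => ?_
    rw [Rule.shift]
    ring
  have h0 : e.payoffTerm s c 0 = e.flow (c 0 fun _ => s) := by
    simp [payoffTerm, cons_elim0]
  have h1 := (summable_payoffTerm he hbox s).tsum_eq_zero_add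
  have h2 : ∑' t, e.payoffTerm s c (t + 1) = e.δ * ∑ r, e.prob r * e.payoff r (Rule.shift s c) := by
    rw [tsum_congr hterm, Summable.tsum_finsetSum fun r _ =>
      ((summable_payoffTerm he hbox' r).mul_left _).mul_left _, Finset.mul_sum]
    refine Finset.sum_congr rfl fun r _ => ?_
    rw [tsum_mul_left, tsum_mul_left]
    rfl
  have h3 : e.payoff s c = ∑' t, e.payoffTerm s c t := rfl
  rw [h3, h1, h0, h2]

open scoped Classical in
/-- The rule that starts from state `s` with consumption `x` and continues with the rules `C r`;
after any other initial state it is autarky. -/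
noncomputable def Rule.glue (e : Economy ι) (s : ι) (x : ℝ) (C : ι → Rule ι) : Rule ι
  | 0, h => if h 0 = s then x else e.share (h 0)
  | t + 1, h => if h 0 = s then C (Fin.tail h 0) t (Fin.tail h) else e.share (h (Fin.last (t + 1)))

theorem Rule.glue_zero (s : ι) (x : ℝ) (C : ι → Rule ι) :
    Rule.glue e s x C 0 (fun _ => s) = x := by
  simp [Rule.glue]

theorem payoff_congr {c c' : Rule ι} (r : ι)
    (h : ∀ t (k : Fin t → ι), c t (Fin.cons (α := fun _ => ι) r k) =
      c' t (Fin.cons (α := fun _ => ι) r k)) : e.payoff r c = e.payoff r c' := by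
  simp only [payoff, h]

theorem payoff_shift_glue (s : ι) (x : ℝ) (C : ι → Rule ι) (r : ι) :
    e.payoff r (Rule.shift s (Rule.glue e s x C)) = e.payoff r (C r) := by
  refine payoff_congr r fun t k => ?_
  simp [Rule.shift, Rule.glue]

/-- Participation has to hold after every history, also those not starting in `s`; there autarky
satisfies it with equality. Past the initial date the constraints are those of `C r`, so only the
initial one is new. -/
theorem Sustainable.glue (he : e.Regular) (s : ι) {x : ℝ} {C : ι → Rule ι}
    (hC : ∀ r, e.Sustainable (C r)) (hx : 0 < x) (hxs : x ≤ e.share s)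
    (hp : e.autarky s ≤ Real.log x + e.β * ∑ r, e.prob r * Real.log (1 - C r 0 fun _ => r)) :
    e.Sustainable (Rule.glue e s x C) := by
  intro t h
  have hsnoc0 : ∀ r, Fin.snoc (α := fun _ => ι) h r 0 = h 0 := fun r => by
    rw [← Fin.castSucc_zero, Fin.snoc_castSucc]
  by_cases h0 : h 0 = s
  · cases t with
    | zero =>
      have hl : h (Fin.last 0) = s := h0
      have hn : ∀ r, Rule.glue e s x C 1 (Fin.snoc (α := fun _ => ι) h r) = C r 0 fun _ => r := by
        intro r
        have ht : Fin.tail (Fin.snoc (α := fun _ => ι) h r) = fun _ => r := by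
          ext k
          rw [Subsingleton.elim (α := Fin 1) k (Fin.last 0)]
          simp [Fin.tail, Fin.snoc]
        simp [Rule.glue, h0, hsnoc0, ht]
      have hx0 : Rule.glue e s x C 0 h = x := by simp [Rule.glue, h0]
      simp only [hn, hl, hx0]
      exact ⟨hx, hxs, hp⟩
    | succ t =>
      have hn : ∀ r, Rule.glue e s x C (t + 2) (Fin.snoc (α := fun _ => ι) h r) =
          C (Fin.tail h 0) (t + 1) (Fin.snoc (α := fun _ => ι) (Fin.tail h) r) := by
        intro r
        have ht : Fin.tail (Fin.snoc (α := fun _ => ι) h r) =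
            Fin.snoc (α := fun _ => ι) (Fin.tail h) r := by
          conv_lhs => rw [← Fin.cons_self_tail h, ← Fin.cons_snoc_eq_snoc_cons, Fin.tail_cons]
        have ht0 : Fin.snoc (α := fun _ => ι) (Fin.tail h) r 0 = Fin.tail h 0 := by
          rw [← Fin.castSucc_zero, Fin.snoc_castSucc]
        simp only [Rule.glue, hsnoc0, h0, if_true, ht]
        rw [ht0]
      have h1 := hC (Fin.tail h 0) t (Fin.tail h)
      have hl : Fin.tail h (Fin.last t) = h (Fin.last (t + 1)) := by
        rw [Fin.tail, Fin.succ_last]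
      rw [hl] at h1
      simp only [hn]
      simpa only [Rule.glue, h0, if_true] using h1
  · have hn : ∀ r, Rule.glue e s x C (t + 1) (Fin.snoc (α := fun _ => ι) h r) = e.share r := by
      intro r
      simp [Rule.glue, hsnoc0, h0]
    have hc : Rule.glue e s x C t h = e.share (h (Fin.last t)) := by
      cases t with
      | zero => simp [Rule.glue, h0]
      | succ t => simp [Rule.glue, h0]
    simp only [hn, hc]
    exact ⟨he.share_pos _, le_rfl, le_rfl⟩

/-! ### Convexity -/

theorem flow_concave (he : e.Regular) {x y a b : ℝ} (hx : 0 < x ∧ x < 1) (hy : 0 < y ∧ y < 1)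
    (ha : 0 ≤ a) (hb : 0 ≤ b) (hab : a + b = 1) :
    a * e.flow x + b * e.flow y ≤ e.flow (a * x + b * y) := by
  have h1 := log_mix_le hx.1 hy.1 ha hb hab
  have h2 := log_mix_le (sub_pos.2 hx.2) (sub_pos.2 hy.2) ha hb hab
  have h3 : a * (1 - x) + b * (1 - y) = 1 - (a * x + b * y) := by linear_combination hab
  rw [h3] at h2
  have h4 := mul_le_mul_of_nonneg_left h2 (div_pos he.β_pos he.δ_pos).le
  unfold flow
  linarith

theorem Sustainable.mix (he : e.Regular) {c c' : Rule ι} (hc : e.Sustainable c)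
    (hc' : e.Sustainable c') {a b : ℝ} (ha : 0 ≤ a) (hb : 0 ≤ b) (hab : a + b = 1) :
    e.Sustainable fun t h => a * c t h + b * c' t h := by
  have hlog : ∀ t (h : Fin (t + 1) → ι), a * Real.log (1 - c t h) + b * Real.log (1 - c' t h) ≤
      Real.log (1 - (a * c t h + b * c' t h)) := by
    intro t h
    have h2 := log_mix_le (sub_pos.2 (mem_box_lt he (hc.mem_box he) t h))
      (sub_pos.2 (mem_box_lt he (hc'.mem_box he) t h)) ha hb hab
    have h3 : a * (1 - c t h) + b * (1 - c' t h) = 1 - (a * c t h + b * c' t h) := by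
      linear_combination hab
    rwa [h3] at h2
  intro t h
  obtain ⟨h1, h2, h3⟩ := hc t h
  obtain ⟨h1', h2', h3'⟩ := hc' t h
  refine ⟨?_, ?_, ?_⟩
  · rcases ha.eq_or_lt with rfl | ha
    · rw [zero_add] at hab; simpa [hab] using h1'
    · have := mul_pos ha h1
      have := mul_nonneg hb h1'.le
      linarith
  · refine (add_le_add (mul_le_mul_of_nonneg_left h2 ha)
      (mul_le_mul_of_nonneg_left h2' hb)).trans (le_of_eq ?_)
    rw [← add_mul, hab, one_mul]
  · have h4 := log_mix_le h1 h1' ha hb hab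
    have h5 : a * (∑ r, e.prob r * Real.log (1 - c (t + 1) (Fin.snoc (α := fun _ => ι) h r))) +
        b * (∑ r, e.prob r * Real.log (1 - c' (t + 1) (Fin.snoc (α := fun _ => ι) h r))) ≤
        ∑ r, e.prob r * Real.log (1 - (a * c (t + 1) (Fin.snoc (α := fun _ => ι) h r) +
          b * c' (t + 1) (Fin.snoc (α := fun _ => ι) h r))) := by
      rw [Finset.mul_sum, Finset.mul_sum, ← Finset.sum_add_distrib]
      refine Finset.sum_le_sum fun r _ => ?_
      have := mul_le_mul_of_nonneg_left (hlog (t + 1) (Fin.snoc (α := fun _ => ι) h r))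
        (he.prob_pos r).le
      linarith
    have h6 := mul_le_mul_of_nonneg_left h5 he.β_pos.le
    have h7 : a * e.autarky (h (Fin.last t)) + b * e.autarky (h (Fin.last t)) =
        e.autarky (h (Fin.last t)) := by rw [← add_mul, hab, one_mul]
    have h8 := mul_le_mul_of_nonneg_left h3 ha
    have h9 := mul_le_mul_of_nonneg_left h3' hb
    linarith

theorem payoff_mix (he : e.Regular) {c c' : Rule ι} (hc : e.Sustainable c)
    (hc' : e.Sustainable c') {a b : ℝ} (ha : 0 ≤ a) (hb : 0 ≤ b) (hab : a + b = 1) (s : ι) :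
    a * e.payoff s c + b * e.payoff s c' ≤ e.payoff s fun t h => a * c t h + b * c' t h := by
  have hs := summable_payoffTerm he (hc.mem_box he) s
  have hs' := summable_payoffTerm he (hc'.mem_box he) s
  have hm := summable_payoffTerm he ((hc.mix he hc' ha hb hab).mem_box he) s
  have h1 : a * e.payoff s c + b * e.payoff s c' =
      ∑' t, (a * e.payoffTerm s c t + b * e.payoffTerm s c' t) := by
    rw [(hs.mul_left a).tsum_add (hs'.mul_left b), tsum_mul_left, tsum_mul_left]
    rfl
  rw [h1]
  refine Summable.tsum_le_tsum (fun t => ?_) ((hs.mul_left a).add (hs'.mul_left b)) hm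
  have h2 : a * e.payoffTerm s c t + b * e.payoffTerm s c' t = e.δ ^ t * ∑ h : Fin t → ι,
      (∏ k, e.prob (h k)) * (a * e.flow (c t (Fin.cons (α := fun _ => ι) s h)) +
        b * e.flow (c' t (Fin.cons (α := fun _ => ι) s h))) := by
    simp only [payoffTerm, mul_add, Finset.sum_add_distrib, Finset.mul_sum]
    congr 1 <;> exact Finset.sum_congr rfl fun h _ => by ring
  rw [h2]
  refine mul_le_mul_of_nonneg_left (Finset.sum_le_sum fun h _ => ?_) (pow_nonneg he.δ_pos.le t)
  refine mul_le_mul_of_nonneg_left ?_ (Finset.prod_nonneg fun k _ => (he.prob_pos _).le)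
  exact flow_concave he ⟨mem_box_pos he (hc.mem_box he) _ _, mem_box_lt he (hc.mem_box he) _ _⟩
    ⟨mem_box_pos he (hc'.mem_box he) _ _, mem_box_lt he (hc'.mem_box he) _ _⟩ ha hb hab

end Economy

namespace Economy

variable {ι : Type} [Fintype ι] {e : Economy ι}

theorem concave_three_point {S : Set ℝ} {F : ℝ → ℝ} (h : ConcaveOn ℝ S F) {x y z : ℝ} (hx : x ∈ S)
    (hz : z ∈ S) (hxy : x ≤ y) (hyz : y ≤ z) :
    (z - y) * F x + (y - x) * F z ≤ (z - x) * F y := by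
  rcases (hxy.trans hyz).eq_or_lt with rfl | hxz
  · obtain rfl := le_antisymm hxy hyz
    simp
  · have hpos := sub_pos.2 hxz
    have h1 := h.2 hx hz (div_nonneg (sub_nonneg.2 hyz) hpos.le)
      (div_nonneg (sub_nonneg.2 hxy) hpos.le) (by field_simp; ring)
    have h2 : (z - y) / (z - x) * x + (y - x) / (z - x) * z = y := by field_simp; ring
    simp only [smul_eq_mul, h2] at h1
    calc _ = (z - x) * ((z - y) / (z - x) * F x + (y - x) / (z - x) * F z) := by field_simp
      _ ≤ _ := mul_le_mul_of_nonneg_left h1 hpos.le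

/-! ### The value function -/

theorem isCompact_admissible (he : e.Regular) (s : ι) (ω : ℝ) :
    IsCompact {c | e.Sustainable c ∧ ω ≤ Real.log (1 - c 0 fun _ => s)} := by
  have h1 : IsClosed ({c | e.Sustainable c} ∩
      (fun c : Rule ι => Real.log (1 - c 0 fun _ => s)) ⁻¹' Ici ω) :=
    ((continuousOn_log_one_sub_rule he 0 fun _ => s).mono fun c hc =>
      Sustainable.mem_box he hc).preimage_isClosed_of_isClosed
        (isCompact_sustainable he).isClosed isClosed_Ici
  exact (isCompact_sustainable he).of_isClosed_subset h1 fun c hc => hc.1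

/-- Debt at its limit after every history. -/
noncomputable def floorRule (e : Economy ι) : Rule ι :=
  fun t h => e.share (h (Fin.last t)) * (1 - e.debtLimit)

theorem sustainable_floorRule (he : e.Regular) : e.Sustainable e.floorRule := by
  intro t h
  refine ⟨he.floor_pos _, ?_, ?_⟩
  · have := he.share_pos (h (Fin.last t))
    unfold floorRule
    nlinarith [he.debtLimit_pos]
  · rw [he.autarky_eq]
    refine le_of_eq ?_
    simp only [floorRule, promise, Fin.snoc_last]
    congr 3
    ext r
    congr 2
    ring

theorem log_one_sub_floorRule (s : ι) :
    Real.log (1 - e.floorRule 0 fun _ => s) = e.promise s e.debtLimit := by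
  rw [floorRule, promise]
  congr 1
  ring

theorem payoff_le_value (he : e.Regular) {s : ι} {ω : ℝ} {c : Rule ι} (hc : e.Sustainable c)
    (hω : ω ≤ Real.log (1 - c 0 fun _ => s)) : e.payoff s c ≤ e.value s ω :=
  le_csSup ((isCompact_admissible he s ω).bddAbove_image
    ((continuousOn_payoff he s).mono fun _ hc => hc.1.mem_box he)) (mem_image_of_mem _ ⟨hc, hω⟩)

theorem exists_optimal_rule (he : e.Regular) {s : ι} {ω : ℝ} (hω : ω ≤ e.promise s e.debtLimit) :
    ∃ c, e.Sustainable c ∧ ω ≤ Real.log (1 - c 0 fun _ => s) ∧ e.payoff s c = e.value s ω := by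
  obtain ⟨c, hc, h⟩ := (isCompact_admissible he s ω).exists_sSup_image_eq
    ⟨e.floorRule, sustainable_floorRule he, by rwa [log_one_sub_floorRule]⟩
    ((continuousOn_payoff he s).mono fun _ hc => hc.1.mem_box he)
  exact ⟨c, hc.1, hc.2, h.symm⟩

theorem value_antitone (he : e.Regular) {s : ι} {ω ω' : ℝ} (h : ω ≤ ω')
    (hω' : ω' ≤ e.promise s e.debtLimit) : e.value s ω' ≤ e.value s ω := by
  obtain ⟨c, hc, h1, h2⟩ := exists_optimal_rule he hω'
  rw [← h2]
  exact payoff_le_value he hc (h.trans h1)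

theorem value_concave (he : e.Regular) (s : ι) :
    ConcaveOn ℝ (Iic (e.promise s e.debtLimit)) (e.value s) := by
  refine ⟨convex_Iic _, fun x hx y hy a b ha hb hab => ?_⟩
  obtain ⟨c, hc, h1, h2⟩ := exists_optimal_rule he hx
  obtain ⟨c', hc', h1', h2'⟩ := exists_optimal_rule he hy
  simp only [smul_eq_mul]
  rw [← h2, ← h2']
  refine (payoff_mix he hc hc' ha hb hab s).trans (payoff_le_value he (hc.mix he hc' ha hb hab) ?_)
  have h3 := log_mix_le (sub_pos.2 (mem_box_lt he (hc.mem_box he) 0 fun _ => s))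
    (sub_pos.2 (mem_box_lt he (hc'.mem_box he) 0 fun _ => s)) ha hb hab
  have h4 : a * (1 - c 0 fun _ => s) + b * (1 - c' 0 fun _ => s) =
      1 - (a * (c 0 fun _ => s) + b * c' 0 fun _ => s) := by linear_combination hab
  rw [h4] at h3
  have := mul_le_mul_of_nonneg_left h1 ha
  have := mul_le_mul_of_nonneg_left h1' hb
  linarith

theorem Sustainable.log_mem_promises (he : e.Regular) {c : Rule ι} (hc : e.Sustainable c) (t : ℕ)
    (h : Fin (t + 1) → ι) : Real.log (1 - c t h) ∈ e.promises (h (Fin.last t)) := by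
  have h1 := mem_box_lt he (hc.mem_box he) t h
  refine ⟨Real.log_le_log (by linarith [he.share_lt_one (h (Fin.last t))])
    (by linarith [(hc t h).2.1]), Real.log_le_log (by linarith) ?_⟩
  have := hc.lower_bound he t h
  linarith

/-- The supremum is attained: among the rules that are optimal at the lowest promise, a compact set,
choose one giving the initial old the most. Their utility is the largest maximizer. -/
theorem resetPromise_isGreatest (he : e.Regular) (s : ι) :
    IsGreatest {ω | ω ∈ e.promises s ∧ ∀ ω' ∈ e.promises s, e.value s ω' ≤ e.value s ω}
      (e.resetPromise s) := by
  have hlow := (he.log_lt_promise_debtLimit s).le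
  set K := {c | e.Sustainable c ∧ Real.log (1 - e.share s) ≤ Real.log (1 - c 0 fun _ => s)} with hK
  have hKc : IsCompact K := isCompact_admissible he s _
  have hcont : ContinuousOn (e.payoff s) K := (continuousOn_payoff he s).mono fun _ hc =>
    hc.1.mem_box he
  have hKM : IsCompact (K ∩ e.payoff s ⁻¹' Ici (e.value s (Real.log (1 - e.share s)))) :=
    hKc.of_isClosed_subset (hcont.preimage_isClosed_of_isClosed hKc.isClosed isClosed_Ici)
      inter_subset_left
  obtain ⟨c₀, hc₀, hl₀, hv₀⟩ := exists_optimal_rule he hlow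
  obtain ⟨c, hc, hmax⟩ := hKM.exists_isMaxOn ⟨c₀, ⟨hc₀, hl₀⟩, hv₀.ge⟩
    ((continuousOn_log_one_sub_rule he 0 fun _ => s).mono fun c hc => hc.1.1.mem_box he)
  have hg : IsGreatest {ω | ω ∈ e.promises s ∧ ∀ ω' ∈ e.promises s, e.value s ω' ≤ e.value s ω}
      (Real.log (1 - c 0 fun _ => s)) := by
    refine ⟨⟨hc.1.1.log_mem_promises he 0 fun _ => s, fun ω' hω' => ?_⟩, ?_⟩
    · exact ((value_antitone he hω'.1 hω'.2).trans hc.2).trans (payoff_le_value he hc.1.1 le_rfl)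
    · rintro ω ⟨hω, hωm⟩
      obtain ⟨c', hc', hl', hv'⟩ := exists_optimal_rule he hω.2
      refine hl'.trans (isMaxOn_iff.1 hmax c' ⟨⟨hc', hω.1.trans hl'⟩, ?_⟩)
      exact (hωm _ ⟨le_rfl, hlow⟩).trans hv'.ge
  have h : e.resetPromise s = _ := hg.csSup_eq
  rw [h]
  exact hg

theorem resetPromise_mem (he : e.Regular) (s : ι) : e.resetPromise s ∈ e.promises s :=
  (resetPromise_isGreatest he s).1.1

theorem value_le_reset (he : e.Regular) {s : ι} {ω : ℝ} (hω : ω ∈ e.promises s) :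
    e.value s ω ≤ e.value s (e.resetPromise s) :=
  (resetPromise_isGreatest he s).1.2 ω hω

theorem value_eq_reset (he : e.Regular) {s : ι} {ω : ℝ} (hω : ω ∈ e.promises s)
    (h : ω ≤ e.resetPromise s) : e.value s ω = e.value s (e.resetPromise s) :=
  (value_le_reset he hω).antisymm (value_antitone he h (resetPromise_mem he s).2)

theorem le_resetPromise (he : e.Regular) {s : ι} {ω : ℝ} (hω : ω ∈ e.promises s)
    (h : e.value s (e.resetPromise s) ≤ e.value s ω) : ω ≤ e.resetPromise s :=
  (resetPromise_isGreatest he s).2 ⟨hω, fun _ hω' => (value_le_reset he hω').trans h⟩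

/-- A concave function cannot be flat beyond its largest maximizer. -/
theorem value_strictAnti (he : e.Regular) {s : ι} {ω ω' : ℝ} (h : e.resetPromise s ≤ ω)
    (hω : ω < ω') (hω' : ω' ≤ e.promise s e.debtLimit) : e.value s ω' < e.value s ω := by
  have hm := resetPromise_mem he s
  have h0 : e.value s ω' < e.value s (e.resetPromise s) := by
    by_contra! hc
    exact absurd (le_resetPromise he ⟨hm.1.trans (h.trans hω.le), hω'⟩ hc) (by linarith)
  rcases h.eq_or_lt with rfl | h
  · exact h0
  have h1 := concave_three_point (value_concave he s) hm.2 hω' h.le hω.le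
  have h2 := mul_lt_mul_of_pos_left h0 (sub_pos.2 hω)
  have h3 : 0 < ω' - e.resetPromise s := by linarith
  by_contra! hc
  nlinarith [mul_le_mul_of_nonneg_left hc h3.le]

/-! ### The Bellman equation -/

/-- Gluing optimal rules for the chosen promises produces a sustainable rule worth at least the
objective. With `exists_feasible_value`, obtained by cutting an optimal rule after one period, this
is the Bellman equation. -/
theorem objective_le_value (he : e.Regular) {s : ι} {ω : ℝ} {a : ℝ × (ι → ℝ)}
    (ha : e.Feasible s ω a) : e.objective a ≤ e.value s ω := by
  obtain ⟨h1, h2, h3, h4, h5⟩ := ha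
  choose C hC hCl hCv using fun r => exists_optimal_rule he (h4 r).2
  have hs : e.Sustainable (Rule.glue e s a.1 C) := by
    refine Sustainable.glue he s hC h1 h3 (h5.trans (add_le_add_right ?_ _))
    refine mul_le_mul_of_nonneg_left (Finset.sum_le_sum fun r _ => ?_) he.β_pos.le
    exact mul_le_mul_of_nonneg_left (hCl r) (he.prob_pos r).le
  have h6 := payoff_le_value he (s := s) (ω := ω) hs (by rwa [Rule.glue_zero])
  rw [payoff_eq he hs, Rule.glue_zero] at h6
  simp only [payoff_shift_glue, hCv] at h6
  exact h6

theorem exists_feasible_value (he : e.Regular) {s : ι} {ω : ℝ}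
    (hω : ω ≤ e.promise s e.debtLimit) :
    ∃ a, e.Feasible s ω a ∧ e.value s ω ≤ e.objective a := by
  obtain ⟨c, hc, hl, hv⟩ := exists_optimal_rule he hω
  refine ⟨(c 0 fun _ => s, fun r => Real.log (1 - Rule.shift s c 0 fun _ => r)),
    ⟨(hc 0 _).1, hl, (hc 0 fun _ => s).2.1, fun r => ?_, ?_⟩, ?_⟩
  · exact (hc.shift s).log_mem_promises he 0 fun _ => r
  · refine (hc 0 fun _ => s).2.2.trans (le_of_eq ?_)
    have : ∀ r, Fin.snoc (α := fun _ => ι) (fun _ : Fin 1 => s) r =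
        Fin.cons (α := fun _ => ι) s (fun _ : Fin 1 => r) := by
      intro r
      ext k
      refine Fin.cases ?_ (fun j => ?_) k
      · rfl
      · rw [Subsingleton.elim j 0]; rfl
    simp only [this, Rule.shift]
  · rw [← hv, payoff_eq he hc]
    refine add_le_add_right (mul_le_mul_of_nonneg_left (Finset.sum_le_sum fun r _ => ?_)
      he.δ_pos.le) _
    exact mul_le_mul_of_nonneg_left (payoff_le_value he (hc.shift s) le_rfl) (he.prob_pos r).le

/-- Raising promises to the reset level loosens participation and leaves the value unchanged, so the
normalization is free. -/
theorem exists_isOptimalChoice (he : e.Regular) {s : ι} {ω : ℝ}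
    (hω : ω ≤ e.promise s e.debtLimit) : ∃ a, e.IsOptimalChoice s ω a := by
  obtain ⟨a, ⟨h1, h2, h3, h4, h5⟩, hv⟩ := exists_feasible_value he hω
  have hmem : ∀ r, max (a.2 r) (e.resetPromise r) ∈ e.promises r := fun r =>
    ⟨(h4 r).1.trans (le_max_left _ _), max_le (h4 r).2 (resetPromise_mem he r).2⟩
  have hval : ∀ r, e.value r (max (a.2 r) (e.resetPromise r)) = e.value r (a.2 r) := by
    intro r
    rcases le_total (a.2 r) (e.resetPromise r) with h | h
    · rw [max_eq_right h, value_eq_reset he (h4 r) h]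
    · rw [max_eq_left h]
  have hobj : e.objective (a.1, fun r => max (a.2 r) (e.resetPromise r)) = e.objective a := by
    simp only [objective, hval]
  refine ⟨(a.1, fun r => max (a.2 r) (e.resetPromise r)), ⟨h1, h2, h3, hmem, h5.trans ?_⟩,
    fun a' ha' => ?_, fun r => le_max_right _ _⟩
  · refine add_le_add_right (mul_le_mul_of_nonneg_left (Finset.sum_le_sum fun r _ => ?_)
      he.β_pos.le) _
    exact mul_le_mul_of_nonneg_left (le_max_left _ _) (he.prob_pos r).le
  · rw [hobj]
    exact (objective_le_value he ha').trans hv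

theorem policy_spec (he : e.Regular) {s : ι} {ω : ℝ} (hω : ω ≤ e.promise s e.debtLimit) :
    e.IsOptimalChoice s ω (e.policy s ω) :=
  Classical.epsilon_spec (exists_isOptimalChoice he hω)

theorem IsOptimalChoice.value_eq (he : e.Regular) {s : ι} {ω : ℝ}
    (hω : ω ≤ e.promise s e.debtLimit) {a : ℝ × (ι → ℝ)} (ha : e.IsOptimalChoice s ω a) :
    e.value s ω = e.objective a := by
  obtain ⟨a', ha', h⟩ := exists_feasible_value he hω
  exact (h.trans (ha.2.1 a' ha')).antisymm (objective_le_value he ha.1)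

/-- Every feasible choice leaves the young at least what they consume at the debt limit. -/
theorem Feasible.floor_le (he : e.Regular) {s : ι} {ω : ℝ} {a : ℝ × (ι → ℝ)}
    (ha : e.Feasible s ω a) : e.share s * (1 - e.debtLimit) ≤ a.1 := by
  obtain ⟨h1, -, -, h4, h5⟩ := ha
  rw [he.autarky_eq] at h5
  rw [← Real.log_le_log_iff (he.floor_pos s) h1]
  have : e.β * ∑ r, e.prob r * a.2 r ≤ e.β * ∑ r, e.prob r * e.promise r e.debtLimit :=
    mul_le_mul_of_nonneg_left (Finset.sum_le_sum fun r _ =>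
      mul_le_mul_of_nonneg_left (h4 r).2 (he.prob_pos r).le) he.β_pos.le
  linarith

/-- Promise keeping binds from the reset level on: otherwise the same choice would be feasible at a
higher promise, whose value is strictly lower. -/
theorem IsOptimalChoice.fst_eq (he : e.Regular) {s : ι} {ω : ℝ} (hr : e.resetPromise s ≤ ω)
    (hω : ω ≤ e.promise s e.debtLimit) {a : ℝ × (ι → ℝ)} (ha : e.IsOptimalChoice s ω a) :
    a.1 = 1 - Real.exp ω := by
  have hfl := ha.1.floor_le he
  have hv := ha.value_eq he hω
  obtain ⟨h1, h2, h3, h4, h5⟩ := ha.1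
  have hlt : 0 < 1 - a.1 := by linarith [he.share_lt_one s]
  have hfeas : e.Feasible s (Real.log (1 - a.1)) a := ⟨h1, le_rfl, h3, h4, h5⟩
  have h6 := objective_le_value he hfeas
  have hle : Real.log (1 - a.1) ≤ e.promise s e.debtLimit :=
    Real.log_le_log hlt (by linarith)
  rcases h2.eq_or_lt with h | h
  · rw [h, Real.exp_log hlt]; ring
  · have := value_strictAnti he hr h hle
    linarith

end Economy

/-! ### Supergradients of concave functions -/

/-- `D` is a supergradient of `F` at `x` relative to `S`. -/
def IsSupergradient (F : ℝ → ℝ) (S : Set ℝ) (x D : ℝ) : Prop :=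
  ∀ z ∈ S, F z ≤ F x + D * (z - x)

theorem tendsto_slope_right {m : ℝ → ℝ} {x D : ℝ} (hm : HasDerivAt m D x) :
    Tendsto (slope m x) (𝓝[>] x) (𝓝 D) :=
  (hasDerivWithinAt_iff_tendsto_slope' self_notMem_Ioi).1 hm.hasDerivWithinAt

theorem tendsto_slope_left {m : ℝ → ℝ} {x D : ℝ} (hm : HasDerivAt m D x) :
    Tendsto (slope m x) (𝓝[<] x) (𝓝 D) :=
  (hasDerivWithinAt_iff_tendsto_slope' self_notMem_Iio).1 hm.hasDerivWithinAt

section Minorant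

variable {F m : ℝ → ℝ} {S : Set ℝ} {x D : ℝ}

/-- The envelope argument, one side at a time, because at a corner the smooth minorant exists on one
side only. -/
theorem IsSupergradient.ge_of_minorant_right {μ : ℝ} (hμ : IsSupergradient F S x μ)
    (hm : HasDerivAt m D x) (hx : m x = F x) (h : ∀ᶠ y in 𝓝[>] x, y ∈ S ∧ m y ≤ F y) : D ≤ μ := by
  refine le_of_tendsto (tendsto_slope_right hm) ?_
  filter_upwards [h, self_mem_nhdsWithin] with y hy hxy
  rw [slope_def_field, div_le_iff₀ (sub_pos.2 hxy)]
  have := hμ y hy.1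
  linarith [hy.2]

theorem IsSupergradient.le_of_minorant_left {μ : ℝ} (hμ : IsSupergradient F S x μ)
    (hm : HasDerivAt m D x) (hx : m x = F x) (h : ∀ᶠ y in 𝓝[<] x, y ∈ S ∧ m y ≤ F y) : μ ≤ D := by
  refine ge_of_tendsto (tendsto_slope_left hm) ?_
  filter_upwards [h, self_mem_nhdsWithin] with y hy hxy
  rw [slope_def_field, le_div_iff_of_neg (sub_neg.2 hxy)]
  have := hμ y hy.1
  linarith [hy.2]

/-- Slopes of a concave function decrease, so a lower bound on the slope to the right of `x` bounds
the slopes to its left as well. -/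
theorem le_of_minorant_right (hF : ConcaveOn ℝ S F) (hm : HasDerivAt m D x) (hx : m x = F x)
    (h : ∀ᶠ y in 𝓝[>] x, y ∈ S ∧ m y ≤ F y) {z : ℝ} (hz : z ∈ S) (hzx : z ≤ x) :
    F z ≤ F x + D * (z - x) := by
  have h1 : Tendsto (fun y => F x + slope m x y * (z - x)) (𝓝[>] x) (𝓝 (F x + D * (z - x))) :=
    ((tendsto_slope_right hm).mul_const _).const_add _
  refine ge_of_tendsto h1 ?_
  filter_upwards [h, self_mem_nhdsWithin] with y hy hxy
  have hpos : 0 < y - x := sub_pos.2 hxy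
  have h2 := Economy.concave_three_point hF hz hy.1 hzx (le_of_lt hxy)
  rw [slope_def_field, div_mul_eq_mul_div, ← sub_le_iff_le_add', le_div_iff₀ hpos]
  nlinarith [mul_le_mul_of_nonneg_left hy.2 (sub_nonneg.2 hzx)]

theorem le_of_minorant_left (hF : ConcaveOn ℝ S F) (hm : HasDerivAt m D x) (hx : m x = F x)
    (h : ∀ᶠ y in 𝓝[<] x, y ∈ S ∧ m y ≤ F y) {z : ℝ} (hz : z ∈ S) (hzx : x ≤ z) :
    F z ≤ F x + D * (z - x) := by
  have h1 : Tendsto (fun y => F x + slope m x y * (z - x)) (𝓝[<] x) (𝓝 (F x + D * (z - x))) :=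
    ((tendsto_slope_left hm).mul_const _).const_add _
  refine ge_of_tendsto h1 ?_
  filter_upwards [h, self_mem_nhdsWithin] with y hy hxy
  have hneg : y - x < 0 := sub_neg.2 hxy
  have h2 := Economy.concave_three_point hF hy.1 hz (le_of_lt hxy) hzx
  rw [slope_def_field, div_mul_eq_mul_div, ← sub_le_iff_le_add', le_div_iff_of_neg hneg]
  nlinarith [mul_le_mul_of_nonneg_left hy.2 (sub_nonneg.2 hzx)]

end Minorant

/-- The right derivative is the least supergradient. -/
theorem exists_least_supergradient {F : ℝ → ℝ} {S : Set ℝ} {x : ℝ} (hF : ConcaveOn ℝ S F)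
    (hx : x ∈ interior S) :
    ∃ D, IsSupergradient F S x D ∧ ∀ μ, (∀ᶠ y in 𝓝[>] x, F y ≤ F x + μ * (y - x)) → D ≤ μ := by
  have hr := hF.neg.hasDerivWithinAt_rightDeriv_of_mem_interior hx
  have hl := hF.neg.hasDerivWithinAt_leftDeriv_of_mem_interior hx
  have hlr := hF.neg.leftDeriv_le_rightDeriv_of_mem_interior hx
  have hxS := interior_subset hx
  refine ⟨-derivWithin (-F) (Ioi x) x, fun z hz => ?_, fun μ hμ => ?_⟩
  · rcases lt_trichotomy z x with h | rfl | h
    · have := hF.neg.slope_le_of_hasDerivWithinAt_Iio hz hxS h hl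
      rw [slope_def_field, div_le_iff₀ (sub_pos.2 h)] at this
      simp only [Pi.neg_apply] at this
      nlinarith [mul_le_mul_of_nonneg_right hlr (sub_pos.2 h).le]
    · simp
    · have := hF.neg.le_slope_of_hasDerivWithinAt_Ioi hxS hz h hr
      rw [slope_def_field, le_div_iff₀ (sub_pos.2 h)] at this
      simp only [Pi.neg_apply] at this
      linarith
  · have h1 := ((hasDerivWithinAt_iff_tendsto_slope' self_notMem_Ioi).1 hr)
    have h2 : -μ ≤ derivWithin (-F) (Ioi x) x := by
      refine ge_of_tendsto h1 ?_
      filter_upwards [hμ, self_mem_nhdsWithin] with y hy hxy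
      rw [slope_def_field, le_div_iff₀ (sub_pos.2 hxy)]
      simp only [Pi.neg_apply]
      linarith
    linarith

/-- The left derivative is the greatest supergradient. -/
theorem exists_greatest_supergradient {F : ℝ → ℝ} {S : Set ℝ} {x : ℝ} (hF : ConcaveOn ℝ S F)
    (hx : x ∈ interior S) :
    ∃ D, IsSupergradient F S x D ∧ ∀ μ, (∀ᶠ y in 𝓝[<] x, F y ≤ F x + μ * (y - x)) → μ ≤ D := by
  have hr := hF.neg.hasDerivWithinAt_rightDeriv_of_mem_interior hx
  have hl := hF.neg.hasDerivWithinAt_leftDeriv_of_mem_interior hx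
  have hlr := hF.neg.leftDeriv_le_rightDeriv_of_mem_interior hx
  have hxS := interior_subset hx
  refine ⟨-derivWithin (-F) (Iio x) x, fun z hz => ?_, fun μ hμ => ?_⟩
  · rcases lt_trichotomy z x with h | rfl | h
    · have := hF.neg.slope_le_of_hasDerivWithinAt_Iio hz hxS h hl
      rw [slope_def_field, div_le_iff₀ (sub_pos.2 h)] at this
      simp only [Pi.neg_apply] at this
      linarith
    · simp
    · have := hF.neg.le_slope_of_hasDerivWithinAt_Ioi hxS hz h hr
      rw [slope_def_field, le_div_iff₀ (sub_pos.2 h)] at this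
      simp only [Pi.neg_apply] at this
      nlinarith [mul_le_mul_of_nonneg_right hlr (sub_pos.2 h).le]
  · have h1 := ((hasDerivWithinAt_iff_tendsto_slope' self_notMem_Iio).1 hl)
    have h2 : derivWithin (-F) (Iio x) x ≤ -μ := by
      refine le_of_tendsto h1 ?_
      filter_upwards [hμ, self_mem_nhdsWithin] with y hy hxy
      rw [slope_def_field, div_le_iff_of_neg (sub_neg.2 hxy)]
      simp only [Pi.neg_apply]
      linarith
    linarith

/-! ### Consumption of the young as a function of the utility of the old -/

/-- Log consumption of the young when the old get utility `ω`. -/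
noncomputable def logYoung (ω : ℝ) : ℝ := Real.log (1 - Real.exp ω)

/-- The ratio of the consumption of the old, who get utility `ω`, to that of the young. -/
noncomputable def odds (ω : ℝ) : ℝ := Real.exp ω / (1 - Real.exp ω)

theorem one_sub_exp_pos {ω : ℝ} (h : ω < 0) : 0 < 1 - Real.exp ω := by
  have := Real.exp_lt_exp.2 h
  rw [Real.exp_zero] at this
  linarith

theorem odds_pos {ω : ℝ} (h : ω < 0) : 0 < odds ω :=
  div_pos (Real.exp_pos ω) (one_sub_exp_pos h)

theorem odds_lt_odds {ω ω' : ℝ} (h : ω < ω') (h' : ω' < 0) : odds ω < odds ω' := by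
  have h1 := one_sub_exp_pos h'
  have h2 := Real.exp_lt_exp.2 h
  exact div_lt_div₀ h2 (by linarith) (Real.exp_pos _).le h1

theorem odds_le_odds {ω ω' : ℝ} (h : ω ≤ ω') (h' : ω' < 0) : odds ω ≤ odds ω' := by
  rcases h.eq_or_lt with rfl | h
  · exact le_rfl
  · exact (odds_lt_odds h h').le

theorem hasDerivAt_logYoung {ω : ℝ} (h : ω < 0) : HasDerivAt logYoung (-odds ω) ω := by
  have h1 := ((Real.hasDerivAt_exp ω).const_sub 1).log (one_sub_exp_pos h).ne'
  rwa [neg_div] at h1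

theorem logYoung_lt {z w : ℝ} (hz : z < 0) (hw : w < 0) (h : z ≠ w) :
    logYoung z < logYoung w - odds w * (z - w) := by
  have hz' := one_sub_exp_pos hz
  have hw' := one_sub_exp_pos hw
  have h1 : logYoung z - logYoung w ≤ (1 - Real.exp z) / (1 - Real.exp w) - 1 := by
    rw [logYoung, logYoung, ← Real.log_div hz'.ne' hw'.ne']
    exact Real.log_le_sub_one_of_pos (div_pos hz' hw')
  have h2 : (1 - Real.exp z) / (1 - Real.exp w) - 1 = -odds w * (Real.exp (z - w) - 1) := by
    have := (Real.exp_pos w).ne'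
    rw [odds, Real.exp_sub]; field_simp; ring
  have h3 := Real.add_one_lt_exp (sub_ne_zero.2 h)
  nlinarith [odds_pos hw]

theorem logYoung_le {z w : ℝ} (hz : z < 0) (hw : w < 0) :
    logYoung z ≤ logYoung w - odds w * (z - w) := by
  rcases eq_or_ne z w with rfl | h
  · simp
  · exact (logYoung_lt hz hw h).le

theorem logYoung_lt_logYoung {z w : ℝ} (h : z < w) (hw : w < 0) : logYoung w < logYoung z := by
  have := logYoung_lt hw (h.trans hw) h.ne'
  nlinarith [odds_pos (h.trans hw)]

theorem logYoung_le_logYoung {z w : ℝ} (h : z ≤ w) (hw : w < 0) : logYoung w ≤ logYoung z := by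
  rcases h.eq_or_lt with rfl | h
  · exact le_rfl
  · exact (logYoung_lt_logYoung h hw).le

namespace Economy

variable {ι : Type} [Fintype ι] {e : Economy ι}

/-! ### The continuation value as a function of the log consumption of the young -/

/-- The flow payoff when the old get utility `ω`. -/
noncomputable def flowOld (e : Economy ι) (ω : ℝ) : ℝ := e.β / e.δ * ω + logYoung ω

theorem flow_eq_flowOld (ω : ℝ) : e.flow (1 - Real.exp ω) = e.flowOld ω := by
  rw [flow, flowOld, sub_sub_cancel, Real.log_exp, logYoung]

/-- The values of the promises that compensate a young agent with log consumption `y`. -/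
def continuations (e : Economy ι) (s : ι) (y : ℝ) : Set ℝ :=
  {v | ∃ ω : ι → ℝ, (∀ r, ω r ∈ e.promises r) ∧
    e.autarky s ≤ y + e.β * ∑ r, e.prob r * ω r ∧ v = ∑ r, e.prob r * e.value r (ω r)}

/-- The continuation value when the log consumption of the young is `y`. -/
noncomputable def continuation (e : Economy ι) (s : ι) (y : ℝ) : ℝ := sSup (e.continuations s y)

/-- The least log consumption of the young. -/
noncomputable def floorLog (e : Economy ι) (s : ι) : ℝ := logYoung (e.promise s e.debtLimit)

theorem floorLog_eq (he : e.Regular) (s : ι) :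
    e.floorLog s = Real.log (e.share s * (1 - e.debtLimit)) := by
  rw [floorLog, logYoung, exp_promise he s he.debtLimit_mem.1.le]

theorem continuations_nonempty (he : e.Regular) {s : ι} {y : ℝ} (hy : e.floorLog s ≤ y) :
    (e.continuations s y).Nonempty := by
  refine ⟨_, fun r => e.promise r e.debtLimit,
    fun r => ⟨(he.log_lt_promise_debtLimit r).le, le_rfl⟩, ?_, rfl⟩
  rw [he.autarky_eq, ← floorLog_eq he]
  linarith

theorem continuations_bddAbove (he : e.Regular) (s : ι) (y : ℝ) :
    BddAbove (e.continuations s y) := by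
  refine ⟨∑ r, e.prob r * e.value r (e.resetPromise r), ?_⟩
  rintro _ ⟨ω, hω, -, rfl⟩
  exact Finset.sum_le_sum fun r _ =>
    mul_le_mul_of_nonneg_left (value_le_reset he (hω r)) (he.prob_pos r).le

theorem le_continuation (he : e.Regular) {s : ι} {y : ℝ} {ω : ι → ℝ}
    (h1 : ∀ r, ω r ∈ e.promises r) (h2 : e.autarky s ≤ y + e.β * ∑ r, e.prob r * ω r) :
    ∑ r, e.prob r * e.value r (ω r) ≤ e.continuation s y :=
  le_csSup (continuations_bddAbove he s y) ⟨ω, h1, h2, rfl⟩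

theorem floorLog_le (he : e.Regular) {s : ι} {y : ℝ} {ω : ι → ℝ}
    (h1 : ∀ r, ω r ∈ e.promises r) (h2 : e.autarky s ≤ y + e.β * ∑ r, e.prob r * ω r) :
    e.floorLog s ≤ y := by
  rw [he.autarky_eq, ← floorLog_eq he] at h2
  have : e.β * ∑ r, e.prob r * ω r ≤ e.β * ∑ r, e.prob r * e.promise r e.debtLimit :=
    mul_le_mul_of_nonneg_left (Finset.sum_le_sum fun r _ =>
      mul_le_mul_of_nonneg_left (h1 r).2 (he.prob_pos r).le) he.β_pos.le
  linarith

theorem continuation_mono (he : e.Regular) {s : ι} {y y' : ℝ} (hy : e.floorLog s ≤ y)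
    (h : y ≤ y') : e.continuation s y ≤ e.continuation s y' := by
  refine csSup_le_csSup (continuations_bddAbove he s y') (continuations_nonempty he hy) ?_
  rintro _ ⟨ω, h1, h2, rfl⟩
  exact ⟨ω, h1, h2.trans (by linarith), rfl⟩

theorem mix_mem_promises {r : ι} {x y a b : ℝ} (hx : x ∈ e.promises r) (hy : y ∈ e.promises r)
    (ha : 0 ≤ a) (hb : 0 ≤ b) (hab : a + b = 1) : a * x + b * y ∈ e.promises r :=
  convex_Icc _ _ hx hy ha hb hab

theorem continuation_concave (he : e.Regular) (s : ι) :
    ConcaveOn ℝ (Ici (e.floorLog s)) (e.continuation s) := by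
  refine ⟨convex_Ici _, fun x hx y hy a b ha hb hab => ?_⟩
  simp only [smul_eq_mul]
  have key : ∀ v ∈ e.continuations s x, ∀ v' ∈ e.continuations s y,
      a * v + b * v' ≤ e.continuation s (a * x + b * y) := by
    rintro _ ⟨ω, h1, h2, rfl⟩ _ ⟨ω', h1', h2', rfl⟩
    refine le_trans ?_ (le_continuation he (ω := fun r => a * ω r + b * ω' r)
      (fun r => mix_mem_promises (h1 r) (h1' r) ha hb hab) ?_)
    · rw [Finset.mul_sum, Finset.mul_sum, ← Finset.sum_add_distrib]
      refine Finset.sum_le_sum fun r _ => ?_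
      have h3 := (value_concave he r).2 (mem_Iic.2 (h1 r).2) (mem_Iic.2 (h1' r).2) ha hb hab
      have h4 := mul_le_mul_of_nonneg_left h3 (he.prob_pos r).le
      simp only [smul_eq_mul] at h4
      linarith
    · have h3 : ∑ r, e.prob r * (a * ω r + b * ω' r) =
          a * ∑ r, e.prob r * ω r + b * ∑ r, e.prob r * ω' r := by
        rw [Finset.mul_sum, Finset.mul_sum, ← Finset.sum_add_distrib]
        exact Finset.sum_congr rfl fun r _ => by ring
      have h4 : a * e.autarky s + b * e.autarky s = e.autarky s := by rw [← add_mul, hab, one_mul]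
      rw [h3]
      nlinarith [mul_le_mul_of_nonneg_left h2 ha, mul_le_mul_of_nonneg_left h2' hb]
  -- Degenerate weights are treated apart, since passing to the two suprema divides by `a` and `b`.
  rcases ha.eq_or_lt with rfl | ha
  · rw [zero_add] at hab; subst hab; simp
  rcases hb.eq_or_lt with rfl | hb
  · rw [add_zero] at hab; subst hab; simp
  have h1 : ∀ v ∈ e.continuations s x,
      a * v + b * e.continuation s y ≤ e.continuation s (a * x + b * y) := by
    intro v hv
    have : e.continuation s y ≤ (e.continuation s (a * x + b * y) - a * v) / b := by
      refine csSup_le (continuations_nonempty he hy) fun v' hv' => ?_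
      rw [le_div_iff₀ hb]
      linarith [key v hv v' hv']
    rw [le_div_iff₀ hb] at this
    linarith
  have : e.continuation s x ≤ (e.continuation s (a * x + b * y) - b * e.continuation s y) / a := by
    refine csSup_le (continuations_nonempty he hx) fun v hv => ?_
    rw [le_div_iff₀ ha]
    linarith [h1 v hv]
  rw [le_div_iff₀ ha] at this
  linarith

theorem promises_neg (he : e.Regular) {s : ι} {ω : ℝ} (h : ω ∈ e.promises s) : ω < 0 :=
  h.2.trans_lt (he.promise_debtLimit_neg s)

theorem floorLog_le_logYoung (he : e.Regular) {s : ι} {ω : ℝ} (h : ω ∈ e.promises s) :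
    e.floorLog s ≤ logYoung ω :=
  logYoung_le_logYoung h.2 (he.promise_debtLimit_neg s)

theorem one_sub_exp_le_share (he : e.Regular) {s : ι} {ω : ℝ} (h : ω ∈ e.promises s) :
    1 - Real.exp ω ≤ e.share s := by
  have := (Real.log_le_iff_le_exp (by linarith [he.share_lt_one s])).1 h.1
  linarith

theorem feasible_of_promises (he : e.Regular) {s : ι} {w : ℝ} (hw : w ∈ e.promises s) {ω : ι → ℝ}
    (h1 : ∀ r, ω r ∈ e.promises r)
    (h2 : e.autarky s ≤ logYoung w + e.β * ∑ r, e.prob r * ω r) :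
    e.Feasible s w (1 - Real.exp w, ω) := by
  refine ⟨one_sub_exp_pos (promises_neg he hw), ?_, one_sub_exp_le_share he hw, h1, h2⟩
  simp

/-- Giving the old exactly `w` is always allowed, so this holds at every promise. Equality needs
promise keeping to bind, hence the restriction to `binding` in `value_eq_continuation`. -/
theorem value_ge (he : e.Regular) {s : ι} {w : ℝ} (hw : w ∈ e.promises s) :
    e.flowOld w + e.δ * e.continuation s (logYoung w) ≤ e.value s w := by
  have h : e.continuation s (logYoung w) ≤ (e.value s w - e.flowOld w) / e.δ := by
    refine csSup_le (continuations_nonempty he (floorLog_le_logYoung he hw)) ?_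
    rintro _ ⟨ω, h1, h2, rfl⟩
    have h3 := objective_le_value he (feasible_of_promises he hw h1 h2)
    rw [objective, flow_eq_flowOld] at h3
    rw [le_div_iff₀ he.δ_pos]
    linarith
  rw [le_div_iff₀ he.δ_pos] at h
  linarith

/-- Promises from the reset level up to the debt limit. -/
def binding (e : Economy ι) (s : ι) : Set ℝ := Icc (e.resetPromise s) (e.promise s e.debtLimit)

theorem mem_promises_of_binding (he : e.Regular) {s : ι} {w : ℝ} (hw : w ∈ e.binding s) :
    w ∈ e.promises s :=
  ⟨(resetPromise_mem he s).1.trans hw.1, hw.2⟩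

/-- The promises chosen at the promise `w` in state `s`. -/
noncomputable def nextPromise (e : Economy ι) (s : ι) (w : ℝ) (r : ι) : ℝ := (e.policy s w).2 r

theorem nextPromise_mem_binding (he : e.Regular) {s : ι} {w : ℝ} (hw : w ∈ e.binding s) (r : ι) :
    e.nextPromise s w r ∈ e.binding r :=
  ⟨(policy_spec he hw.2).2.2 r, ((policy_spec he hw.2).1.2.2.2.1 r).2⟩

theorem nextPromise_mem (he : e.Regular) {s : ι} {w : ℝ} (hw : w ∈ e.binding s) (r : ι) :
    e.nextPromise s w r ∈ e.promises r :=
  mem_promises_of_binding he (nextPromise_mem_binding he hw r)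

theorem participation (he : e.Regular) {s : ι} {w : ℝ} (hw : w ∈ e.binding s) :
    e.autarky s ≤ logYoung w + e.β * ∑ r, e.prob r * e.nextPromise s w r := by
  have h := policy_spec he hw.2
  have h1 := h.1.2.2.2.2
  rwa [h.fst_eq he hw.1 hw.2] at h1

theorem value_eq_nextPromise (he : e.Regular) {s : ι} {w : ℝ} (hw : w ∈ e.binding s) :
    e.value s w = e.flowOld w + e.δ * ∑ r, e.prob r * e.value r (e.nextPromise s w r) := by
  have h := policy_spec he hw.2
  rw [h.value_eq he hw.2, objective, h.fst_eq he hw.1 hw.2, flow_eq_flowOld]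
  rfl

theorem continuation_eq (he : e.Regular) {s : ι} {w : ℝ} (hw : w ∈ e.binding s) :
    e.continuation s (logYoung w) = ∑ r, e.prob r * e.value r (e.nextPromise s w r) := by
  refine le_antisymm ?_ (le_continuation he (nextPromise_mem he hw) (participation he hw))
  have h1 := value_ge he (mem_promises_of_binding he hw)
  rw [value_eq_nextPromise he hw] at h1
  exact le_of_mul_le_mul_left (by linarith) he.δ_pos

theorem value_eq_continuation (he : e.Regular) {s : ι} {w : ℝ} (hw : w ∈ e.binding s) :
    e.value s w = e.flowOld w + e.δ * e.continuation s (logYoung w) := by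
  rw [continuation_eq he hw, value_eq_nextPromise he hw]

theorem sum_update [DecidableEq ι] (F : ι → ℝ → ℝ) (b : ι → ℝ) (r : ι) (z : ℝ) :
    ∑ j, F j (Function.update b r z j) = ∑ j, F j (b j) + (F r z - F r (b r)) := by
  rw [← sub_eq_iff_eq_add', ← Finset.sum_sub_distrib, Finset.sum_eq_single r]
  · simp
  · intro j _ hj
    simp [hj]
  · simp

/-- Changing one promise and adjusting consumption. -/
theorem le_continuation_update (he : e.Regular) {s : ι} {w : ℝ} (hw : w ∈ e.binding s) (r : ι)
    {z y : ℝ} (hz : z ∈ e.promises r)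
    (hy : logYoung w + e.β * e.prob r * (e.nextPromise s w r - z) ≤ y) :
    e.continuation s (logYoung w) +
      e.prob r * (e.value r z - e.value r (e.nextPromise s w r)) ≤ e.continuation s y := by
  classical
  have h1 := le_continuation he (s := s) (y := y) (ω := Function.update (e.nextPromise s w) r z)
    (fun j => by
      rcases eq_or_ne j r with rfl | hj
      · simpa using hz
      · simpa [hj] using nextPromise_mem he hw j)
    (by
      rw [sum_update (fun j x => e.prob j * x)]
      have := participation he hw
      linarith)
  rw [sum_update (fun j x => e.prob j * e.value j x)] at h1
  rw [continuation_eq he hw]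
  linarith

/-- A supergradient of the continuation value is a common multiplier for all promises. -/
theorem isSupergradient_value (he : e.Regular) {s : ι} {w l : ℝ} (hw : w ∈ e.binding s)
    (hl : IsSupergradient (e.continuation s) (Ici (e.floorLog s)) (logYoung w) l) (r : ι) :
    IsSupergradient (e.value r) (e.promises r) (e.nextPromise s w r) (-(e.β * l)) := by
  intro z hz
  have h2 := le_continuation_update he hw r hz le_rfl
  -- The perturbed consumption stays in the domain of the continuation value because feasible
  -- promises support it.
  have h3 : e.floorLog s ≤ logYoung w + e.β * e.prob r * (e.nextPromise s w r - z) := by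
    classical
    refine floorLog_le he (ω := Function.update (e.nextPromise s w) r z)
      (fun j => ?_) ?_
    · rcases eq_or_ne j r with rfl | hj
      · simpa using hz
      · simpa [hj] using nextPromise_mem he hw j
    · rw [sum_update (fun j x => e.prob j * x)]
      have := participation he hw
      linarith
  have h4 := hl _ h3
  have h5 : 0 < e.prob r := he.prob_pos r
  have h6 : e.prob r * (e.value r z - e.value r (e.nextPromise s w r)) ≤
      e.prob r * (e.β * l * (e.nextPromise s w r - z)) := by nlinarith
  have h7 := le_of_mul_le_mul_left h6 h5
  linarith

end Economy

theorem concave_four_point {S : Set ℝ} {F : ℝ → ℝ} (h : ConcaveOn ℝ S F) {a b u : ℝ} (ha : a ∈ S)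
    (hb : b + u ∈ S) (hab : a ≤ b) (hu : 0 ≤ u) : F (b + u) - F b ≤ F (a + u) - F a := by
  have h1 := Economy.concave_three_point h (y := a + u) ha hb (by linarith) (by linarith)
  have h2 := Economy.concave_three_point h (y := b) ha hb hab (by linarith)
  rcases (show a ≤ b + u by linarith).eq_or_lt with h3 | h3
  · have h4 : b = a := by linarith
    subst h4
    exact le_rfl
  · by_contra! hc
    nlinarith [mul_lt_mul_of_pos_left hc (sub_pos.2 h3)]

/-! ### The two-state economy: assumptions and first best. -/

namespace Economy

variable {e : Economy (Fin 2)}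

/-- The first-best promise to the old when the young are rich. -/
noncomputable def bestPromise {ι : Type} (e : Economy ι) : ℝ := Real.log (1 - e.δ / (e.β + e.δ))

/-- The derivative of `flowOld`. -/
noncomputable def slopeOld {ι : Type} (e : Economy ι) (w : ℝ) : ℝ := e.β / e.δ - odds w

/-- The assumptions of the two-state example. -/
structure TwoState (e : Economy (Fin 2)) : Prop extends Regular e where
  poor : e.share 0 ≤ e.δ / (e.β + e.δ)
  rich : e.δ / (e.β + e.δ) < e.share 1
  violates : Real.log (e.δ / (e.β + e.δ)) + e.β * (e.prob 0 * Real.log (1 - e.share 0) +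
    e.prob 1 * e.bestPromise) < e.autarky 1
  best_lt : e.bestPromise < e.promise 1 e.debtLimit
  criticalDebt_pos : 0 < e.criticalDebt
  next_lt : e.nextPromise 1 e.bestPromise 0 < e.promise 0 e.criticalDebt

section FirstBest

variable {ι : Type} [Fintype ι] {e : Economy ι}

theorem exp_bestPromise (he : e.Regular) : Real.exp e.bestPromise = 1 - e.δ / (e.β + e.δ) := by
  have := he.β_pos
  have := he.δ_pos
  refine Real.exp_log ?_
  rw [sub_pos, div_lt_one (by positivity)]
  linarith

theorem bestPromise_neg (he : e.Regular) : e.bestPromise < 0 := by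
  have := he.β_pos
  have := he.δ_pos
  rw [← Real.exp_lt_exp, exp_bestPromise he, Real.exp_zero]
  have : 0 < e.δ / (e.β + e.δ) := by positivity
  linarith

theorem odds_bestPromise (he : e.Regular) : odds e.bestPromise = e.β / e.δ := by
  have := he.β_pos
  have := he.δ_pos
  have h : 1 - e.δ / (e.β + e.δ) = e.β / (e.β + e.δ) := by field_simp; ring
  rw [odds, exp_bestPromise he, sub_sub_cancel, h, div_div_div_cancel_right₀ (by positivity)]

theorem logYoung_bestPromise (he : e.Regular) :
    logYoung e.bestPromise = Real.log (e.δ / (e.β + e.δ)) := by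
  rw [logYoung, exp_bestPromise he, sub_sub_cancel]

theorem slopeOld_bestPromise (he : e.Regular) : e.slopeOld e.bestPromise = 0 := by
  rw [slopeOld, odds_bestPromise he, sub_self]

theorem slopeOld_lt {w w' : ℝ} (h : w < w') (hw' : w' < 0) : e.slopeOld w' < e.slopeOld w := by
  have := odds_lt_odds h hw'
  unfold slopeOld
  linarith

theorem slopeOld_le {w w' : ℝ} (h : w ≤ w') (hw' : w' < 0) : e.slopeOld w' ≤ e.slopeOld w := by
  have := odds_le_odds h hw'
  unfold slopeOld
  linarith

theorem flowOld_lt {z w : ℝ} (hz : z < 0) (hw : w < 0) (h : z ≠ w) :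
    e.flowOld z < e.flowOld w + e.slopeOld w * (z - w) := by
  have := logYoung_lt hz hw h
  unfold flowOld slopeOld
  linarith

theorem hasDerivAt_flowOld {w : ℝ} (hw : w < 0) : HasDerivAt e.flowOld (e.slopeOld w) w := by
  have h := ((hasDerivAt_id w).const_mul (e.β / e.δ)).add (hasDerivAt_logYoung hw)
  rw [mul_one] at h
  exact h

theorem flowOld_lt_flowOld (he : e.Regular) {z w : ℝ} (hw : e.bestPromise ≤ w) (h : w < z)
    (hz : z < 0) : e.flowOld z < e.flowOld w := by
  have h1 := flowOld_lt (e := e) hz (h.trans hz) h.ne'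
  have h2 := slopeOld_le (e := e) hw (h.trans hz)
  rw [slopeOld_bestPromise he] at h2
  nlinarith

theorem flowOld_le_flowOld (he : e.Regular) {z w : ℝ} (hw : e.bestPromise ≤ w) (h : w ≤ z)
    (hz : z < 0) : e.flowOld z ≤ e.flowOld w := by
  rcases h.eq_or_lt with rfl | h
  · exact le_rfl
  · exact (flowOld_lt_flowOld he hw h hz).le

theorem log_one_sub_criticalDebt (he : e.Regular) : Real.log (1 - e.criticalDebt) =
    -e.β * ∑ r, e.prob r * (e.resetPromise r - Real.log (1 - e.share r)) := by
  have h : ∀ r, Real.log (1 - e.share r + e.share r * e.resetDebt r) = e.resetPromise r :=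
    fun r => he.promise_debt r _
  rw [criticalDebt, sub_sub_cancel, Real.log_exp]
  simp only [h]

theorem criticalDebt_lt_one : e.criticalDebt < 1 := by
  rw [criticalDebt]
  linarith [Real.exp_pos (-e.β * ∑ r, e.prob r *
    (Real.log (1 - e.share r + e.share r * e.resetDebt r) - Real.log (1 - e.share r)))]

theorem criticalDebt_le (he : e.Regular) : e.criticalDebt ≤ e.debtLimit := by
  obtain ⟨h0, h1, h2⟩ := he.debtLimit_mem
  have h3 : Real.log (1 - e.debtLimit) ≤ Real.log (1 - e.criticalDebt) := by
    rw [log_one_sub_criticalDebt he]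
    have h4 : e.β * ∑ r, e.prob r * (e.resetPromise r - Real.log (1 - e.share r)) ≤
        e.β * ∑ r, e.prob r *
          (Real.log (1 - e.share r + e.share r * e.debtLimit) - Real.log (1 - e.share r)) :=
      mul_le_mul_of_nonneg_left (Finset.sum_le_sum fun r _ => mul_le_mul_of_nonneg_left
        (sub_le_sub_right (resetPromise_mem he r).2 _) (he.prob_pos r).le) he.β_pos.le
    unfold surplus at h2
    linarith
  have := (Real.log_le_log_iff (by linarith) (sub_pos.2 criticalDebt_lt_one)).1 h3
  linarith

end FirstBest

/-! ### The poor state -/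

/-- Promises in the poor state that allow resetting next period. -/
def resetting (e : Economy (Fin 2)) : Set ℝ :=
  Icc (Real.log (1 - e.share 0)) (e.promise 0 e.criticalDebt)

theorem mem_promises_of_resetting (he : e.TwoState) {w : ℝ} (hw : w ∈ e.resetting) :
    w ∈ e.promises 0 :=
  ⟨hw.1, hw.2.trans (he.promise_le_promise 0 he.criticalDebt_pos.le (criticalDebt_le he.toRegular))⟩

theorem bestPromise_le_log (he : e.TwoState) : e.bestPromise ≤ Real.log (1 - e.share 0) := by
  have := he.β_pos
  have := he.δ_pos
  refine Real.log_le_log ?_ (by linarith [he.poor])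
  rw [sub_pos, div_lt_one (by positivity)]
  linarith

theorem participation_reset (he : e.TwoState) {w : ℝ} (hw : w ∈ e.resetting) :
    e.autarky 0 ≤ logYoung w + e.β * ∑ r, e.prob r * e.resetPromise r := by
  have h1 := logYoung_le_logYoung hw.2
    (promises_neg he.toRegular (mem_promises_of_resetting he
      ⟨hw.1.trans hw.2, le_rfl⟩))
  rw [logYoung, exp_promise he.toRegular 0 he.criticalDebt_pos.le,
    Real.log_mul (he.share_pos 0).ne' (sub_pos.2 criticalDebt_lt_one).ne',
    log_one_sub_criticalDebt he.toRegular] at h1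
  simp only [mul_sub, Finset.sum_sub_distrib] at h1
  unfold autarky
  linarith

theorem objective_le_resetting (he : e.TwoState) {w : ℝ} (hw : w ∈ e.resetting)
    {a : ℝ × (Fin 2 → ℝ)} (ha : e.Feasible 0 w a) : e.flow a.1 ≤ e.flowOld w := by
  obtain ⟨h1, h2, h3, h4, h5⟩ := ha
  have hlt : 0 < 1 - a.1 := by linarith [he.share_lt_one 0]
  have h6 : a.1 = 1 - Real.exp (Real.log (1 - a.1)) := by rw [Real.exp_log hlt]; ring
  rw [h6, flow_eq_flowOld]
  exact flowOld_le_flowOld he.toRegular ((bestPromise_le_log he).trans hw.1) h2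
    (Real.log_neg hlt (by linarith))

/-- Resetting is compatible with participation here and maximizes the continuation. The flow
decreases above the first-best promise, and all promises in the poor state lie above it, so keeping
the promise exactly maximizes the flow. Both parts of the objective are maximal together. -/
theorem value_poor (he : e.TwoState) {w : ℝ} (hw : w ∈ e.resetting) :
    e.value 0 w = e.flowOld w + e.δ * ∑ r, e.prob r * e.value r (e.resetPromise r) := by
  refine le_antisymm ?_ ?_
  · obtain ⟨a, ha, h⟩ := exists_feasible_value he.toRegular (mem_promises_of_resetting he hw).2
    refine h.trans (add_le_add (objective_le_resetting he hw ha) ?_)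
    exact mul_le_mul_of_nonneg_left (Finset.sum_le_sum fun r _ => mul_le_mul_of_nonneg_left
      (value_le_reset he.toRegular (ha.2.2.2.1 r)) (he.prob_pos r).le) he.δ_pos.le
  · have h := objective_le_value he.toRegular (feasible_of_promises he.toRegular
      (mem_promises_of_resetting he hw) (fun r => resetPromise_mem he.toRegular r)
      (participation_reset he hw))
    rwa [objective, flow_eq_flowOld] at h

/-- Every term of the optimal continuation is at most its reset value and the sums agree, so every
term agrees; the reset promise is the largest maximizer. -/
theorem nextPromise_poor (he : e.TwoState) {w : ℝ} (hw : w ∈ e.resetting) (r : Fin 2) :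
    e.nextPromise 0 w r = e.resetPromise r := by
  have hw' := mem_promises_of_resetting he hw
  have h := policy_spec he.toRegular hw'.2
  have h1 := h.value_eq he.toRegular hw'.2
  rw [value_poor he hw, objective] at h1
  have h2 := objective_le_resetting he hw h.1
  have hle : ∀ j, e.prob j * e.value j ((e.policy 0 w).2 j) ≤
      e.prob j * e.value j (e.resetPromise j) := fun j => mul_le_mul_of_nonneg_left
    (value_le_reset he.toRegular (h.1.2.2.2.1 j)) (he.prob_pos j).le
  have h3 : ∑ j, e.prob j * e.value j (e.resetPromise j) ≤
      ∑ j, e.prob j * e.value j ((e.policy 0 w).2 j) :=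
    le_of_mul_le_mul_left (by linarith) he.δ_pos
  have h4 := (Finset.sum_eq_sum_iff_of_le fun j _ => hle j).1
    (le_antisymm (Finset.sum_le_sum fun j _ => hle j) h3) r (Finset.mem_univ r)
  have h5 := mul_left_cancel₀ (he.prob_pos r).ne' h4
  exact le_antisymm (le_resetPromise he.toRegular (h.1.2.2.2.1 r) h5.ge) (h.2.2 r)

theorem log_lt_critical (he : e.TwoState) :
    Real.log (1 - e.share 0) < e.promise 0 e.criticalDebt := by
  rw [← promise_zero]
  exact he.promise_lt_promise 0 le_rfl he.criticalDebt_pos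

theorem log_mem_resetting (he : e.TwoState) : Real.log (1 - e.share 0) ∈ e.resetting :=
  ⟨le_rfl, (log_lt_critical he).le⟩

theorem resetPromise_poor (he : e.TwoState) : e.resetPromise 0 = Real.log (1 - e.share 0) := by
  have hm := resetPromise_mem he.toRegular 0
  refine le_antisymm ?_ hm.1
  by_contra! h
  -- Truncated at the critical promise, up to which the explicit value is available.
  set z := min (e.resetPromise 0) (e.promise 0 e.criticalDebt) with hz
  have hz1 : Real.log (1 - e.share 0) < z := lt_min h (log_lt_critical he)
  have hzr : z ∈ e.resetting := ⟨hz1.le, min_le_right _ _⟩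
  have h1 := value_antitone he.toRegular (min_le_left _ _ : z ≤ e.resetPromise 0) hm.2
  have h2 := value_le_reset he.toRegular (mem_promises_of_resetting he (log_mem_resetting he))
  rw [value_poor he hzr] at h1
  rw [value_poor he (log_mem_resetting he)] at h2
  have h3 := flowOld_lt_flowOld he.toRegular (bestPromise_le_log he) hz1
    (promises_neg he.toRegular (mem_promises_of_resetting he hzr))
  linarith

/-! ### The rich state -/

theorem best_mem_promises (he : e.TwoState) : e.bestPromise ∈ e.promises 1 := by
  refine ⟨Real.log_le_log (by linarith [he.share_lt_one 1]) (by linarith [he.rich]), he.best_lt.le⟩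

theorem log_lt_best (he : e.TwoState) : Real.log (1 - e.share 1) < e.bestPromise :=
  Real.log_lt_log (by linarith [he.share_lt_one 1]) (by linarith [he.rich])

/-- Coming down to the first-best promise from above raises the flow strictly, and it raises the
young's consumption and with it the continuation value. -/
theorem reset_le_best (he : e.TwoState) : e.resetPromise 1 ≤ e.bestPromise := by
  by_contra! h
  have hm := resetPromise_mem he.toRegular 1
  have h1 := value_eq_continuation he.toRegular (w := e.resetPromise 1) (s := 1) ⟨le_rfl, hm.2⟩
  have h2 := value_ge he.toRegular (best_mem_promises he)
  have h3 := value_le_reset he.toRegular (best_mem_promises he)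
  have hneg := promises_neg he.toRegular hm
  have h4 := flowOld_lt_flowOld he.toRegular le_rfl h hneg
  have h5 := continuation_mono he.toRegular (floorLog_le_logYoung he.toRegular hm)
    (logYoung_le_logYoung h.le hneg)
  have h6 := mul_le_mul_of_nonneg_left h5 he.δ_pos.le
  linarith

theorem best_mem_binding (he : e.TwoState) : e.bestPromise ∈ e.binding 1 :=
  ⟨reset_le_best he, he.best_lt.le⟩

theorem mem_binding_of_le (he : e.TwoState) {w : ℝ} (h1 : e.resetPromise 1 ≤ w)
    (h2 : w ≤ e.bestPromise) : w ∈ e.binding 1 :=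
  ⟨h1, h2.trans he.best_lt.le⟩

theorem logYoung_mem_interior (he : e.TwoState) {w : ℝ} (hw : w ≤ e.bestPromise) :
    logYoung w ∈ interior (Ici (e.floorLog 1)) := by
  rw [interior_Ici]
  exact logYoung_lt_logYoung (hw.trans_lt he.best_lt) (he.promise_debtLimit_neg 1)

/-- Suppose w' = T(w*) > w*. Lowering w' by u raises the flow by at least ηu and the young's log
consumption by at least (β/δ)u. By concavity the continuation then gains at least what the increment
(β/δ)u brings at w*, where the young consume more. Since -βl bounds the slope of V(1,·) at w', the
right slope of the continuation at w* is at most l - η/β, although l is its least supergradient. -/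
theorem next_best_le (he : e.TwoState) : e.nextPromise 1 e.bestPromise 1 ≤ e.bestPromise := by
  by_contra! h
  set w := e.bestPromise with hwdef
  set w' := e.nextPromise 1 w 1 with hw'def
  have hb : w ∈ e.binding 1 := best_mem_binding he
  have hb' : w' ∈ e.binding 1 := nextPromise_mem_binding he.toRegular hb 1
  have hp' := mem_promises_of_binding he.toRegular hb'
  have hneg' := promises_neg he.toRegular hp'
  have hcc := continuation_concave he.toRegular 1
  obtain ⟨l, hl, hmin⟩ := exists_least_supergradient hcc (logYoung_mem_interior he (le_refl w))
  have hsg := isSupergradient_value he.toRegular hb hl 1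
  have hβ := he.β_pos
  have hδ := he.δ_pos
  -- Staying above the midpoint keeps the odds, and hence the gain `η`, uniformly away from their
  -- first-best level.
  set z₁ := (w + w') / 2 with hz₁
  have ho : e.β / e.δ < odds z₁ := by
    rw [← odds_bestPromise he.toRegular]
    exact odds_lt_odds (by linarith) (by linarith)
  set η := odds z₁ - e.β / e.δ with hη
  have hηpos : 0 < η := sub_pos.2 ho
  have hle := hmin (l - η / e.β) (by
    have hu0 : 0 < e.β / e.δ * (w' - z₁) := mul_pos (div_pos hβ hδ) (by linarith)
    filter_upwards [Ioo_mem_nhdsGT (show logYoung w < logYoung w + e.β / e.δ * (w' - z₁) by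
      linarith)] with y hy
    obtain ⟨u, rfl⟩ : ∃ u, y = logYoung w + e.β / e.δ * u :=
      ⟨(y - logYoung w) / (e.β / e.δ), by field_simp; ring⟩
    have hu1 : 0 < u := by
      have := hy.1
      exact pos_of_mul_pos_right (by linarith : 0 < e.β / e.δ * u) (div_pos hβ hδ).le
    have hu2 : u < w' - z₁ := lt_of_mul_lt_mul_left (by linarith [hy.2]) (div_pos hβ hδ).le
    have hzm : w' - u ∈ e.promises 1 :=
      ⟨(best_mem_promises he).1.trans (by linarith), by linarith [hp'.2]⟩
    have hzneg := promises_neg he.toRegular hzm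
    have h1 := value_ge he.toRegular hzm
    have h2 := hsg _ hzm
    have h3 := value_eq_continuation he.toRegular hb'
    have h4 := logYoung_le hneg' hzneg
    have h5 : odds z₁ ≤ odds (w' - u) := odds_le_odds (by linarith) hzneg
    have h6 : odds z₁ * u ≤ logYoung (w' - u) - logYoung w' := by nlinarith
    have h7 : e.flowOld (w' - u) - e.flowOld w' ≥ η * u := by
      unfold flowOld
      rw [hη]
      linarith
    have h8 := continuation_mono he.toRegular
      (y := logYoung w' + e.β / e.δ * u) (y' := logYoung (w' - u))
      ((floorLog_le_logYoung he.toRegular hp').trans (by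
        have : 0 < e.β / e.δ * u := by positivity
        linarith)) (by nlinarith)
    have h9 := concave_four_point hcc (a := logYoung w') (b := logYoung w) (u := e.β / e.δ * u)
      (floorLog_le_logYoung he.toRegular hp')
      ((floorLog_le_logYoung he.toRegular (best_mem_promises he)).trans hy.1.le)
      (logYoung_le_logYoung h.le hneg') (by positivity)
    have h10 : e.δ * (e.continuation 1 (logYoung w + e.β / e.δ * u) -
        e.continuation 1 (logYoung w)) ≤ (e.β * l - η) * u := by
      have := mul_le_mul_of_nonneg_left (h9.trans (sub_le_sub_right h8 _)) hδ.le
      rw [show w' - u - w' = -u by ring] at h2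
      linarith
    have h11 : (e.β * l - η) * u = e.δ * ((l - η / e.β) * (e.β / e.δ * u)) := by
      field_simp
    rw [h11] at h10
    have := le_of_mul_le_mul_left h10 hδ
    linarith)
  have : 0 < η / e.β := by positivity
  linarith

/-- The mirror image of `next_best_le`: raise T(w) instead and use the greatest supergradient. The
hypothesis T(w) ≤ w orders the two consumption levels for the concavity step. At the first best it
gives the fixed point; below it, it forces T(w) > w. -/
theorem best_le_next (he : e.TwoState) {w : ℝ} (hr : e.resetPromise 1 ≤ w)
    (hw : w ≤ e.bestPromise) (hT : e.nextPromise 1 w 1 ≤ w) :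
    e.bestPromise ≤ e.nextPromise 1 w 1 := by
  by_contra! h
  set w' := e.nextPromise 1 w 1 with hw'def
  have hb : w ∈ e.binding 1 := mem_binding_of_le he hr hw
  have hb' : w' ∈ e.binding 1 := nextPromise_mem_binding he.toRegular hb 1
  have hp := mem_promises_of_binding he.toRegular hb
  have hp' := mem_promises_of_binding he.toRegular hb'
  have hneg := promises_neg he.toRegular hp
  have hneg' := promises_neg he.toRegular hp'
  have hcc := continuation_concave he.toRegular 1
  have hint := logYoung_mem_interior he hw
  obtain ⟨l, hl, hmax⟩ := exists_greatest_supergradient hcc hint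
  have hsg := isSupergradient_value he.toRegular hb hl 1
  have hβ := he.β_pos
  have hδ := he.δ_pos
  set z₁ := (w' + e.bestPromise) / 2 with hz₁
  have hbneg := bestPromise_neg he.toRegular
  have ho : odds z₁ < e.β / e.δ := by
    rw [← odds_bestPromise he.toRegular]
    exact odds_lt_odds (by linarith) hbneg
  set η := e.β / e.δ - odds z₁ with hη
  have hηpos : 0 < η := sub_pos.2 ho
  have hle := hmax (l + η / e.β) (by
    have hu0 : 0 < e.β / e.δ * (z₁ - w') := mul_pos (div_pos hβ hδ) (by linarith)
    rw [interior_Ici] at hint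
    filter_upwards [Ioo_mem_nhdsLT (show logYoung w - e.β / e.δ * (z₁ - w') < logYoung w by
      linarith), Ioo_mem_nhdsLT hint] with y hy hy'
    obtain ⟨u, rfl⟩ : ∃ u, y = logYoung w - e.β / e.δ * u :=
      ⟨-((y - logYoung w) / (e.β / e.δ)), by field_simp; ring⟩
    have hu1 : 0 < u := by
      have := hy.2
      exact pos_of_mul_pos_right (by linarith : 0 < e.β / e.δ * u) (div_pos hβ hδ).le
    have hu2 : u < z₁ - w' := lt_of_mul_lt_mul_left (by linarith [hy.1]) (div_pos hβ hδ).le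
    have hzm : w' + u ∈ e.promises 1 :=
      ⟨by linarith [hp'.1], by linarith [he.best_lt]⟩
    have hzneg := promises_neg he.toRegular hzm
    have h1 := value_ge he.toRegular hzm
    have h2 := hsg _ hzm
    have h3 := value_eq_continuation he.toRegular hb'
    have h4 := logYoung_le hneg' hzneg
    have h5 : odds (w' + u) ≤ odds z₁ := odds_le_odds (by linarith) (by linarith)
    have h6 : logYoung w' - logYoung (w' + u) ≤ odds z₁ * u := by nlinarith
    have h7 : e.flowOld (w' + u) - e.flowOld w' ≥ η * u := by
      unfold flowOld
      rw [hη]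
      linarith
    have hyy : logYoung w ≤ logYoung w' := logYoung_le_logYoung hT hneg
    have h8 := continuation_mono he.toRegular
      (y := logYoung w' - e.β / e.δ * u) (y' := logYoung (w' + u))
      (by linarith [hy'.1]) (by nlinarith)
    have h9 := concave_four_point hcc (a := logYoung w - e.β / e.δ * u)
      (b := logYoung w' - e.β / e.δ * u) (u := e.β / e.δ * u) hy'.1.le
      (by rw [sub_add_cancel]; exact floorLog_le_logYoung he.toRegular hp')
      (by linarith) (by positivity)
    rw [sub_add_cancel, sub_add_cancel] at h9
    have h10 : (e.β * l + η) * u ≤ e.δ * (e.continuation 1 (logYoung w) -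
        e.continuation 1 (logYoung w - e.β / e.δ * u)) := by
      have := mul_le_mul_of_nonneg_left ((sub_le_sub_left h8 _).trans h9) hδ.le
      rw [show w' + u - w' = u by ring] at h2
      linarith
    have h11 : (e.β * l + η) * u = e.δ * ((l + η / e.β) * (e.β / e.δ * u)) := by
      field_simp
    rw [h11] at h10
    have := le_of_mul_le_mul_left h10 hδ
    linarith)
  have : 0 < η / e.β := by positivity
  linarith

/-- First-best debt is a stationary point of the debt policy in the rich state. -/
theorem next_best (he : e.TwoState) : e.nextPromise 1 e.bestPromise 1 = e.bestPromise :=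
  (next_best_le he).antisymm
    (best_le_next he (reset_le_best he) le_rfl (next_best_le he))

theorem participation_rich (he : e.TwoState) {w : ℝ} (hw : w ∈ e.binding 1) :
    e.autarky 1 ≤ logYoung w + e.β * (e.prob 0 * e.nextPromise 1 w 0 +
      e.prob 1 * e.nextPromise 1 w 1) := by
  have h := participation he.toRegular hw
  rwa [Fin.sum_univ_two] at h

/-- The rich promise stays at the first best, so zero debt in the poor state would make the first
best satisfy participation. -/
theorem log_lt_next_best (he : e.TwoState) :
    Real.log (1 - e.share 0) < e.nextPromise 1 e.bestPromise 0 := by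
  have h1 := participation_rich he (best_mem_binding he)
  have h2 := he.violates
  rw [next_best he, logYoung_bestPromise he.toRegular] at h1
  have h3 := lt_of_mul_lt_mul_left (by linarith : e.β * (e.prob 0 * Real.log (1 - e.share 0) +
    e.prob 1 * e.bestPromise) < e.β * (e.prob 0 * e.nextPromise 1 e.bestPromise 0 +
      e.prob 1 * e.bestPromise)) he.β_pos.le
  exact lt_of_mul_lt_mul_left (by linarith) (he.prob_pos 0).le

end Economy

namespace Economy

variable {e : Economy (Fin 2)}

/-! ### Differentiability of the value in the rich state -/

/-- The promise to the poor state that compensates for moving the current promise from `w` to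
`z`. -/
noncomputable def compensate (e : Economy (Fin 2)) (w z : ℝ) : ℝ :=
  e.nextPromise 1 w 0 - (logYoung z - logYoung w) / (e.β * e.prob 0)

/-- A differentiable minorant of the value in the rich state that touches it at `w`. -/
noncomputable def minorant (e : Economy (Fin 2)) (w z : ℝ) : ℝ :=
  e.value 1 w + (e.flowOld z - e.flowOld w) +
    e.δ * (e.prob 0 * (e.flowOld (e.compensate w z) - e.flowOld (e.nextPromise 1 w 0)))

/-- The derivative of the value in the rich state. -/
noncomputable def slopeValue (e : Economy (Fin 2)) (w : ℝ) : ℝ :=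
  e.slopeOld w + e.δ / e.β * e.slopeOld (e.nextPromise 1 w 0) * odds w

theorem compensate_self (w : ℝ) : e.compensate w w = e.nextPromise 1 w 0 := by
  simp [compensate]

theorem minorant_self (w : ℝ) : e.minorant w w = e.value 1 w := by
  simp [minorant, compensate_self]

theorem hasDerivAt_compensate {w : ℝ} (hw : w < 0) :
    HasDerivAt (e.compensate w) (odds w / (e.β * e.prob 0)) w := by
  have h := (((hasDerivAt_logYoung hw).sub_const (logYoung w)).div_const
    (e.β * e.prob 0)).const_sub (e.nextPromise 1 w 0)
  rw [neg_div, neg_neg] at h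
  exact h

theorem hasDerivAt_minorant (he : e.TwoState) {w : ℝ} (hw : w ∈ e.binding 1) :
    HasDerivAt (e.minorant w) (e.slopeValue w) w := by
  have hneg := promises_neg he.toRegular (mem_promises_of_binding he.toRegular hw)
  have hneg0 := promises_neg he.toRegular (nextPromise_mem he.toRegular hw 0)
  have h1 : HasDerivAt (fun z => e.flowOld (e.compensate w z))
      (e.slopeOld (e.nextPromise 1 w 0) * (odds w / (e.β * e.prob 0))) w := by
    have h : HasDerivAt e.flowOld (e.slopeOld (e.nextPromise 1 w 0)) (e.compensate w w) := by
      rw [compensate_self]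
      exact hasDerivAt_flowOld hneg0
    exact h.comp w (hasDerivAt_compensate hneg)
  have h2 := (((hasDerivAt_flowOld (e := e) hneg).sub_const (e.flowOld w)).const_add
    (e.value 1 w)).add (((h1.sub_const (e.flowOld (e.nextPromise 1 w 0))).const_mul
      (e.prob 0)).const_mul e.δ)
  have hβ := he.β_pos.ne'
  have hp := (he.prob_pos 0).ne'
  refine h2.congr_deriv ?_
  rw [slopeValue]
  field_simp

/-- The minorant is the payoff of a feasible plan that changes only the promise to the poor state.
Both poor promises lie in the resetting range, so their values are explicit up to a common constant.
-/
theorem minorant_le (he : e.TwoState) {w z : ℝ} (hw : w ∈ e.binding 1) (hz : z ∈ e.promises 1)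
    (hb : e.nextPromise 1 w 0 ∈ e.resetting) (hc : e.compensate w z ∈ e.resetting) :
    e.minorant w z ≤ e.value 1 z := by
  have h1 := value_ge he.toRegular hz
  have h2 := value_eq_continuation he.toRegular hw
  have hpos : 0 < e.β * e.prob 0 := mul_pos he.β_pos (he.prob_pos 0)
  have h3 := le_continuation_update he.toRegular hw 0 (mem_promises_of_resetting he hc)
    (y := logYoung z) (by
      rw [compensate, sub_sub_cancel, mul_div_cancel₀ _ hpos.ne']
      linarith)
  rw [value_poor he hb, value_poor he hc] at h3
  have h4 := mul_le_mul_of_nonneg_left h3 he.δ_pos.le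
  unfold minorant
  linarith

/-- A larger promise takes consumption from the young, so the compensating promise rises and needs
room below the critical debt only. On the left it falls and needs room above zero debt. -/
theorem eventually_minorant_right (he : e.TwoState) {w : ℝ} (hw : w ∈ e.binding 1)
    (hU : w < e.promise 1 e.debtLimit) (hb : e.nextPromise 1 w 0 < e.promise 0 e.criticalDebt) :
    ∀ᶠ z in 𝓝[>] w, z ∈ e.promises 1 ∧ e.minorant w z ≤ e.value 1 z := by
  have hp := mem_promises_of_binding he.toRegular hw
  have hneg := promises_neg he.toRegular hp
  have hlow := (nextPromise_mem he.toRegular hw 0).1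
  have hc := (hasDerivAt_compensate (e := e) hneg).continuousAt
  have h1 : ∀ᶠ z in 𝓝 w, e.compensate w z < e.promise 0 e.criticalDebt :=
    hc.eventually_lt_const (by rwa [compensate_self])
  filter_upwards [Ioo_mem_nhdsGT hU, h1.filter_mono nhdsWithin_le_nhds] with z hz hcz
  have hzp : z ∈ e.promises 1 := ⟨hp.1.trans hz.1.le, hz.2.le⟩
  refine ⟨hzp, minorant_le he hw hzp ⟨hlow, hb.le⟩ ⟨?_, hcz.le⟩⟩
  have h2 := logYoung_le_logYoung hz.1.le (promises_neg he.toRegular hzp)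
  have h3 : (logYoung z - logYoung w) / (e.β * e.prob 0) ≤ 0 :=
    div_nonpos_of_nonpos_of_nonneg (by linarith) (mul_pos he.β_pos (he.prob_pos 0)).le
  unfold compensate
  linarith

theorem eventually_minorant_left (he : e.TwoState) {w : ℝ} (hw : w ∈ e.binding 1)
    (hL : Real.log (1 - e.share 1) < w) (hb0 : Real.log (1 - e.share 0) < e.nextPromise 1 w 0)
    (hb : e.nextPromise 1 w 0 ≤ e.promise 0 e.criticalDebt) :
    ∀ᶠ z in 𝓝[<] w, z ∈ e.promises 1 ∧ e.minorant w z ≤ e.value 1 z := by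
  have hp := mem_promises_of_binding he.toRegular hw
  have hneg := promises_neg he.toRegular hp
  have hc := (hasDerivAt_compensate (e := e) hneg).continuousAt
  have h1 : ∀ᶠ z in 𝓝 w, Real.log (1 - e.share 0) < e.compensate w z :=
    hc.eventually_const_lt (by rwa [compensate_self])
  filter_upwards [Ioo_mem_nhdsLT hL, h1.filter_mono nhdsWithin_le_nhds] with z hz hcz
  have hzp : z ∈ e.promises 1 := ⟨hz.1.le, hz.2.le.trans hp.2⟩
  refine ⟨hzp, minorant_le he hw hzp ⟨hb0.le, hb⟩ ⟨hcz.le, ?_⟩⟩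
  have h2 := logYoung_le_logYoung hz.2.le hneg
  have h3 : 0 ≤ (logYoung z - logYoung w) / (e.β * e.prob 0) :=
    div_nonneg (by linarith) (mul_pos he.β_pos (he.prob_pos 0)).le
  unfold compensate
  linarith

theorem value_concaveOn_promises (he : e.Regular) (s : Fin 2) :
    ConcaveOn ℝ (e.promises s) (e.value s) :=
  (value_concave he s).subset (fun _ h => h.2) (convex_Icc _ _)

/-- A promise in the rich state after which the poor state neither binds at its lower bound nor
exceeds the critical debt has a unique supergradient. -/
theorem supergradient_eq_slopeValue (he : e.TwoState) {w μ : ℝ} (hw : w ∈ e.binding 1)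
    (hL : Real.log (1 - e.share 1) < w) (hU : w < e.promise 1 e.debtLimit)
    (hb0 : Real.log (1 - e.share 0) < e.nextPromise 1 w 0)
    (hb : e.nextPromise 1 w 0 < e.promise 0 e.criticalDebt)
    (hμ : IsSupergradient (e.value 1) (e.promises 1) w μ) : μ = e.slopeValue w :=
  le_antisymm
    (hμ.le_of_minorant_left (hasDerivAt_minorant he hw) (minorant_self w)
      (eventually_minorant_left he hw hL hb0 hb.le))
    (hμ.ge_of_minorant_right (hasDerivAt_minorant he hw) (minorant_self w)
      (eventually_minorant_right he hw hU hb))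

theorem slopeValue_best (he : e.TwoState) :
    e.slopeValue e.bestPromise = e.slopeOld (e.nextPromise 1 e.bestPromise 0) := by
  have := he.β_pos.ne'
  have := he.δ_pos.ne'
  rw [slopeValue, slopeOld_bestPromise he.toRegular, odds_bestPromise he.toRegular]
  field_simp
  ring

theorem isSupergradient_best (he : e.TwoState) :
    IsSupergradient (e.value 1) (e.promises 1) e.bestPromise
      (e.slopeOld (e.nextPromise 1 e.bestPromise 0)) := by
  intro z hz
  have hb := best_mem_binding he
  rw [← slopeValue_best he]
  rcases le_total z e.bestPromise with h | h
  · exact le_of_minorant_right (value_concaveOn_promises he.toRegular 1) (hasDerivAt_minorant he hb)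
      (minorant_self _) (eventually_minorant_right he hb he.best_lt he.next_lt) hz h
  · exact le_of_minorant_left (value_concaveOn_promises he.toRegular 1) (hasDerivAt_minorant he hb)
      (minorant_self _) (eventually_minorant_left he hb (log_lt_best he) (log_lt_next_best he)
        he.next_lt.le) hz h

theorem supergradient_best_eq (he : e.TwoState) {μ : ℝ}
    (hμ : IsSupergradient (e.value 1) (e.promises 1) e.bestPromise μ) :
    μ = e.slopeOld (e.nextPromise 1 e.bestPromise 0) := by
  rw [← slopeValue_best he]
  exact supergradient_eq_slopeValue he (best_mem_binding he) (log_lt_best he) he.best_lt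
    (log_lt_next_best he) he.next_lt hμ

theorem next_best_neg (he : e.TwoState) : e.nextPromise 1 e.bestPromise 0 < 0 :=
  promises_neg he.toRegular (nextPromise_mem he.toRegular (best_mem_binding he) 0)

theorem slopeOld_next_best_neg (he : e.TwoState) :
    e.slopeOld (e.nextPromise 1 e.bestPromise 0) < 0 := by
  rw [← slopeOld_bestPromise he.toRegular]
  exact slopeOld_lt ((bestPromise_le_log he).trans_lt (log_lt_next_best he)) (next_best_neg he)

/-- At a maximizer 0 is a supergradient, but the only one at the first best is negative. -/
theorem reset_lt_best (he : e.TwoState) : e.resetPromise 1 < e.bestPromise := by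
  refine (reset_le_best he).lt_of_ne fun h => ?_
  have h0 : IsSupergradient (e.value 1) (e.promises 1) e.bestPromise 0 := by
    intro z hz
    rw [zero_mul, add_zero, ← h]
    exact value_le_reset he.toRegular hz
  exact (slopeOld_next_best_neg he).ne' (supergradient_best_eq he h0)

theorem slopeOld_le_supergradient_poor (he : e.TwoState) {b μ : ℝ}
    (hb0 : Real.log (1 - e.share 0) ≤ b) (hb : b < e.promise 0 e.criticalDebt)
    (hμ : IsSupergradient (e.value 0) (e.promises 0) b μ) : e.slopeOld b ≤ μ := by
  have hbr : b ∈ e.resetting := ⟨hb0, hb.le⟩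
  have hneg := promises_neg he.toRegular (mem_promises_of_resetting he hbr)
  refine hμ.ge_of_minorant_right ((hasDerivAt_flowOld hneg).add_const
    (e.δ * ∑ r, e.prob r * e.value r (e.resetPromise r))) (value_poor he hbr).symm ?_
  filter_upwards [Ioo_mem_nhdsGT hb] with z hz
  have hzr : z ∈ e.resetting := ⟨hb0.trans hz.1.le, hz.2.le⟩
  exact ⟨mem_promises_of_resetting he hzr, (value_poor he hzr).ge⟩

theorem supergradient_poor_le_slopeOld (he : e.TwoState) {b μ : ℝ}
    (hb0 : Real.log (1 - e.share 0) < b) (hb : b ≤ e.promise 0 e.criticalDebt)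
    (hμ : IsSupergradient (e.value 0) (e.promises 0) b μ) : μ ≤ e.slopeOld b := by
  have hbr : b ∈ e.resetting := ⟨hb0.le, hb⟩
  have hneg := promises_neg he.toRegular (mem_promises_of_resetting he hbr)
  refine hμ.le_of_minorant_left ((hasDerivAt_flowOld hneg).add_const
    (e.δ * ∑ r, e.prob r * e.value r (e.resetPromise r))) (value_poor he hbr).symm ?_
  filter_upwards [Ioo_mem_nhdsLT hb0] with z hz
  have hzr : z ∈ e.resetting := ⟨hz.1.le, hz.2.le.trans hb⟩
  exact ⟨mem_promises_of_resetting he hzr, (value_poor he hzr).ge⟩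

/-! ### The policy below first-best debt -/

theorem exists_multiplier (he : e.TwoState) {w : ℝ} (hr : e.resetPromise 1 ≤ w)
    (hw : w ≤ e.bestPromise) :
    ∃ μ, ∀ r, IsSupergradient (e.value r) (e.promises r) (e.nextPromise 1 w r) μ := by
  obtain ⟨l, hl, -⟩ := exists_least_supergradient (continuation_concave he.toRegular 1)
    (logYoung_mem_interior he hw)
  exact ⟨_, isSupergradient_value he.toRegular (mem_binding_of_le he hr hw) hl⟩

theorem lt_next (he : e.TwoState) {w : ℝ} (hr : e.resetPromise 1 ≤ w) (hw : w < e.bestPromise) :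
    w < e.nextPromise 1 w 1 := by
  by_contra! h
  linarith [best_le_next he hr hw.le h]

/-- With slack, the rich promise could be lowered a little: it exceeds `w`, hence the reset promise,
so the value would strictly rise. -/
theorem participation_rich_eq (he : e.TwoState) {w : ℝ} (hr : e.resetPromise 1 ≤ w)
    (hw : w < e.bestPromise) :
    e.autarky 1 = logYoung w + e.β * (e.prob 0 * e.nextPromise 1 w 0 +
      e.prob 1 * e.nextPromise 1 w 1) := by
  have hb := mem_binding_of_le he hr hw.le
  refine (participation_rich he hb).antisymm ?_
  by_contra! h
  have hpos : 0 < e.β * e.prob 1 := mul_pos he.β_pos (he.prob_pos 1)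
  have hT := nextPromise_mem he.toRegular hb 1
  -- The second argument uses up exactly the slack; the first keeps `z` where the value is strictly
  -- decreasing.
  set z := max w (e.nextPromise 1 w 1 - (logYoung w + e.β * (e.prob 0 * e.nextPromise 1 w 0 +
      e.prob 1 * e.nextPromise 1 w 1) - e.autarky 1) / (e.β * e.prob 1)) with hz
  have hzT : z < e.nextPromise 1 w 1 := by
    refine max_lt (lt_next he hr hw) ?_
    have := div_pos (sub_pos.2 h) hpos
    linarith
  have hzp : z ∈ e.promises 1 :=
    ⟨(mem_promises_of_binding he.toRegular hb).1.trans (le_max_left _ _), hzT.le.trans hT.2⟩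
  have hzc : e.nextPromise 1 w 1 - z ≤ (logYoung w + e.β * (e.prob 0 * e.nextPromise 1 w 0 +
      e.prob 1 * e.nextPromise 1 w 1) - e.autarky 1) / (e.β * e.prob 1) := by
    linarith [le_max_right w (e.nextPromise 1 w 1 - (logYoung w + e.β * (e.prob 0 *
      e.nextPromise 1 w 0 + e.prob 1 * e.nextPromise 1 w 1) - e.autarky 1) / (e.β * e.prob 1))]
  rw [le_div_iff₀ hpos] at hzc
  have h1 := le_continuation he.toRegular (s := 1) (y := logYoung w)
    (ω := ![e.nextPromise 1 w 0, z])
    (Fin.forall_fin_two.2 ⟨nextPromise_mem he.toRegular hb 0, hzp⟩) (by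
      simp only [Fin.sum_univ_two, Matrix.cons_val_zero, Matrix.cons_val_one]
      linarith)
  rw [continuation_eq he.toRegular hb] at h1
  simp only [Fin.sum_univ_two, Matrix.cons_val_zero, Matrix.cons_val_one] at h1
  have h2 := value_strictAnti he.toRegular (hr.trans (le_max_left _ _)) hzT hT.2
  have h3 := mul_lt_mul_of_pos_left h2 (he.prob_pos 1)
  linarith

/-- If T(w) ≥ w*, the common multiplier is at most the slope at w*, which is `slopeOld` at B(w*).
But below w* the young consume more, so binding participation forces B(w) < B(w*), where the slope
is strictly larger. -/
theorem next_lt_best (he : e.TwoState) {w : ℝ} (hr : e.resetPromise 1 ≤ w)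
    (hw : w < e.bestPromise) : e.nextPromise 1 w 1 < e.bestPromise := by
  by_contra! h
  have hb := mem_binding_of_le he hr hw.le
  obtain ⟨μ, hμ⟩ := exists_multiplier he hr hw.le
  have hle : μ ≤ e.slopeOld (e.nextPromise 1 e.bestPromise 0) := by
    rcases h.eq_or_lt with h | h
    · have h1 := hμ 1
      rw [← h] at h1
      exact (supergradient_best_eq he h1).le
    · have h1 := hμ 1 _ (best_mem_promises he)
      have h2 := isSupergradient_best he _ (nextPromise_mem he.toRegular hb 1)
      by_contra! hc
      nlinarith
  have hB : e.nextPromise 1 w 0 < e.nextPromise 1 e.bestPromise 0 := by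
    have h1 := participation_rich_eq he hr hw
    have h2 := participation_rich he (best_mem_binding he)
    rw [next_best he] at h2
    have h3 := logYoung_lt_logYoung hw (bestPromise_neg he.toRegular)
    have h4 : e.β * (e.prob 0 * e.nextPromise 1 w 0 + e.prob 1 * e.nextPromise 1 w 1) <
        e.β * (e.prob 0 * e.nextPromise 1 e.bestPromise 0 + e.prob 1 * e.bestPromise) := by linarith
    have h5 := lt_of_mul_lt_mul_left h4 he.β_pos.le
    have h6 := mul_le_mul_of_nonneg_left h (he.prob_pos 1).le
    exact lt_of_mul_lt_mul_left (by linarith) (he.prob_pos 0).le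
  have h1 := slopeOld_le_supergradient_poor he (nextPromise_mem he.toRegular hb 0).1
    (hB.trans he.next_lt) (hμ 0)
  have h2 := slopeOld_lt (e := e) hB (next_best_neg he)
  linarith

/-- Since T(w) < w*, the multiplier is at least `slopeOld` at B(w*). A poor promise beyond B(w*)
would have strictly smaller supergradients, because V(0,·) is strictly concave just above B(w*). -/
theorem next_poor_le (he : e.TwoState) {w : ℝ} (hr : e.resetPromise 1 ≤ w)
    (hw : w < e.bestPromise) : e.nextPromise 1 w 0 ≤ e.nextPromise 1 e.bestPromise 0 := by
  by_contra! h
  have hb := mem_binding_of_le he hr hw.le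
  have hT := next_lt_best he hr hw
  obtain ⟨μ, hμ⟩ := exists_multiplier he hr hw.le
  have hneg := promises_neg he.toRegular (nextPromise_mem he.toRegular hb 0)
  set B := e.nextPromise 1 w 0
  set B' := e.nextPromise 1 e.bestPromise 0
  have hμ' : e.slopeOld B' ≤ μ := by
    have h1 := hμ 1 _ (best_mem_promises he)
    have h2 := isSupergradient_best he _ (nextPromise_mem he.toRegular hb 1)
    by_contra! hc
    nlinarith
  have hBr : B' ∈ e.resetting := ⟨(log_lt_next_best he).le, he.next_lt.le⟩
  -- An intermediate point below the critical promise, since B(w) may lie beyond the range of the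
  -- explicit value.
  obtain ⟨z, hz1, hz2⟩ := exists_between (lt_min h he.next_lt)
  have hzB := hz2.trans_le (min_le_left _ _)
  have hzr : z ∈ e.resetting := ⟨hBr.1.trans hz1.le, hz2.le.trans (min_le_right _ _)⟩
  have h1 := flowOld_lt (e := e) (hzB.trans hneg) (next_best_neg he) hz1.ne'
  have h2 := concave_three_point (value_concaveOn_promises he.toRegular 0)
    (mem_promises_of_resetting he hBr) (nextPromise_mem he.toRegular hb 0) hz1.le hzB.le
  rw [value_poor he hzr] at h2
  have h3 := hμ 0 _ (mem_promises_of_resetting he hBr)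
  rw [value_poor he hBr] at h2 h3
  have hzB' := sub_pos.2 hz1
  have hBB := sub_pos.2 h
  have h4 := mul_lt_mul_of_pos_left h1 hBB
  have h5 := mul_le_mul_of_nonneg_left h3 hzB'.le
  have h6 := mul_le_mul_of_nonneg_left hμ' (mul_pos hzB' hBB).le
  nlinarith

/-! ### First-order conditions when the lower bound on debt does not bind -/

theorem bestPromise_eq_log (h0 : e.share 0 = e.δ / (e.β + e.δ)) :
    e.bestPromise = Real.log (1 - e.share 0) := by rw [bestPromise, h0]

/-- Here zero debt in the poor state is the first best, where `slopeOld` vanishes. A poor promise at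
that corner would make the multiplier nonnegative, while V(1,·) has already decreased strictly by
T(w). -/
theorem log_lt_next_poor (he : e.TwoState) (h0 : e.share 0 = e.δ / (e.β + e.δ)) {w : ℝ}
    (hr : e.resetPromise 1 ≤ w) (hw : w < e.bestPromise) :
    Real.log (1 - e.share 0) < e.nextPromise 1 w 0 := by
  have hb := mem_binding_of_le he hr hw.le
  refine (nextPromise_mem he.toRegular hb 0).1.lt_of_ne fun h => ?_
  obtain ⟨μ, hμ⟩ := exists_multiplier he hr hw.le
  have h1 := slopeOld_le_supergradient_poor he h.le
    ((next_poor_le he hr hw).trans_lt he.next_lt) (hμ 0)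
  rw [← h, ← bestPromise_eq_log h0, slopeOld_bestPromise he.toRegular] at h1
  have h2 := hμ 1 _ (resetPromise_mem he.toRegular 1)
  have hT := hr.trans_lt (lt_next he hr hw)
  have h3 := value_strictAnti he.toRegular le_rfl hT (nextPromise_mem he.toRegular hb 1).2
  nlinarith [mul_nonneg h1 (sub_pos.2 hT).le]

theorem supergradient_eq_of_lt_best (he : e.TwoState) (h0 : e.share 0 = e.δ / (e.β + e.δ)) {w : ℝ}
    (hr : e.resetPromise 1 ≤ w) (hw : w < e.bestPromise) (hL : Real.log (1 - e.share 1) < w) {μ : ℝ}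
    (hμ : IsSupergradient (e.value 1) (e.promises 1) w μ) : μ = e.slopeValue w :=
  supergradient_eq_slopeValue he (mem_binding_of_le he hr hw.le) hL (hw.trans he.best_lt)
    (log_lt_next_poor he h0 hr hw) ((next_poor_le he hr hw).trans_lt he.next_lt) hμ

/-- The two derivatives agree because both equal the common multiplier. -/
theorem slopeValue_next (he : e.TwoState) (h0 : e.share 0 = e.δ / (e.β + e.δ)) {w : ℝ}
    (hr : e.resetPromise 1 ≤ w) (hw : w < e.bestPromise) :
    e.slopeValue (e.nextPromise 1 w 1) = e.slopeOld (e.nextPromise 1 w 0) := by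
  have hb := mem_binding_of_le he hr hw.le
  have hB := (next_poor_le he hr hw).trans_lt he.next_lt
  have hT := lt_next he hr hw
  obtain ⟨μ, hμ⟩ := exists_multiplier he hr hw.le
  rw [← supergradient_eq_of_lt_best he h0 (hr.trans hT.le) (next_lt_best he hr hw)
    ((mem_promises_of_binding he.toRegular hb).1.trans_lt hT) (hμ 1)]
  exact le_antisymm (supergradient_poor_le_slopeOld he (log_lt_next_poor he h0 hr hw) hB.le (hμ 0))
    (slopeOld_le_supergradient_poor he (nextPromise_mem he.toRegular hb 0).1 hB (hμ 0))

theorem slopeValue_reset (he : e.TwoState) (h0 : e.share 0 = e.δ / (e.β + e.δ)) :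
    e.slopeValue (e.resetPromise 1) = 0 := by
  have hlt := reset_lt_best he
  -- At zero debt the young would consume their endowment, and binding participation would hold the
  -- average promise at autarky, yet both promises exceed their autarky levels.
  have hL : Real.log (1 - e.share 1) < e.resetPromise 1 := by
    refine (resetPromise_mem he.toRegular 1).1.lt_of_ne fun h => ?_
    have h1 := participation_rich_eq he le_rfl hlt
    have h2 := log_lt_next_poor he h0 le_rfl hlt
    have h3 := lt_next he le_rfl hlt
    rw [← h] at h1 h2 h3
    have h4 : logYoung (Real.log (1 - e.share 1)) = Real.log (e.share 1) := by
      rw [logYoung, Real.exp_log (by linarith [he.share_lt_one 1]), sub_sub_cancel]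
    rw [h4, autarky, Fin.sum_univ_two] at h1
    have h5 := mul_left_cancel₀ he.β_pos.ne' (add_left_cancel h1)
    nlinarith [mul_lt_mul_of_pos_left h2 (he.prob_pos 0), mul_lt_mul_of_pos_left h3 (he.prob_pos 1)]
  refine (supergradient_eq_of_lt_best he h0 le_rfl hlt hL fun z hz => ?_).symm
  rw [zero_mul, add_zero]
  exact value_le_reset he.toRegular hz

theorem odds_of_slopeValue_eq (he : e.TwoState) {w b : ℝ} (h : e.slopeValue w = e.slopeOld b) :
    odds b = e.δ / e.β * odds (e.nextPromise 1 w 0) * odds w := by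
  have hβ := he.β_pos.ne'
  have hδ := he.δ_pos.ne'
  unfold slopeValue slopeOld at h
  have h1 : e.δ / e.β * (e.β / e.δ) = 1 := by field_simp
  linear_combination h - odds w * h1

/-! ### The path of promises along consecutive rich states -/

/-- The promises after `n` consecutive rich states, starting from resetting. -/
noncomputable def path (e : Economy (Fin 2)) : ℕ → Fin 2 → ℝ
  | 0, s => e.resetPromise s
  | n + 1, s => e.nextPromise 1 (path e n 1) s

theorem path_rich (he : e.TwoState) (n : ℕ) :
    e.resetPromise 1 ≤ e.path n 1 ∧ e.path n 1 < e.bestPromise := by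
  induction n with
  | zero => exact ⟨le_rfl, reset_lt_best he⟩
  | succ n ih => exact ⟨ih.1.trans (lt_next he ih.1 ih.2).le, next_lt_best he ih.1 ih.2⟩

theorem path_rich_strictMono (he : e.TwoState) : StrictMono fun n => e.path n 1 :=
  strictMono_nat_of_lt_succ fun n => lt_next he (path_rich he n).1 (path_rich he n).2

theorem path_poor_mem_resetting (he : e.TwoState) (n : ℕ) : e.path n 0 ∈ e.resetting := by
  cases n with
  | zero =>
    rw [path, resetPromise_poor he]
    exact log_mem_resetting he
  | succ n =>
    obtain ⟨h1, h2⟩ := path_rich he n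
    exact ⟨(nextPromise_mem he.toRegular (mem_binding_of_le he h1 h2.le) 0).1,
      (next_poor_le he h1 h2).trans he.next_lt.le⟩

theorem path_neg (he : e.TwoState) (n : ℕ) (s : Fin 2) : e.path n s < 0 := by
  revert s
  rw [Fin.forall_fin_two]
  exact ⟨promises_neg he.toRegular (mem_promises_of_resetting he (path_poor_mem_resetting he n)),
    (path_rich he n).2.trans (bestPromise_neg he.toRegular)⟩

theorem path_poor_le (he : e.TwoState) (n : ℕ) :
    e.path n 0 ≤ e.nextPromise 1 e.bestPromise 0 := by
  cases n with
  | zero =>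
    rw [path, resetPromise_poor he]
    exact (log_lt_next_best he).le
  | succ n => exact next_poor_le he (path_rich he n).1 (path_rich he n).2

/-- For n = 0 the slope of V(1,·) at its interior maximizer is 0, which is also `slopeOld` at zero
debt in the poor state. Later steps are the first-order condition `slopeValue_next`. -/
theorem odds_path (he : e.TwoState) (h0 : e.share 0 = e.δ / (e.β + e.δ)) (n : ℕ) :
    odds (e.path n 0) = e.δ / e.β * odds (e.path (n + 1) 0) * odds (e.path n 1) := by
  refine odds_of_slopeValue_eq he ?_
  cases n with
  | zero =>
    rw [path, path, resetPromise_poor he, slopeValue_reset he h0, ← bestPromise_eq_log h0,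
      slopeOld_bestPromise he.toRegular]
  | succ n => exact slopeValue_next he h0 (path_rich he n).1 (path_rich he n).2

/-- In the recursion the factor (δ/β) · odds(w n) is below 1, as w n is below the first best. -/
theorem path_poor_strictMono (he : e.TwoState) (h0 : e.share 0 = e.δ / (e.β + e.δ)) :
    StrictMono fun n => e.path n 0 := by
  refine strictMono_nat_of_lt_succ fun n => ?_
  by_contra! h
  have h1 := odds_le_odds h (path_neg he n 0)
  have h2 := odds_path he h0 n
  have h3 := odds_lt_odds (path_rich he n).2 (bestPromise_neg he.toRegular)
  rw [odds_bestPromise he.toRegular] at h3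
  have h4 := odds_pos (path_neg he (n + 1) 0)
  have h5 : e.δ / e.β * odds (e.path n 1) < 1 := by
    have hβ := he.β_pos
    have hδ := he.δ_pos
    have := mul_lt_mul_of_pos_left h3 (div_pos hδ hβ)
    rwa [show e.δ / e.β * (e.β / e.δ) = 1 by field_simp] at this
  nlinarith

theorem path_participation (he : e.TwoState) (n : ℕ) :
    e.autarky 1 = logYoung (e.path n 1) + e.β * (e.prob 0 * e.path (n + 1) 0 +
      e.prob 1 * e.path (n + 1) 1) :=
  participation_rich_eq he (path_rich he n).1 (path_rich he n).2

/-- The limit of the promises to the poor state. -/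
noncomputable def limitPromise (e : Economy (Fin 2)) : ℝ :=
  ((e.autarky 1 - Real.log (e.δ / (e.β + e.δ))) / e.β - e.prob 1 * e.bestPromise) / e.prob 0

/-- Both paths are monotone and bounded. The limit of the odds recursion forces the rich limit to be
the first best; the limit of binding participation then determines the poor one. -/
theorem tendsto_path (he : e.TwoState) (h0 : e.share 0 = e.δ / (e.β + e.δ)) :
    Tendsto (fun n => e.path n 0) atTop (𝓝 e.limitPromise) ∧ e.limitPromise < 0 ∧
      Tendsto (fun n => e.path n 1) atTop (𝓝 e.bestPromise) := by
  have hβ := he.β_pos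
  have hδ := he.δ_pos
  have hp := he.prob_pos 0
  have hbneg := bestPromise_neg he.toRegular
  obtain ⟨b, hb⟩ : ∃ b, Tendsto (fun n => e.path n 0) atTop (𝓝 b) :=
    ⟨_, tendsto_atTop_ciSup (path_poor_strictMono he h0).monotone
      ⟨_, forall_mem_range.2 (path_poor_le he)⟩⟩
  obtain ⟨w, hw⟩ : ∃ w, Tendsto (fun n => e.path n 1) atTop (𝓝 w) :=
    ⟨_, tendsto_atTop_ciSup (path_rich_strictMono he).monotone
      ⟨_, forall_mem_range.2 fun n => (path_rich he n).2.le⟩⟩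
  have hbneg' : b < 0 := (le_of_tendsto' hb (path_poor_le he)).trans_lt (next_best_neg he)
  have hwle : w ≤ e.bestPromise := le_of_tendsto' hw fun n => (path_rich he n).2.le
  have hcont : ∀ x < 0, ContinuousAt odds x := fun x hx =>
    Real.continuous_exp.continuousAt.div (continuousAt_const.sub Real.continuous_exp.continuousAt)
      (one_sub_exp_pos hx).ne'
  have h1 : odds b = e.δ / e.β * odds b * odds w := by
    refine tendsto_nhds_unique ((hcont b hbneg').tendsto.comp hb) ?_
    have h2 := (((hcont b hbneg').tendsto.comp ((tendsto_add_atTop_iff_nat 1).2 hb)).const_mul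
      (e.δ / e.β)).mul ((hcont w (hwle.trans_lt hbneg)).tendsto.comp hw)
    exact h2.congr fun n => (odds_path he h0 n).symm
  have h2 : odds w = e.β / e.δ := by
    have := (odds_pos hbneg').ne'
    field_simp at h1 ⊢
    linarith
  have hwe : w = e.bestPromise := by
    refine hwle.antisymm ?_
    by_contra! h
    have := odds_lt_odds h hbneg
    rw [odds_bestPromise he.toRegular, h2] at this
    exact lt_irrefl _ this
  subst hwe
  have h3 : e.autarky 1 = logYoung e.bestPromise + e.β * (e.prob 0 * b +
      e.prob 1 * e.bestPromise) := by
    refine tendsto_nhds_unique (tendsto_const_nhds (x := e.autarky 1) (f := (atTop : Filter ℕ))) ?_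
    have h4 := ((hasDerivAt_logYoung hbneg).continuousAt.tendsto.comp hw).add
      (((((tendsto_add_atTop_iff_nat 1).2 hb).const_mul (e.prob 0)).add
        (((tendsto_add_atTop_iff_nat 1).2 hw).const_mul (e.prob 1))).const_mul e.β)
    exact h4.congr fun n => (path_participation he n).symm
  rw [logYoung_bestPromise he.toRegular] at h3
  have hbl : b = e.limitPromise := by
    rw [limitPromise, h3]
    field_simp
    ring
  exact ⟨hbl ▸ hb, hbl ▸ hbneg', hw⟩

end Economy

namespace Economy

variable {e : Economy (Fin 2)}

/-! ### The debt path -/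

theorem debtAfter_eq (he : e.Regular) (n : ℕ) (s : Fin 2) :
    debtAfter e n s = e.debt s (e.path n s) := by
  induction n generalizing s with
  | zero => rfl
  | succ n ih => rw [debtAfter, nextDebt, ih, he.promise_debt]; rfl

theorem promise_debtAfter (he : e.Regular) (n : ℕ) (s : Fin 2) :
    e.promise s (debtAfter e n s) = e.path n s := by
  rw [debtAfter_eq he, he.promise_debt]

/-- Every poor promise on the path is in the resetting range, so state 1 erases the history. -/
theorem nextDebt_poor (he : e.TwoState) (n : ℕ) (r : Fin 2) :
    e.nextDebt (0, debtAfter e n 0) r = debtAfter e 0 r := by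
  have h := nextPromise_poor he (path_poor_mem_resetting he n) r
  rw [nextDebt, promise_debtAfter he.toRegular, debtAfter, resetDebt, ← h]
  rfl

theorem nextDebt_rich (n : ℕ) (r : Fin 2) :
    e.nextDebt (1, debtAfter e n 1) r = debtAfter e (n + 1) r := rfl

theorem debtAfter_rich_injective (he : e.TwoState) : Function.Injective fun n => debtAfter e n 1 := by
  simp only [debtAfter_eq he.toRegular]
  exact StrictMono.injective fun m n h => he.debt_lt_debt 1 (path_rich_strictMono he h)

theorem debtAfter_injective (he : e.TwoState) (h0 : e.share 0 = e.δ / (e.β + e.δ)) (s : Fin 2) :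
    Function.Injective fun n => debtAfter e n s := by
  revert s
  refine Fin.forall_fin_two.2 ⟨?_, debtAfter_rich_injective he⟩
  simp only [debtAfter_eq he.toRegular]
  exact StrictMono.injective fun m n h => he.debt_lt_debt 0 (path_poor_strictMono he h0 h)

/-! ### Reachable states -/

/-- The state after `q.1` consecutive rich states if the current endowment state is `q.2`. -/
noncomputable def stateAfter (e : Economy (Fin 2)) (q : ℕ × Fin 2) : State (Fin 2) :=
  (q.2, debtAfter e q.1 q.2)

/-- The number of consecutive rich states next period. -/
def nextCount : ℕ × Fin 2 → ℕ
  | (_, 0) => 0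
  | (n, 1) => n + 1

theorem nextDebt_stateAfter (he : e.TwoState) (q : ℕ × Fin 2) (r : Fin 2) :
    e.nextDebt (e.stateAfter q) r = debtAfter e (nextCount q) r := by
  obtain ⟨n, s⟩ := q
  revert s
  exact Fin.forall_fin_two.2 ⟨nextDebt_poor he n r, nextDebt_rich n r⟩

theorem transition_eq (x x' : State (Fin 2)) :
    e.transition x x' = if e.nextDebt x x'.1 = x'.2 then e.prob x'.1 else 0 := by
  obtain ⟨r, d⟩ := x'
  rw [transition, Finset.sum_eq_single r]
  · simp
  · intro j _ hj
    simp [hj]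
  · simp

theorem transition_pos_iff (he : e.Regular) (x x' : State (Fin 2)) :
    0 < e.transition x x' ↔ x' = (x'.1, e.nextDebt x x'.1) := by
  rw [transition_eq]
  split_ifs with h
  · simp [h, he.prob_pos]
  · simp only [lt_irrefl, false_iff]
    exact fun h' => h (congrArg Prod.snd h').symm

theorem transition_stateAfter_pos (he : e.TwoState) (q : ℕ × Fin 2) (r : Fin 2) :
    0 < e.transition (e.stateAfter q) (e.stateAfter (nextCount q, r)) := by
  rw [transition_pos_iff he.toRegular, nextDebt_stateAfter he]
  rfl

theorem eq_of_transition_pos (he : e.TwoState) {q : ℕ × Fin 2} {x : State (Fin 2)}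
    (h : 0 < e.transition (e.stateAfter q) x) : x = e.stateAfter (nextCount q, x.1) := by
  rw [transition_pos_iff he.toRegular, nextDebt_stateAfter he] at h
  exact h

/-- One poor state resets the count; n rich states and then `s` lead to the target. -/
theorem reaches (he : e.TwoState) (q : ℕ × Fin 2) (n : ℕ) (s : Fin 2) :
    Relation.TransGen (fun y y' => 0 < e.transition y y') (e.stateAfter q)
      (e.stateAfter (n, s)) := by
  have hpoor : Relation.TransGen (fun y y' => 0 < e.transition y y') (e.stateAfter q)
      (e.stateAfter (nextCount q, 0)) := .single (transition_stateAfter_pos he q 0)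
  induction n generalizing s with
  | zero => exact hpoor.tail (transition_stateAfter_pos he (nextCount q, 0) s)
  | succ n ih => exact (ih 1).tail (transition_stateAfter_pos he (n, 1) s)

theorem ergodicSet_eq (he : e.TwoState) (i : Fin 2) :
    e.ergodicSet i = range e.stateAfter := by
  ext x
  constructor
  · intro h
    have h' : Relation.TransGen (fun y y' => 0 < e.transition y y') (e.stateAfter (0, i)) x := h
    clear h
    induction h' with
    | single h => exact ⟨_, (eq_of_transition_pos he h).symm⟩
    | tail h1 h2 ih =>
      obtain ⟨q, rfl⟩ := ih
      exact ⟨_, (eq_of_transition_pos he h2).symm⟩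
  · rintro ⟨⟨n, s⟩, rfl⟩
    exact reaches he (0, i) n s

theorem ergodic_range (he : e.TwoState) : e.Ergodic (range e.stateAfter) := by
  refine ⟨⟨range_nonempty _, ?_⟩, fun E' hE hE' => hE.antisymm ?_⟩
  · rintro _ ⟨q, rfl⟩ x hx
    exact ⟨_, (eq_of_transition_pos he hx).symm⟩
  · rintro _ ⟨⟨n, s⟩, rfl⟩
    obtain ⟨y, hy⟩ := hE'.1
    obtain ⟨q, rfl⟩ := hE hy
    have h := reaches he q n s
    generalize e.stateAfter (n, s) = z at h
    induction h with
    | single h => exact hE'.2 _ hy _ h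
    | tail _ h2 ih => exact hE'.2 _ ih _ h2

/-! ### The invariant distribution -/

theorem prob_one (he : e.Regular) : e.prob 1 = 1 - e.prob 0 := by
  have := he.prob_sum
  rw [Fin.sum_univ_two] at this
  linarith

/-- Probability that the endowment state is `q.2` after exactly `q.1` consecutive rich states. -/
noncomputable def weight (e : Economy (Fin 2)) (q : ℕ × Fin 2) : ℝ :=
  e.prob q.2 * e.prob 0 * e.prob 1 ^ q.1

open scoped Classical in
/-- The image of the geometric distribution. -/
noncomputable def invariant (e : Economy (Fin 2)) (x : State (Fin 2)) : ℝ :=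
  ∑' n : ℕ, if debtAfter e n x.1 = x.2 then e.weight (n, x.1) else 0

theorem weight_pos (he : e.Regular) (q : ℕ × Fin 2) : 0 < e.weight q :=
  mul_pos (mul_pos (he.prob_pos _) (he.prob_pos _)) (pow_pos (he.prob_pos _) _)

theorem hasSum_geometric (he : e.Regular) : HasSum (fun n : ℕ => e.prob 1 ^ n) (e.prob 0)⁻¹ := by
  have h := hasSum_geometric_of_lt_one (he.prob_pos 1).le (r := e.prob 1)
    (by linarith [prob_one he, he.prob_pos 0])
  rwa [prob_one he, sub_sub_cancel, ← prob_one he] at h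

theorem hasSum_weight (he : e.Regular) (s : Fin 2) :
    HasSum (fun n => e.weight (n, s)) (e.prob s) := by
  have h := (hasSum_geometric he).mul_left (e.prob s * e.prob 0)
  rwa [mul_assoc, mul_inv_cancel₀ (he.prob_pos 0).ne', mul_one] at h

open scoped Classical in
theorem hasSum_invariant (he : e.Regular) (x : State (Fin 2)) :
    HasSum (fun n : ℕ => if debtAfter e n x.1 = x.2 then e.weight (n, x.1) else 0)
      (e.invariant x) := by
  refine Summable.hasSum (Summable.of_nonneg_of_le (fun n => ?_) (fun n => ?_)
    (hasSum_weight he x.1).summable)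
  · split_ifs
    exacts [(weight_pos he _).le, le_rfl]
  · split_ifs
    exacts [le_rfl, (weight_pos he _).le]

theorem hasSum_invariant_subtype (he : e.Regular) (x : State (Fin 2)) :
    HasSum (fun n : {n : ℕ // debtAfter e n x.1 = x.2} => e.weight (n, x.1)) (e.invariant x) := by
  classical
  refine (hasSum_subtype_iff_indicator (f := fun n => e.weight (n, x.1))
    (s := {n | debtAfter e n x.1 = x.2})).2 ?_
  refine (hasSum_invariant he x).congr_fun fun n => ?_
  simp [indicator_apply]

/-- The indices of a state. -/
def fiberEquiv (x : State (Fin 2)) :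
    {q : ℕ × Fin 2 // e.stateAfter q = x} ≃ {n : ℕ // debtAfter e n x.1 = x.2} where
  toFun q := ⟨q.1.1, by obtain ⟨q, rfl⟩ := q; rfl⟩
  invFun n := ⟨(n.1, x.1), by rw [stateAfter, n.2]⟩
  left_inv q := by obtain ⟨q, rfl⟩ := q; rfl
  right_inv n := rfl

/-- Summation against the invariant distribution is summation over its indices. -/
theorem hasSum_invariant_mul (he : e.Regular) {F : State (Fin 2) → ℝ} {a : ℝ}
    (h : HasSum (fun q => e.weight q * F (e.stateAfter q)) a) :
    HasSum (fun x : range e.stateAfter => e.invariant x * F x) a := by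
  have h1 := (Equiv.sigmaFiberEquiv (rangeFactorization e.stateAfter)).hasSum_iff.2 h
  refine h1.sigma fun x => ?_
  have h2 := ((fiberEquiv x.1).hasSum_iff.2 (hasSum_invariant_subtype he x.1)).mul_right (F x.1)
  let E : {q // rangeFactorization e.stateAfter q = x} ≃ {q : ℕ × Fin 2 // e.stateAfter q = x.1} :=
    Equiv.subtypeEquivRight fun q => Subtype.ext_iff
  refine (E.hasSum_iff.2 h2).congr_fun ?_
  rintro ⟨q, rfl⟩
  rfl

theorem hasSum_prod_fin_two {f : ℕ × Fin 2 → ℝ} {a b : ℝ} (h0 : HasSum (fun n => f (n, 0)) a)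
    (h1 : HasSum (fun n => f (n, 1)) b) : HasSum f (a + b) := by
  have key : ∀ (s : Fin 2) {c : ℝ}, HasSum (fun n => f (n, s)) c →
      HasSum (fun q : ℕ × Fin 2 => if q.2 = s then f q else 0) c := by
    intro s c h
    have hinj : Function.Injective fun n : ℕ => (n, s) := fun m n h => congrArg Prod.fst h
    refine (hinj.hasSum_iff ?_).1 (by simpa [Function.comp_def] using h)
    rintro ⟨n, r⟩ hr
    have : r ≠ s := fun h => hr ⟨n, by rw [h]⟩
    simp [this]
  refine ((key 0 h0).add (key 1 h1)).congr_fun ?_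
  rintro ⟨n, s⟩
  revert s
  exact Fin.forall_fin_two.2 ⟨by simp, by simp⟩

theorem isInvariant_invariant (he : e.TwoState) :
    e.IsInvariant (range e.stateAfter) e.invariant := by
  classical
  have hR := he.toRegular
  have hp := (hR.prob_pos 0).ne'
  refine ⟨fun x => ?_, fun x hx => ?_, ?_, ?_⟩
  · refine (hasSum_invariant hR x).nonneg fun n => ?_
    split_ifs
    exacts [(weight_pos hR _).le, le_rfl]
  · refine (hasSum_invariant hR x).unique ?_
    convert (hasSum_zero : HasSum (fun _ : ℕ => (0 : ℝ)) 0) using 2 with n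
    rw [if_neg]
    exact fun h => hx ⟨(n, x.1), by rw [stateAfter, h]⟩
  · have h := hasSum_prod_fin_two (f := e.weight) (hasSum_weight hR 0) (hasSum_weight hR 1)
    rw [prob_one hR, add_sub_cancel] at h
    simpa using hasSum_invariant_mul hR (F := fun _ => 1) (by simpa using h)
  · rintro ⟨r, d⟩ -
    refine hasSum_invariant_mul hR (F := fun x => e.transition x (r, d)) ?_
    have h := hasSum_invariant hR (r, d)
    have h1 := (hasSum_nat_add_iff 1).2 (by
      rw [Finset.sum_range_one, sub_add_cancel]; exact h :
      HasSum _ (e.invariant (r, d) - _ + ∑ i ∈ Finset.range 1, _))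
    set c := if debtAfter e 0 r = d then e.weight (0, r) else 0 with hc
    have hzero : HasSum (fun n => e.weight (n, 0) * e.transition (e.stateAfter (n, 0)) (r, d)) c := by
      have h2 := (hasSum_weight hR 0).mul_right (if debtAfter e 0 r = d then e.prob r else 0)
      have h3 : e.prob 0 * (if debtAfter e 0 r = d then e.prob r else 0) = c := by
        rw [hc, weight, pow_zero, mul_one]
        split_ifs
        · exact mul_comm _ _
        · exact mul_zero _
      rw [h3] at h2
      refine h2.congr_fun fun n => ?_
      rw [transition_eq, nextDebt_stateAfter he]
      rfl
    have hone : HasSum (fun n => e.weight (n, 1) * e.transition (e.stateAfter (n, 1)) (r, d))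
        (e.invariant (r, d) - c) := by
      refine h1.congr_fun fun n => ?_
      rw [transition_eq, nextDebt_stateAfter he]
      change e.weight (n, 1) * (if debtAfter e (n + 1) r = d then e.prob r else 0) =
        if debtAfter e (n + 1) r = d then e.weight (n + 1, r) else 0
      split_ifs
      · simp only [weight]; ring
      · exact mul_zero _
    have h4 := hasSum_prod_fin_two (f := fun q => e.weight q * e.transition (e.stateAfter q) (r, d))
      hzero hone
    rwa [add_sub_cancel] at h4

theorem debtAfter_rich_ne (he : e.TwoState) {m n : ℕ} (h : m ≠ n) :
    debtAfter e m 1 ≠ debtAfter e n 1 := fun h' => h (debtAfter_rich_injective he h')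

theorem invariant_unique (he : e.TwoState) {φ : State (Fin 2) → ℝ}
    (hφ : e.IsInvariant (range e.stateAfter) φ) : φ = e.invariant := by
  classical
  have hR := he.toRegular
  have hp := hR.prob_pos 0
  have hq := hR.prob_pos 1
  have hφ' := isInvariant_invariant he
  set g := fun x => φ x - e.invariant x with hg
  have hg1 : HasSum (fun x : range e.stateAfter => g x) 0 := by
    simpa using hφ.2.2.1.sub hφ'.2.2.1
  have hg2 : ∀ q, HasSum (fun x : range e.stateAfter => g x * e.transition x (e.stateAfter q))
      (g (e.stateAfter q)) := by
    intro q
    refine ((hφ.2.2.2 _ ⟨q, rfl⟩).sub (hφ'.2.2.2 _ ⟨q, rfl⟩)).congr_fun fun x => ?_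
    rw [hg]
    ring
  -- rich states after one more rich state
  have hsucc : ∀ n, g (e.stateAfter (n + 1, 1)) = e.prob 1 * g (e.stateAfter (n, 1)) := by
    intro n
    refine (hg2 (n + 1, 1)).unique ?_
    have h1 := hasSum_single (f := fun x : range e.stateAfter =>
      g x * e.transition x (e.stateAfter (n + 1, 1))) ⟨e.stateAfter (n, 1), (n, 1), rfl⟩ (by
        rintro ⟨_, ⟨⟨m, s⟩, rfl⟩⟩ hne
        rw [transition_eq, nextDebt_stateAfter he, if_neg, mul_zero]
        revert hne
        revert s
        refine Fin.forall_fin_two.2 ⟨fun _ => debtAfter_rich_ne he (by simp [nextCount]),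
          fun hne => debtAfter_rich_ne he fun h => hne ?_⟩
        have : m = n := by simpa [nextCount] using h
        exact Subtype.ext (by rw [this]))
    have h2 : e.transition (e.stateAfter (n, 1)) (e.stateAfter (n + 1, 1)) = e.prob 1 := by
      rw [transition_eq, nextDebt_stateAfter he]
      exact if_pos rfl
    rwa [h2, mul_comm] at h1
  have hpow : ∀ n, g (e.stateAfter (n, 1)) = g (e.stateAfter (0, 1)) * e.prob 1 ^ n := by
    intro n
    induction n with
    | zero => simp
    | succ n ih => rw [hsucc, ih]; ring
  -- the mass of the poor state
  have htrans : ∀ (x : range e.stateAfter), e.transition x (e.stateAfter (0, 1)) =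
      if x.1.1 = 0 then e.prob 1 else 0 := by
    rintro ⟨_, ⟨⟨m, s⟩, rfl⟩⟩
    rw [transition_eq, nextDebt_stateAfter he]
    revert s
    refine Fin.forall_fin_two.2 ⟨by simp [nextCount, stateAfter], ?_⟩
    have h1 : debtAfter e (m + 1) 1 ≠ debtAfter e 0 1 := debtAfter_rich_ne he (by simp)
    simp [nextCount, stateAfter, h1]
  set A := g (e.stateAfter (0, 1)) / e.prob 1 with hA
  have hpoor : HasSum (fun x : range e.stateAfter => if x.1.1 = 0 then g x else 0) A := by
    refine ((hg2 (0, 1)).div_const (e.prob 1)).congr_fun fun x => ?_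
    rw [htrans]
    split_ifs
    · field_simp
    · simp
  have hrich : HasSum (fun x : range e.stateAfter => if x.1.1 = 0 then 0 else g x) (0 - A) := by
    refine (hg1.sub hpoor).congr_fun fun x => ?_
    split_ifs <;> simp
  have hrich' : HasSum (fun n => g (e.stateAfter (n, 1))) (0 - A) := by
    have hinj : Function.Injective fun n : ℕ =>
        (⟨e.stateAfter (n, 1), (n, 1), rfl⟩ : range e.stateAfter) := fun m n h =>
      debtAfter_rich_injective he (congrArg (fun x : range e.stateAfter => x.1.2) h)
    refine ((hinj.hasSum_iff ?_).2 hrich).congr_fun fun n => ?_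
    · rintro ⟨_, ⟨⟨m, s⟩, rfl⟩⟩ hx
      refine if_pos ?_
      change s = 0
      by_contra hs
      have : s = 1 := by omega
      exact hx ⟨m, by rw [this]⟩
    · change g (e.stateAfter (n, 1)) = if (1 : Fin 2) = 0 then 0 else g (e.stateAfter (n, 1))
      simp
  have hgeo : HasSum (fun n => g (e.stateAfter (n, 1))) (g (e.stateAfter (0, 1)) * (e.prob 0)⁻¹) :=
    ((hasSum_geometric hR).mul_left _).congr_fun hpow
  have hA0 : A = 0 := by
    have h1 := hrich'.unique hgeo
    have h2 : g (e.stateAfter (0, 1)) = A * e.prob 1 := by rw [hA]; field_simp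
    rw [h2] at h1
    have h3 : A * (1 + e.prob 1 * (e.prob 0)⁻¹) = 0 := by linarith
    rcases mul_eq_zero.1 h3 with h | h
    · exact h
    · have : 0 < 1 + e.prob 1 * (e.prob 0)⁻¹ := by positivity
      linarith
  have hzero1 : ∀ n, g (e.stateAfter (n, 1)) = 0 := by
    intro n
    have h2 : g (e.stateAfter (0, 1)) = A * e.prob 1 := by rw [hA]; field_simp
    rw [hpow, h2, hA0]
    ring
  have hzero0 : ∀ n, g (e.stateAfter (n, 0)) = 0 := by
    intro n
    refine (hg2 (n, 0)).unique ?_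
    have h1 := hpoor.mul_right (if debtAfter e 0 0 = debtAfter e n 0 then e.prob 0 else 0)
    rw [hA0, zero_mul] at h1
    refine h1.congr_fun ?_
    rintro ⟨_, ⟨⟨m, s⟩, rfl⟩⟩
    rw [transition_eq, nextDebt_stateAfter he]
    revert s
    refine Fin.forall_fin_two.2 ⟨rfl, ?_⟩
    have h2 := hzero1 m
    simp only [h2]
    simp [stateAfter]
  ext x
  by_cases hx : x ∈ range e.stateAfter
  · obtain ⟨⟨n, s⟩, rfl⟩ := hx
    refine sub_eq_zero.1 ?_
    revert s
    exact Fin.forall_fin_two.2 ⟨hzero0 n, hzero1 n⟩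
  · rw [hφ.2.1 x hx, hφ'.2.1 x hx]

theorem invariant_of_injective (he : e.Regular) {s : Fin 2}
    (h : Function.Injective fun n => debtAfter e n s) (n : ℕ) :
    e.invariant (s, debtAfter e n s) = e.weight (n, s) := by
  classical
  refine (hasSum_invariant he _).unique ?_
  have h1 := hasSum_single (f := fun m : ℕ =>
    if debtAfter e m s = debtAfter e n s then e.weight (m, s) else 0) n
    fun m hm => if_neg fun h' => hm (h h')
  simpa using h1

end Economy

namespace Economy

variable {e : Economy (Fin 2)}

/-! ### The Perron eigenvector -/

theorem hasSum_statePrice (he : e.TwoState) (q : ℕ × Fin 2) (F : State (Fin 2) → ℝ) :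
    HasSum (fun x : range e.stateAfter => e.statePrice (e.stateAfter q) x * F x)
      (∑ r, e.prob r * (e.β * e.consumption (e.stateAfter q) /
        (1 - e.consumption (e.stateAfter (nextCount q, r))) * F (e.stateAfter (nextCount q, r)))) := by
  classical
  have h : ∀ r, HasSum (fun x : range e.stateAfter => if x.1 = e.stateAfter (nextCount q, r) then
      e.prob r * (e.β * e.consumption (e.stateAfter q) / (1 - e.consumption x.1) * F x.1) else 0)
      (e.prob r * (e.β * e.consumption (e.stateAfter q) /
        (1 - e.consumption (e.stateAfter (nextCount q, r))) *
          F (e.stateAfter (nextCount q, r)))) := by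
    intro r
    have h1 := hasSum_single (f := fun x : range e.stateAfter =>
      if x.1 = e.stateAfter (nextCount q, r) then
      e.prob r * (e.β * e.consumption (e.stateAfter q) / (1 - e.consumption x.1) * F x.1) else 0)
      ⟨e.stateAfter (nextCount q, r), _, rfl⟩ fun x hx => if_neg fun h => hx (Subtype.ext h)
    simpa using h1
  refine (hasSum_sum fun r _ => h r).congr_fun fun x => ?_
  rw [statePrice, transition, Finset.sum_mul, Finset.sum_mul]
  refine Finset.sum_congr rfl fun r _ => ?_
  rw [nextDebt_stateAfter he]
  by_cases hx : x.1 = e.stateAfter (nextCount q, r)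
  · have hx' : (r, debtAfter e (nextCount q) r) = x.1 := hx.symm
    rw [if_pos hx, if_pos hx']
    ring
  · have hx' : ¬ (r, debtAfter e (nextCount q) r) = x.1 := fun h => hx h.symm
    rw [if_neg hx, if_neg hx', zero_mul, zero_mul]

theorem path_ge (he : e.TwoState) (n : ℕ) (s : Fin 2) :
    Real.log (1 - e.share s) ≤ e.path n s := by
  revert s
  exact Fin.forall_fin_two.2 ⟨(path_poor_mem_resetting he n).1,
    (resetPromise_mem he.toRegular 1).1.trans (path_rich he n).1⟩

theorem consumption_stateAfter (he : e.TwoState) (q : ℕ × Fin 2) :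
    e.consumption (e.stateAfter q) = 1 - Real.exp (e.path q.1 q.2) := by
  have h0 : 0 ≤ debtAfter e q.1 q.2 := by
    rw [debtAfter_eq he.toRegular, ← he.debt_log]
    exact he.debt_le_debt _ (path_ge he _ _)
  rw [← promise_debtAfter he.toRegular, exp_promise he.toRegular _ h0]
  rfl

/-- The Perron eigenvector. -/
noncomputable def perron (e : Economy (Fin 2)) (x : State (Fin 2)) : ℝ :=
  e.β / e.δ * e.consumption x / odds (e.promise 0 (e.nextDebt x 0))

theorem perron_stateAfter (he : e.TwoState) (q : ℕ × Fin 2) : e.perron (e.stateAfter q) =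
    e.β / e.δ * (1 - Real.exp (e.path q.1 q.2)) / odds (e.path (nextCount q) 0) := by
  rw [perron, consumption_stateAfter he, nextDebt_stateAfter he, promise_debtAfter he.toRegular]

theorem odds_path_zero (he : e.TwoState) (h0 : e.share 0 = e.δ / (e.β + e.δ)) :
    odds (e.path 0 0) = e.β / e.δ := by
  rw [path, resetPromise_poor he, ← bestPromise_eq_log h0, odds_bestPromise he.toRegular]

theorem perron_stateAfter' (he : e.TwoState) (h0 : e.share 0 = e.δ / (e.β + e.δ)) (q : ℕ × Fin 2) :
    e.perron (e.stateAfter q) = Real.exp (e.path q.1 q.2) / odds (e.path q.1 0) := by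
  have hβ := he.β_pos.ne'
  have hδ := he.δ_pos.ne'
  obtain ⟨n, s⟩ := q
  rw [perron_stateAfter he]
  have h1 := (one_sub_exp_pos (path_neg he n s)).ne'
  have h2 := (Real.exp_pos (e.path n s)).ne'
  revert s
  refine Fin.forall_fin_two.2 ⟨fun h1 h2 => ?_, fun h1 h2 => ?_⟩
  · simp only [nextCount, odds_path_zero he h0]
    rw [odds]
    field_simp
  · have h3 := (odds_pos (path_neg he (n + 1) 0)).ne'
    simp only [nextCount, odds_path he h0 n]
    rw [show odds (e.path n 1) = Real.exp (e.path n 1) / (1 - Real.exp (e.path n 1)) from rfl]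
    field_simp

theorem perron_pos (he : e.TwoState) (q : ℕ × Fin 2) : 0 < e.perron (e.stateAfter q) := by
  rw [perron_stateAfter he]
  exact div_pos (mul_pos (div_pos he.β_pos he.δ_pos) (one_sub_exp_pos (path_neg he _ _)))
    (odds_pos (path_neg he _ _))

/-- The eigenvector equation for a multiple of the Perron eigenvector. -/
theorem hasSum_statePrice_mul_perron (he : e.TwoState) (h0 : e.share 0 = e.δ / (e.β + e.δ))
    (q : ℕ × Fin 2) (h : State (Fin 2) → ℝ) :
    HasSum (fun x : range e.stateAfter => e.statePrice (e.stateAfter q) x * (h x * e.perron x))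
      (e.δ * e.perron (e.stateAfter q) * ∑ r, e.prob r * h (e.stateAfter (nextCount q, r))) := by
  have h1 := hasSum_statePrice he q fun x => h x * e.perron x
  have hδ := he.δ_pos.ne'
  convert h1 using 1
  rw [Finset.mul_sum]
  refine Finset.sum_congr rfl fun r _ => ?_
  have h2 := (Real.exp_pos (e.path (nextCount q) r)).ne'
  have h3 := (odds_pos (path_neg he (nextCount q) 0)).ne'
  rw [perron_stateAfter he q, perron_stateAfter' he h0 (nextCount q, r), consumption_stateAfter he,
    consumption_stateAfter he, sub_sub_cancel]
  field_simp

theorem perron_le (he : e.TwoState) (h0 : e.share 0 = e.δ / (e.β + e.δ)) (q : ℕ × Fin 2) :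
    e.perron (e.stateAfter q) ≤ e.δ / (e.β + e.δ) := by
  have hβ := he.β_pos
  have hδ := he.δ_pos
  obtain ⟨n, s⟩ := q
  revert s
  refine Fin.forall_fin_two.2 ⟨?_, ?_⟩
  · rw [perron_stateAfter he]
    simp only [nextCount, odds_path_zero he h0]
    rw [mul_div_cancel_left₀ _ (div_pos hβ hδ).ne']
    have h1 := Real.exp_le_exp.2 (path_poor_mem_resetting he n).1
    rw [← bestPromise_eq_log h0, exp_bestPromise he.toRegular] at h1
    linarith
  · rw [perron_stateAfter' he h0]
    have h1 := (Real.exp_lt_exp.2 (path_rich he n).2).le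
    have h2 := odds_le_odds ((path_poor_strictMono he h0).monotone (Nat.zero_le n)) (path_neg he n 0)
    rw [odds_path_zero he h0] at h2
    rw [exp_bestPromise he.toRegular] at h1
    have h3 : 1 - e.δ / (e.β + e.δ) = e.δ / (e.β + e.δ) * (e.β / e.δ) := by field_simp; ring
    rw [div_le_iff₀ (odds_pos (path_neg he n 0))]
    calc _ ≤ _ := h1
      _ = _ := h3
      _ ≤ _ := mul_le_mul_of_nonneg_left h2 (by positivity)

theorem perron_zero (he : e.TwoState) (h0 : e.share 0 = e.δ / (e.β + e.δ)) :
    e.perron (e.stateAfter (0, 0)) = e.δ / (e.β + e.δ) := by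
  have hβ := he.β_pos
  have hδ := he.δ_pos
  rw [perron_stateAfter he]
  simp only [nextCount, odds_path_zero he h0]
  rw [mul_div_cancel_left₀ _ (div_pos hβ hδ).ne', path, resetPromise_poor he,
    ← bestPromise_eq_log h0, exp_bestPromise he.toRegular, sub_sub_cancel]

/-- The infimum of the Perron eigenvector. -/
noncomputable def perronInf (e : Economy (Fin 2)) : ℝ :=
  e.β / e.δ * (e.δ / (e.β + e.δ)) / odds e.limitPromise

theorem path_poor_le_limit (he : e.TwoState) (h0 : e.share 0 = e.δ / (e.β + e.δ)) (n : ℕ) :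
    e.path n 0 ≤ e.limitPromise :=
  (path_poor_strictMono he h0).monotone.ge_of_tendsto (tendsto_path he h0).1 n

theorem perronInf_pos (he : e.TwoState) (h0 : e.share 0 = e.δ / (e.β + e.δ)) : 0 < e.perronInf := by
  have hβ := he.β_pos
  have hδ := he.δ_pos
  have := odds_pos (tendsto_path he h0).2.1
  unfold perronInf
  positivity

theorem perronInf_le (he : e.TwoState) (h0 : e.share 0 = e.δ / (e.β + e.δ)) (q : ℕ × Fin 2) :
    e.perronInf ≤ e.perron (e.stateAfter q) := by
  have hβ := he.β_pos
  have hδ := he.δ_pos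
  have hneg := (tendsto_path he h0).2.1
  obtain ⟨n, s⟩ := q
  revert s
  refine Fin.forall_fin_two.2 ⟨?_, ?_⟩
  · rw [perron_stateAfter he]
    simp only [nextCount, odds_path_zero he h0]
    rw [mul_div_cancel_left₀ _ (div_pos hβ hδ).ne', perronInf, div_le_iff₀ (odds_pos hneg)]
    have h1 := Real.exp_le_exp.2 (path_poor_le_limit he h0 n)
    have h2 := Real.exp_le_exp.2 (path_poor_le_limit he h0 0)
    rw [path, resetPromise_poor he, ← bestPromise_eq_log h0, exp_bestPromise he.toRegular] at h2
    have h3 : 1 - e.δ / (e.β + e.δ) = e.β / e.δ * (e.δ / (e.β + e.δ)) := by field_simp; ring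
    have h4 : (1 - Real.exp e.limitPromise) * odds e.limitPromise = Real.exp e.limitPromise := by
      rw [odds, mul_div_cancel₀ _ (one_sub_exp_pos hneg).ne']
    nlinarith [mul_le_mul_of_nonneg_right h1 (odds_pos hneg).le]
  · rw [perron_stateAfter he, perronInf]
    have h1 := (Real.exp_lt_exp.2 (path_rich he n).2).le
    rw [exp_bestPromise he.toRegular] at h1
    have h2 := odds_le_odds (path_poor_le_limit he h0 (n + 1)) hneg
    have h3 := odds_pos (path_neg he (n + 1) 0)
    have h4 := one_sub_exp_pos (path_neg he n 1)
    have h5 : e.δ / (e.β + e.δ) ≤ 1 - Real.exp (e.path n 1) := by linarith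
    simp only [nextCount]
    gcongr

theorem tendsto_perron (he : e.TwoState) (h0 : e.share 0 = e.δ / (e.β + e.δ)) :
    Tendsto (fun n => e.perron (e.stateAfter (n, 1))) atTop (𝓝 e.perronInf) := by
  obtain ⟨h1, h2, h3⟩ := tendsto_path he h0
  have hodds : Tendsto (fun n => odds (e.path (n + 1) 0)) atTop (𝓝 (odds e.limitPromise)) := by
    have h4 := Real.continuous_exp.continuousAt.tendsto.comp ((tendsto_add_atTop_iff_nat 1).2 h1)
    exact h4.div (h4.const_sub 1) (one_sub_exp_pos h2).ne'
  have h5 := (((Real.continuous_exp.continuousAt.tendsto.comp h3).const_sub 1).const_mul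
    (e.β / e.δ)).div hodds (odds_pos h2).ne'
  rw [exp_bestPromise he.toRegular, sub_sub_cancel] at h5
  exact h5.congr fun n => (perron_stateAfter he (n, 1)).symm

theorem isPerronPair_perron (he : e.TwoState) (h0 : e.share 0 = e.δ / (e.β + e.δ)) :
    e.IsPerronPair (range e.stateAfter) e.δ e.perron := by
  refine ⟨⟨_, _, perronInf_pos he h0, forall_mem_range.2 fun q =>
    ⟨perronInf_le he h0 q, perron_le he h0 q⟩⟩, forall_mem_range.2 fun q => ?_⟩
  have h := hasSum_statePrice_mul_perron he h0 q fun _ => 1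
  simpa [he.prob_sum] using h

/-- A bounded solution of the eigenvector equation of the chain is constant. -/
theorem bounded_eigenvector_const {H : ℕ → ℝ} {p q θ m M : ℝ} (hp : 0 ≤ p) (hq : 0 < q)
    (hpq : p + q = 1) (hθ : 0 ≤ θ) (hm : 0 < m) (hmH : ∀ n, m ≤ H n) (hHM : ∀ n, H n ≤ M)
    (h : ∀ n, H n = θ * (p * H 0 + q * H (n + 1))) : θ = 1 ∧ ∀ n, H n = H 0 := by
  have hb : BddBelow (range H) := ⟨m, forall_mem_range.2 hmH⟩
  have ha : BddAbove (range H) := ⟨M, forall_mem_range.2 hHM⟩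
  have hS : ⨆ n, H n ≤ θ * ⨆ n, H n := by
    refine ciSup_le fun n => ?_
    rw [h n]
    refine mul_le_mul_of_nonneg_left ?_ hθ
    have h1 := mul_le_mul_of_nonneg_left (le_ciSup ha 0) hp
    have h2 := mul_le_mul_of_nonneg_left (le_ciSup ha (n + 1)) hq.le
    calc _ ≤ p * (⨆ n, H n) + q * ⨆ n, H n := add_le_add h1 h2
      _ = _ := by rw [← add_mul, hpq, one_mul]
  have hI : θ * ⨅ n, H n ≤ ⨅ n, H n := by
    refine le_ciInf fun n => ?_
    rw [h n]
    refine mul_le_mul_of_nonneg_left ?_ hθ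
    have h1 := mul_le_mul_of_nonneg_left (ciInf_le hb 0) hp
    have h2 := mul_le_mul_of_nonneg_left (ciInf_le hb (n + 1)) hq.le
    calc _ = p * (⨅ n, H n) + q * ⨅ n, H n := by rw [← add_mul, hpq, one_mul]
      _ ≤ _ := add_le_add h1 h2
  have hIpos : 0 < ⨅ n, H n := hm.trans_le (le_ciInf hmH)
  have hSpos : 0 < ⨆ n, H n := hm.trans_le ((hmH 0).trans (le_ciSup ha 0))
  have hθ1 : θ = 1 := by
    refine le_antisymm ?_ ?_
    · by_contra! hc
      nlinarith
    · by_contra! hc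
      nlinarith
  refine ⟨hθ1, fun n => ?_⟩
  induction n with
  | zero => rfl
  | succ n ih =>
    have h1 := h n
    rw [hθ1, one_mul, ih] at h1
    have h2 : q * (H (n + 1) - H 0) = 0 := by linear_combination -h1 - H 0 * hpq
    rcases mul_eq_zero.1 h2 with h3 | h3
    · exact absurd h3 hq.ne'
    · linarith

theorem perron_unique (he : e.TwoState) (h0 : e.share 0 = e.δ / (e.β + e.δ)) {ϱ : ℝ}
    {ψ : State (Fin 2) → ℝ} (hψ : e.IsPerronPair (range e.stateAfter) ϱ ψ) :
    ∃ k, 0 < k ∧ ∀ q, ψ (e.stateAfter q) = k * e.perron (e.stateAfter q) := by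
  obtain ⟨⟨m, M, hm, hmM⟩, hE⟩ := hψ
  have hδ := he.δ_pos
  have hp := he.prob_pos 0
  have hq := he.prob_pos 1
  have hpq : e.prob 0 + e.prob 1 = 1 := by rw [prob_one he.toRegular]; ring
  set h : State (Fin 2) → ℝ := fun x => ψ x / e.perron x with hh
  have hψh : ∀ q, ψ (e.stateAfter q) = h (e.stateAfter q) * e.perron (e.stateAfter q) := fun q => by
    rw [hh, div_mul_cancel₀ _ (perron_pos he q).ne']
  have hbest : 0 < e.δ / (e.β + e.δ) := div_pos hδ (add_pos he.β_pos hδ)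
  have hIpos := perronInf_pos he h0
  have hhm : ∀ q, m / (e.δ / (e.β + e.δ)) ≤ h (e.stateAfter q) := fun q => by
    have h1 := (hmM _ ⟨q, rfl⟩).1
    exact div_le_div₀ (hm.le.trans h1) h1 (perron_pos he q) (perron_le he h0 q)
  have hhM : ∀ q, h (e.stateAfter q) ≤ M / e.perronInf := fun q => by
    have h1 := hmM _ ⟨q, rfl⟩
    exact div_le_div₀ (hm.le.trans (h1.1.trans h1.2)) h1.2 hIpos (perronInf_le he h0 q)
  have hhpos : ∀ q, 0 < h (e.stateAfter q) := fun q => (div_pos hm hbest).trans_le (hhm q)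
  set H : ℕ → ℝ := fun n => ∑ r, e.prob r * h (e.stateAfter (n, r)) with hH
  have heq : ∀ q, ϱ * h (e.stateAfter q) = e.δ * H (nextCount q) := by
    intro q
    have h1 := hasSum_statePrice_mul_perron he h0 q h
    have h2 : HasSum (fun x : range e.stateAfter => e.statePrice (e.stateAfter q) x *
        (h x * e.perron x)) (ϱ * ψ (e.stateAfter q)) := by
      refine (hE _ ⟨q, rfl⟩).congr_fun ?_
      rintro ⟨_, ⟨q', rfl⟩⟩
      rw [hψh]
    have h3 := h2.unique h1
    rw [hψh] at h3
    exact mul_right_cancel₀ (perron_pos he q).ne' (by linear_combination h3)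
  have hHpos : ∀ n, 0 < H n := fun n =>
    Finset.sum_pos (fun r _ => mul_pos (he.prob_pos r) (hhpos _)) Finset.univ_nonempty
  have hϱ : 0 < ϱ := by
    have h1 := heq (0, 0)
    exact pos_of_mul_pos_left (h1 ▸ mul_pos hδ (hHpos _)) (hhpos _).le
  have hθ : ∀ q, h (e.stateAfter q) = e.δ / ϱ * H (nextCount q) := fun q => by
    rw [div_mul_eq_mul_div, eq_div_iff hϱ.ne', ← heq q, mul_comm]
  have hrec : ∀ n, H n = e.δ / ϱ * (e.prob 0 * H 0 + e.prob 1 * H (n + 1)) := by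
    intro n
    have h1 : H n = e.prob 0 * h (e.stateAfter (n, 0)) + e.prob 1 * h (e.stateAfter (n, 1)) :=
      Fin.sum_univ_two _
    rw [h1, hθ, hθ]
    simp only [nextCount]
    ring
  have hsum : ∀ c : ℝ, ∑ r, e.prob r * c = c := fun c => by
    rw [← Finset.sum_mul, he.prob_sum, one_mul]
  obtain ⟨h1, h2⟩ := bounded_eigenvector_const (H := H) (m := m / (e.δ / (e.β + e.δ)))
    (M := M / e.perronInf) hp.le hq hpq (div_pos hδ hϱ).le (div_pos hm hbest)
    (fun n => by
      rw [← hsum (m / (e.δ / (e.β + e.δ)))]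
      exact Finset.sum_le_sum fun r _ => mul_le_mul_of_nonneg_left (hhm _) (he.prob_pos r).le)
    (fun n => by
      rw [← hsum (M / e.perronInf)]
      exact Finset.sum_le_sum fun r _ => mul_le_mul_of_nonneg_left (hhM _) (he.prob_pos r).le)
    hrec
  refine ⟨H 0, hHpos 0, fun q => ?_⟩
  rw [hψh, hθ, h1, one_mul, h2]

theorem martinRoss_eq (he : e.TwoState) (h0 : e.share 0 = e.δ / (e.β + e.δ)) {ϱ : ℝ}
    {ψ : State (Fin 2) → ℝ} (hψ : e.IsPerronPair (range e.stateAfter) ϱ ψ) :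
    martinRoss (range e.stateAfter) ψ =
      Real.log (e.δ / e.β) - Real.log ((Real.exp e.limitPromise)⁻¹ - 1) := by
  obtain ⟨k, hk, hψk⟩ := perron_unique he h0 hψ
  have hβ := he.β_pos
  have hδ := he.δ_pos
  have hneg := (tendsto_path he h0).2.1
  have hsup : IsGreatest (ψ '' range e.stateAfter) (k * (e.δ / (e.β + e.δ))) := by
    constructor
    · exact ⟨_, ⟨(0, 0), rfl⟩, by rw [hψk, perron_zero he h0]⟩
    · rintro _ ⟨_, ⟨q, rfl⟩, rfl⟩
      rw [hψk]
      exact mul_le_mul_of_nonneg_left (perron_le he h0 q) hk.le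
  have hinf : IsGLB (ψ '' range e.stateAfter) (k * e.perronInf) := by
    constructor
    · rintro _ ⟨_, ⟨q, rfl⟩, rfl⟩
      rw [hψk]
      exact mul_le_mul_of_nonneg_left (perronInf_le he h0 q) hk.le
    · intro b hb
      refine ge_of_tendsto' ((tendsto_perron he h0).const_mul k) fun n => ?_
      rw [← hψk]
      exact hb ⟨_, ⟨(n, 1), rfl⟩, rfl⟩
  have hodds := odds_pos hneg
  have hratio : k * (e.δ / (e.β + e.δ)) / (k * e.perronInf) =
      e.δ / e.β * odds e.limitPromise := by
    unfold perronInf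
    field_simp
  have hinv : (Real.exp e.limitPromise)⁻¹ - 1 = (odds e.limitPromise)⁻¹ := by
    have := (Real.exp_pos e.limitPromise).ne'
    rw [odds, inv_div]
    field_simp
  rw [martinRoss, hsup.csSup_eq, hinf.csInf_eq ⟨_, hsup.1⟩, hratio, hinv, Real.log_inv,
    Real.log_mul (div_pos hδ hβ).ne' hodds.ne', sub_neg_eq_add]

end Economy

/-! ### The two-state example -/

section Example

variable {β δ p κ ε : ℝ}

open Economy

theorem exp_limitPromise (hβ : 0 < β) (hδ : 0 < δ) (hp : 0 < p) (hs₁ : 0 < κ + ε)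
    (hs₂ : κ + ε < 1) (hs₀ : κ - ε * (1 - p) / p < 1) :
    Real.exp (twoState β δ p κ ε).limitPromise = chi β δ p κ ε := by
  have h1 : 0 < 1 - κ - ε := by linarith
  have h2 : 0 < 1 - κ + ε * (1 - p) / p := by linarith
  have hs : 1 - (κ + ε) = 1 - κ - ε := by ring
  have hs' : 1 - (κ - ε * (1 - p) / p) = 1 - κ + ε * (1 - p) / p := by ring
  have hb : 1 - δ / (β + δ) = β / (β + δ) := by field_simp; ring
  have hsum : 0 < β + δ := by positivity
  rw [chi, Real.rpow_def_of_pos (div_pos hδ hβ), Real.rpow_def_of_pos (div_pos hsum hδ),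
    Real.rpow_def_of_pos hs₁, Real.rpow_def_of_pos h1]
  rw [← Real.exp_log h2, ← Real.exp_add, ← Real.exp_add, ← Real.exp_add, ← Real.exp_add]
  congr 1
  simp only [limitPromise, autarky, bestPromise, twoState, Fin.sum_univ_two, Matrix.cons_val_zero,
    Matrix.cons_val_one, hs, hs', hb]
  rw [Real.log_div hδ.ne' hβ.ne', Real.log_div hsum.ne' hδ.ne', Real.log_div hδ.ne' hsum.ne',
    Real.log_div hβ.ne' hsum.ne']
  field_simp
  ring

theorem isTwoState_twoState (hβ : 0 < β) (hδ : 0 < δ ∧ δ < 1) (hp : 0 < p ∧ p < 1) (hκ : 1 / 2 ≤ κ)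
    (hε : 0 < ε) {e : Economy (Fin 2)} (he : e = twoState β δ p κ ε) (hs₁ : 0 < e.share 0)
    (hs₂ : e.share 1 < 1) (hpoor : e.share 0 ≤ δ / (β + δ)) (hfb : e.FirstBestViolates 1)
    (hlimit : e.firstBestDebt 1 < e.debtLimit)
    (hreset : e.nextDebt (1, e.firstBestDebt 1) 0 < e.criticalDebt) : e.TwoState := by
  have hp0 : e.prob 0 = p := by rw [he]; rfl
  have hp1 : e.prob 1 = 1 - p := by rw [he]; rfl
  have hβ' : e.β = β := by rw [he]; rfl
  have hδ' : e.δ = δ := by rw [he]; rfl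
  have hsh : 0 < e.share 1 := by
    have : e.share 1 = κ + ε := by rw [he]; rfl
    linarith
  rw [← hβ', ← hδ'] at hpoor
  rw [← hβ'] at hβ
  rw [← hδ'] at hδ
  have hbest1 : e.δ / (e.β + e.δ) < 1 := by
    rw [div_lt_one (by linarith [hδ.1])]
    linarith
  have hdebt : 0 ≤ e.firstBestDebt 1 := by
    rw [firstBestDebt, sub_nonneg, div_le_one hsh]
    exact min_le_right _ _
  have hR : e.Regular :=
    { share_pos := Fin.forall_fin_two.2 ⟨hs₁, hsh⟩
      share_lt_one := Fin.forall_fin_two.2 ⟨hpoor.trans_lt hbest1, hs₂⟩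
      prob_pos := Fin.forall_fin_two.2 ⟨by rw [hp0]; exact hp.1, by rw [hp1]; linarith [hp.2]⟩
      prob_sum := by rw [Fin.sum_univ_two, hp0, hp1]; ring
      β_pos := hβ
      δ_pos := hδ.1
      δ_lt_one := hδ.2
      debtLimit_pos := hdebt.trans_lt hlimit }
  have hfb0 : e.firstBest 0 = e.share 0 := min_eq_right hpoor
  have hrich : e.δ / (e.β + e.δ) < e.share 1 := by
    by_contra! h
    have hfb1 : e.firstBest 1 = e.share 1 := min_eq_right h
    rw [FirstBestViolates, Fin.sum_univ_two, hfb0, hfb1, autarky, Fin.sum_univ_two] at hfb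
    exact lt_irrefl _ hfb
  have hfb1 : e.firstBest 1 = e.δ / (e.β + e.δ) := min_eq_left hrich.le
  have hprom : e.promise 1 (e.firstBestDebt 1) = e.bestPromise := by
    rw [promise, firstBestDebt, hfb1, bestPromise]
    congr 1
    field_simp
    ring
  have hbl : e.bestPromise < e.promise 1 e.debtLimit := by
    rw [← hprom]
    exact hR.promise_lt_promise 1 hdebt hlimit
  have hnext : e.nextDebt (1, e.firstBestDebt 1) 0 =
      e.debt 0 (e.nextPromise 1 e.bestPromise 0) := by
    rw [nextDebt, hprom]
    rfl
  have hmem : e.nextPromise 1 e.bestPromise 0 ∈ e.promises 0 := (policy_spec hR hbl.le).1.2.2.2.1 0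
  have hnn : 0 ≤ e.debt 0 (e.nextPromise 1 e.bestPromise 0) := by
    rw [← hR.debt_log 0]
    exact hR.debt_le_debt 0 hmem.1
  rw [hnext] at hreset
  refine
    { toRegular := hR
      poor := hpoor
      rich := hrich
      violates := ?_
      best_lt := hbl
      criticalDebt_pos := hnn.trans_lt hreset
      next_lt := ?_ }
  · rw [FirstBestViolates, Fin.sum_univ_two, hfb0, hfb1] at hfb
    exact hfb
  · have h := hR.promise_lt_promise 0 hnn hreset
    rwa [hR.promise_debt] at h

end Example

end IntergenInsurance

open IntergenInsurance in
theorem proposition8 (β δ p κ ε : ℝ)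
    (hβ : 0 < β ∧ β ≤ 1) (hδ : 0 < δ ∧ δ < 1) (hp : 0 < p ∧ p < 1)
    (hκ : 1 / 2 ≤ κ) (hε : 0 < ε)
    (e : Economy (Fin 2)) (he : e = twoState β δ p κ ε)
    -- endowment shares are strictly between 0 and 1
    (hs₁ : 0 < e.share 0) (hs₂ : e.share 1 < 1)
    -- the young are poor enough in state 1
    (hpoor : e.share 0 ≤ δ / (β + δ))
    -- the first best violates the participation constraint of the young in state 2
    (hfb : e.FirstBestViolates 1)
    -- the debt limit does not bind, and debt is below the critical level whenever state 1 occurs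
    (hlimit : e.firstBestDebt 1 < e.debtLimit)
    (hreset : e.nextDebt (1, e.firstBestDebt 1) 0 < e.criticalDebt)
    (i : Fin 2) :
    -- the ergodic set
    e.ergodicSet i = {x | ∃ (n : ℕ) (s : Fin 2), x = (s, debtAfter e n s)} ∧
    e.Ergodic (e.ergodicSet i) ∧
    -- the invariant distribution
    (∃ φ : State (Fin 2) → ℝ, e.IsInvariant (e.ergodicSet i) φ ∧
      (∀ φ', e.IsInvariant (e.ergodicSet i) φ' → φ' = φ) ∧
      -- it is the image of a geometric distribution
      (∀ s d, HasSum
        (fun n : {n : ℕ // debtAfter e n s = d} => e.prob s * p * (1 - p) ^ (n : ℕ)) (φ (s, d))) ∧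
      (∀ n, φ (1, debtAfter e n 1) = p * (1 - p) * (1 - p) ^ n) ∧
      -- the probability mass function when the lower bound on debt does not bind
      (e.share 0 = δ / (β + δ) →
        (∀ s, Function.Injective fun n => debtAfter e n s) ∧
        φ (0, e.resetDebt 0) = p ^ 2 ∧ φ (1, e.resetDebt 1) = p * (1 - p) ∧
        ∀ n, 1 ≤ n → ∀ s, φ (s, debtAfter e n s) = φ (s, e.resetDebt s) * (1 - p) ^ n)) ∧
    -- the Martin-Ross measure when the lower bound on debt does not bind
    (e.share 0 = δ / (β + δ) →
      (∃ ϱ ψ, e.IsPerronPair (e.ergodicSet i) ϱ ψ) ∧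
      ∀ ϱ ψ, e.IsPerronPair (e.ergodicSet i) ϱ ψ →
        martinRoss (e.ergodicSet i) ψ =
          Real.log (δ / β) - Real.log ((chi β δ p κ ε)⁻¹ - 1)) := by
  have hT := isTwoState_twoState hβ.1 hδ hp hκ hε he hs₁ hs₂ hpoor hfb hlimit hreset
  have hR := hT.toRegular
  have hp0 : e.prob 0 = p := by rw [he]; rfl
  have hp1 : e.prob 1 = 1 - p := by rw [he]; rfl
  have hβ' : e.β = β := by rw [he]; rfl
  have hδ' : e.δ = δ := by rw [he]; rfl
  have hweight : ∀ n s, e.weight (n, s) = e.prob s * p * (1 - p) ^ n := fun n s => by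
    rw [Economy.weight, hp0, hp1]
  rw [Economy.ergodicSet_eq hT i]
  refine ⟨?_, Economy.ergodic_range hT, ⟨e.invariant, Economy.isInvariant_invariant hT,
    fun φ' hφ' => Economy.invariant_unique hT hφ', fun s d => ?_, fun n => ?_, fun h0 => ?_⟩,
    fun h0 => ?_⟩
  · ext x
    constructor
    · rintro ⟨⟨n, s⟩, rfl⟩
      exact ⟨n, s, rfl⟩
    · rintro ⟨n, s, rfl⟩
      exact ⟨(n, s), rfl⟩
  · simpa only [hweight] using Economy.hasSum_invariant_subtype hR (s, d)
  · rw [Economy.invariant_of_injective hR (Economy.debtAfter_rich_injective hT), hweight, hp1]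
    ring
  · rw [← hβ', ← hδ'] at h0
    have hinj := Economy.debtAfter_injective hT h0
    have hval : ∀ s n, e.invariant (s, debtAfter e n s) = e.prob s * p * (1 - p) ^ n := fun s n => by
      rw [Economy.invariant_of_injective hR (hinj s), hweight]
    have hval0 : ∀ s, e.invariant (s, e.resetDebt s) = e.prob s * p := fun s => by
      simpa [debtAfter] using hval s 0
    refine ⟨hinj, ?_, ?_, fun n _ s => ?_⟩
    · rw [hval0, hp0, sq]
    · rw [hval0, hp1, mul_comm]
    · rw [hval, hval0]
  · rw [← hβ', ← hδ'] at h0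
    refine ⟨⟨_, _, Economy.isPerronPair_perron hT h0⟩, fun ϱ ψ hψ => ?_⟩
    have hs0 : e.share 0 = κ - ε * (1 - p) / p := by rw [he]; rfl
    have hs1 : e.share 1 = κ + ε := by rw [he]; rfl
    have hlim : Real.exp e.limitPromise = chi β δ p κ ε := by
      rw [he]
      exact exp_limitPromise hβ.1 hδ.1 hp.1 (hs1 ▸ hR.share_pos 1) (hs1 ▸ hs₂)
        (hs0 ▸ hR.share_lt_one 0)
    rw [Economy.martinRoss_eq hT h0 hψ, hlim, hβ', hδ']
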